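/- Let $m>1$, $0<p<1$ and let $N>0$ be a real number. Consider nonnegative continuous solutions $w=w(y,\tau)$, in the sense of distributions on $\mathbb{R}\times\mathbb{R}$, of the reaction-convection-diffusion equation $$w_\tau=(w^m)_{yy}+\frac{N(m-1)+2(m+1)}{m-1}(w^m)_y+\frac{2m(N(m-1)+2)}{(m-1)^2}w^m+w^p. \qquad (*)$$ A \emph{traveling wave} with speed $c\in\mathbb{R}$ is a solution of $(*)$ of the form $w(y,\tau)=f(y-c\tau)$ with $f\not\equiv0$; $f$ is its profile. It is called \emph{good} if $F(\xi)=\xi^{2/(m-1)}f(\ln\xi)$, $\xi>0$, satisfies $F(\xi)\to A$ for some $A>0$, $F'(\xi)\to0$ and $\xi^{N-1}F'(\xi)\to0$ as $\xi\to0^+$ (the last condition follows from the second if $N\ge1$). (i) If $m+p\ge2$, there exists a unique $c^*>0$ with the following properties. A good traveling wave with speed $c\in\mathbb{R}$ exists if and only if $c\ge c^*$, and its profile is then unique up to translations. All these waves are compactly supported to the right: there is $y_0\in\mathbb{R}$ with $f>0$ on $(-\infty,y_0)$ and $f=0$ on $[y_0,\infty)$. If moreover $m+p>2$, then the good traveling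 wave with minimal speed $c=c^*$ has an interface of Type I, that is, for some $C>0$, $$f(y)\sim C(y_0-y)_+^{1/(m-1)}\quad\text{as } y\to y_0,\ y<y_0,$$ while all the good traveling waves with speed $c>c^*$ have an interface of Type II, that is, for some $C>0$, $$f(y)\sim C(y_0-y)_+^{1/(1-p)}\quad\text{as } y\to y_0,\ y<y_0.$$ (ii) If $m+p<2$, then $(*)$ has no traveling waves, good or not, of any speed $c\in\mathbb{R}$. -/

import Mathlib

open Filter Topology MeasureTheory
open scoped ContDiff

noncomputable section

/-- Convection coefficient `(N(m-1) + 2(m+1)) / (m-1)`. -/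
def convCoeff (m N : ℝ) : ℝ := (N * (m - 1) + 2 * (m + 1)) / (m - 1)

/-- Coefficient `2m(N(m-1) + 2) / (m-1)^2` of the zero-order term `w^m`. -/
def reactCoeff (m N : ℝ) : ℝ := 2 * m * (N * (m - 1) + 2) / (m - 1) ^ 2

/-- `w = w(y, τ)` is a continuous nonnegative (eternal) solution, in the sense of distributions on
`ℝ × ℝ`, of
`w_τ = (w^m)_yy + convCoeff m N * (w^m)_y + reactCoeff m N * w^m + w^p`.
All derivatives are moved to the test function `φ`, a smooth compactly supported function
of `(y, τ)`. -/
structure IsSolution (m p N : ℝ) (w : ℝ → ℝ → ℝ) : Prop where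
  continuous : Continuous fun z : ℝ × ℝ => w z.1 z.2
  nonneg : ∀ y τ, 0 ≤ w y τ
  weak : ∀ φ : ℝ × ℝ → ℝ, ContDiff ℝ ∞ φ → HasCompactSupport φ →
    ∫ z : ℝ × ℝ,
      (w z.1 z.2 * deriv (fun τ => φ (z.1, τ)) z.2
        + w z.1 z.2 ^ m * iteratedDeriv 2 (fun y => φ (y, z.2)) z.1
        - convCoeff m N * w z.1 z.2 ^ m * deriv (fun y => φ (y, z.2)) z.1
        + reactCoeff m N * w z.1 z.2 ^ m * φ z
        + w z.1 z.2 ^ p * φ z) = 0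

/-- `f` is the profile of a (nontrivial, nonnegative) traveling wave advancing to the right with
speed `c`, that is, `w(y, τ) = f(y - cτ)` is a solution. -/
structure IsTravelingWave (m p N c : ℝ) (f : ℝ → ℝ) : Prop where
  solution : IsSolution m p N fun y τ => f (y - c * τ)
  ne_zero : f ≠ 0

/-- The profile of `u(r, t) = r^(2/(m-1)) w(log r, t)` when `w` has profile `f`. -/
def radialProfile (m : ℝ) (f : ℝ → ℝ) (ξ : ℝ) : ℝ := ξ ^ (2 / (m - 1)) * f (Real.log ξ)

/-- The profile `F` in the radial variable satisfies `F(0) = A > 0` and `F'(0) = 0`, with no flux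
through the origin, `ξ^(N-1) F'(ξ) → 0`. The flux condition follows from `F'(0) = 0` if `N ≥ 1`;
it is the natural form of `F'(0) = 0` if the real parameter `N` is less than `1`. -/
def RegularAtOrigin (m N : ℝ) (f : ℝ → ℝ) : Prop :=
  (∃ A : ℝ, 0 < A ∧ Tendsto (radialProfile m f) (𝓝[>] 0) (𝓝 A)) ∧
  Tendsto (deriv (radialProfile m f)) (𝓝[>] 0) (𝓝 0) ∧
  Tendsto (fun ξ => ξ ^ (N - 1) * deriv (radialProfile m f) ξ) (𝓝[>] 0) (𝓝 0)

/-- A traveling wave whose radial profile is good at the origin. -/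
def IsGoodTravelingWave (m p N c : ℝ) (f : ℝ → ℝ) : Prop :=
  IsTravelingWave m p N c f ∧ RegularAtOrigin m N f

/-- `f` is compactly supported to the right, with its interface at `y₀`. -/
def HasInterfaceAt (f : ℝ → ℝ) (y₀ : ℝ) : Prop :=
  (∀ y, y < y₀ → 0 < f y) ∧ ∀ y, y₀ ≤ y → f y = 0

/-- `f(y) ~ C (y₀ - y)^κ` as `y → y₀` from the left, for some `C > 0`. -/
def InterfaceBehavior (f : ℝ → ℝ) (y₀ κ : ℝ) : Prop :=
  ∃ C : ℝ, 0 < C ∧ Tendsto (fun y => f y / (y₀ - y) ^ κ) (𝓝[<] y₀) (𝓝 C)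

/-- Interface of Type I: `f(y) ~ C (y₀ - y)_+^{1/(m-1)}`. -/
def HasTypeI (m : ℝ) (f : ℝ → ℝ) : Prop :=
  ∃ y₀, HasInterfaceAt f y₀ ∧ InterfaceBehavior f y₀ (1 / (m - 1))

/-- Interface of Type II: `f(y) ~ C (y₀ - y)_+^{1/(1-p)}`. -/
def HasTypeII (p : ℝ) (f : ℝ → ℝ) : Prop :=
  ∃ y₀, HasInterfaceAt f y₀ ∧ InterfaceBehavior f y₀ (1 / (1 - p))

end

noncomputable section

/-!
A wave with speed `c` is a profile `f` with `(f^m)'' + (k + l) (f^m)' + k l f^m + c f' + f^p = 0`,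
where `k = 2m/(m-1)` and `l = N + 2/(m-1)`. Its interface exists because the flux
`(f^m)' + (k + l) f^m + c f` decreases; near the interface that flux is at least of order
`f^(m+p-1)` and at most of order `f`, which excludes `m + p < 2`. Where `f` is positive and
decreasing, `P = -(f^m)'` as a function of `s = f` solves the first-order equation
`dP/ds = c + (k + l) m s^(m-1) - m s^(m-1) (k l s^m + s^p) / P`.

A wave is good exactly if its orbit satisfies `P = k s^m + O(s)` as `s → ∞`. For each `c > 0` there
is exactly one such orbit; it decreases with `c` and depends continuously on it. Conversely, since
`P` is bounded below by a multiple of `s^(m+p-1)` and `p < 1`, the profile reaches zero in finite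
distance, and it is a solution across its interface if and only if `P → 0` as `s → 0`. This singles
out the speeds `c ≥ c^*`. When `m + p > 2`, an orbit starting at the origin has either `P ~ c s` or
`P ~ (m/c) s^(m+p-1)`. By continuity the critical orbit is of the first kind; the orbits of larger
speed lie below it, hence are of the second kind. Integrating `-m f^(m-1) f' = P(f)` turns these
two laws into the interfaces of Type I and Type II.
-/

/-! ### Test functions -/

/-- A test function: a smooth compactly supported real function, as in `IsSolution`. -/
structure IsTestFunction {E : Type*} [NormedAddCommGroup E] [NormedSpace ℝ E] (φ : E → ℝ) :
    Prop where
  contDiff : ContDiff ℝ ∞ φ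
  hasCompactSupport : HasCompactSupport φ

namespace IsTestFunction

section

variable {E : Type*} [NormedAddCommGroup E] [NormedSpace ℝ E] {φ χ : E → ℝ}

theorem continuous (hφ : IsTestFunction φ) : Continuous φ := hφ.contDiff.continuous

theorem differentiable (hφ : IsTestFunction φ) : Differentiable ℝ φ :=
  hφ.contDiff.differentiable (by simp)

theorem sub_const_mul (hφ : IsTestFunction φ) (hχ : IsTestFunction χ) (r : ℝ) :
    IsTestFunction fun x => φ x - r * χ x :=
  ⟨hφ.contDiff.sub (contDiff_const.mul hχ.contDiff),
    hφ.hasCompactSupport.sub hχ.hasCompactSupport.mul_left⟩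

theorem fderiv_apply (hφ : IsTestFunction φ) (v : E) : IsTestFunction fun z => fderiv ℝ φ z v :=
  ⟨(hφ.contDiff.fderiv_right (m := ∞) (by simp)).clm_apply contDiff_const,
    (hφ.hasCompactSupport.fderiv (𝕜 := ℝ)).comp_left (g := fun L : E →L[ℝ] ℝ => L v) (by simp)⟩

theorem integrable_mul [MeasurableSpace E] [OpensMeasurableSpace E]
    {μ : Measure E} [IsFiniteMeasureOnCompacts μ] (hφ : IsTestFunction φ) {u : E → ℝ}
    (hu : Continuous u) : Integrable (fun x => u x * φ x) μ :=
  (hu.mul hφ.continuous).integrable_of_hasCompactSupport hφ.hasCompactSupport.mul_left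

theorem integrable [MeasurableSpace E] [OpensMeasurableSpace E]
    {μ : Measure E} [IsFiniteMeasureOnCompacts μ] (hφ : IsTestFunction φ) : Integrable φ μ :=
  hφ.continuous.integrable_of_hasCompactSupport hφ.hasCompactSupport

end

section

variable {ψ : ℝ → ℝ}

protected theorem deriv (hψ : IsTestFunction ψ) : IsTestFunction (deriv ψ) :=
  ⟨(contDiff_infty_iff_deriv.1 hψ.contDiff).2, hψ.hasCompactSupport.deriv⟩

theorem hasDerivAt (hψ : IsTestFunction ψ) (x : ℝ) : HasDerivAt ψ (deriv ψ x) x :=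
  (hψ.differentiable x).hasDerivAt

theorem deriv_sub_const_mul {η : ℝ → ℝ} (hψ : IsTestFunction ψ) (hη : IsTestFunction η) (r : ℝ) :
    deriv (fun x => ψ x - r * η x) = fun x => deriv ψ x - r * deriv η x :=
  funext fun x => ((hψ.hasDerivAt x).sub ((hη.hasDerivAt x).const_mul r)).deriv

theorem integral_deriv_eq_zero (hψ : IsTestFunction ψ) : ∫ x, deriv ψ x = 0 :=
  integral_eq_zero_of_hasDerivAt_of_integrable hψ.hasDerivAt hψ.deriv.integrable hψ.integrable

theorem integral_mul_deriv {u u' : ℝ → ℝ} (hψ : IsTestFunction ψ)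
    (hu : ∀ x, HasDerivAt u (u' x) x) (hc : Continuous u') :
    ∫ x, u x * deriv ψ x = -∫ x, u' x * ψ x := by
  have huc : Continuous u := continuous_iff_continuousAt.2 fun x => (hu x).continuousAt
  exact integral_mul_deriv_eq_deriv_mul_of_integrable (fun x _ => hu x)
    (fun x _ => hψ.hasDerivAt x) (hψ.deriv.integrable_mul huc) (hψ.integrable_mul hc)
    (hψ.integrable_mul huc)

end

end IsTestFunction

theorem exists_isTestFunction_integral_eq_one :
    ∃ η : ℝ → ℝ, IsTestFunction η ∧ ∫ x, η x = 1 := by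
  let b : ContDiffBump (0 : ℝ) := ⟨1, 2, one_pos, one_lt_two⟩
  exact ⟨b.normed volume, ⟨b.contDiff_normed, b.hasCompactSupport_normed⟩, b.integral_normed⟩

theorem exists_forall_hasDerivAt {g : ℝ → ℝ} (hg : Continuous g) :
    ∃ G : ℝ → ℝ, ∀ x, HasDerivAt G (g x) x :=
  ⟨fun x => ∫ t in (0 : ℝ)..x, g t, fun _ => (hg.integral_hasStrictDerivAt _ _).hasDerivAt⟩

theorem continuous_of_forall_hasDerivAt {u u' : ℝ → ℝ} (h : ∀ x, HasDerivAt u (u' x) x) :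
    Continuous u :=
  continuous_iff_continuousAt.2 fun x => (h x).continuousAt

theorem IsTestFunction.exists_eq_deriv {θ : ℝ → ℝ} (hθ : IsTestFunction θ)
    (h0 : ∫ x, θ x = 0) : ∃ ψ : ℝ → ℝ, IsTestFunction ψ ∧ θ = deriv ψ := by
  obtain ⟨R, hR⟩ := hθ.hasCompactSupport.isCompact.isBounded.subset_closedBall 0
  have hzero : ∀ x, x ∉ Set.Icc (-R) R → θ x = 0 := fun x hx =>
    image_eq_zero_of_notMem_tsupport fun h => hx (by simpa [Real.closedBall_eq_Icc] using hR h)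
  let ψ : ℝ → ℝ := fun x => ∫ t in Set.Iic x, θ t
  have hd : ∀ x, HasDerivAt ψ (θ x) x := fun x => by
    have hsplit : ψ = fun y => (∫ t in Set.Iic 0, θ t) + ∫ t in (0 : ℝ)..y, θ t := funext fun y =>
      (add_eq_of_eq_sub' (intervalIntegral.integral_Iic_sub_Iic
        hθ.integrable.integrableOn hθ.integrable.integrableOn).symm).symm
    rw [hsplit]
    exact (hθ.continuous.integral_hasStrictDerivAt _ _).hasDerivAt.const_add _
  have hder : deriv ψ = θ := funext fun x => (hd x).deriv
  refine ⟨ψ, ⟨?_, ?_⟩, hder.symm⟩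
  · rw [contDiff_infty_iff_deriv]
    exact ⟨fun x => (hd x).differentiableAt, by rw [hder]; exact hθ.contDiff⟩
  · refine HasCompactSupport.intro (isCompact_Icc (a := -R) (b := R)) fun x hx => ?_
    rw [Set.mem_Icc, not_and_or, not_le, not_le] at hx
    rcases hx with hx | hx
    · exact setIntegral_eq_zero_of_forall_eq_zero fun t ht =>
        hzero t fun h => absurd (h.1.trans ht) (not_le.2 hx)
    · rw [← h0]
      exact setIntegral_eq_integral_of_forall_compl_eq_zero fun t ht =>
        hzero t fun h => ht (h.2.trans hx.le)

theorem IsTestFunction.exists_sub_eq_deriv {θ η : ℝ → ℝ} (hθ : IsTestFunction θ)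
    (hη : IsTestFunction η) (hη1 : ∫ x, η x = 1) :
    ∃ ψ, IsTestFunction ψ ∧ (fun x => θ x - (∫ t, θ t) * η x) = deriv ψ := by
  refine (hθ.sub_const_mul hη _).exists_eq_deriv ?_
  rw [integral_sub hθ.integrable (hη.integrable.const_mul _), integral_const_mul, hη1, mul_one,
    sub_self]

/-! ### Distributional equations on the line -/

section Distributions

variable {u v g h : ℝ → ℝ}

theorem exists_integral_eq_const_mul_integral (hu : Continuous u) (hv : Continuous v)
    (H : ∀ ψ, IsTestFunction ψ → ∫ x, (u x * deriv (deriv ψ) x + v x * deriv ψ x) = 0) :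
    ∃ C : ℝ, ∀ θ, IsTestFunction θ → ∫ x, (u x * deriv θ x + v x * θ x) = C * ∫ x, θ x := by
  obtain ⟨η, hη, hη1⟩ := exists_isTestFunction_integral_eq_one
  have hint : ∀ {θ}, IsTestFunction θ → Integrable fun x => u x * deriv θ x + v x * θ x :=
    fun hθ => (hθ.deriv.integrable_mul hu).add (hθ.integrable_mul hv)
  refine ⟨∫ x, (u x * deriv η x + v x * η x), fun θ hθ => ?_⟩
  obtain ⟨ψ, hψ, hθψ⟩ := hθ.exists_sub_eq_deriv hη hη1
  have hzero := H ψ hψ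
  rw [← hθψ, hθ.deriv_sub_const_mul hη] at hzero
  have hsplit : ∀ x, u x * (deriv θ x - (∫ t, θ t) * deriv η x)
      + v x * (θ x - (∫ t, θ t) * η x) = (u x * deriv θ x + v x * θ x)
        - (∫ t, θ t) * (u x * deriv η x + v x * η x) := fun x => by ring
  simp only [hsplit] at hzero
  rw [integral_sub (hint hθ) ((hint hη).const_mul _), integral_const_mul, sub_eq_zero] at hzero
  rw [hzero, mul_comm]

theorem eq_const_of_integral_mul_eq (hu : Continuous u) {C : ℝ}
    (H : ∀ θ, IsTestFunction θ → ∫ x, u x * θ x = C * ∫ x, θ x) (x : ℝ) : u x = C := by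
  have hae : ∀ᵐ x, u x - C = 0 := by
    refine ae_eq_zero_of_integral_contDiff_smul_eq_zero
      (hu.sub continuous_const).locallyIntegrable fun θ hθ hs => ?_
    have hθ : IsTestFunction θ := ⟨hθ, hs⟩
    simp only [smul_eq_mul, mul_comm (θ _), sub_mul]
    rw [integral_sub (hθ.integrable_mul hu) (hθ.integrable.const_mul _), integral_const_mul,
      H θ hθ, sub_self]
  exact sub_eq_zero.1 (congrFun ((Continuous.ae_eq_iff_eq volume (hu.sub continuous_const)
    continuous_const).1 hae) x)

theorem hasDerivAt_of_integral_mul_deriv_eq_neg (hu : Continuous u) (hg : Continuous g)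
    (H : ∀ ψ, IsTestFunction ψ → ∫ x, u x * deriv ψ x = -∫ x, g x * ψ x) (x : ℝ) :
    HasDerivAt u (g x) x := by
  obtain ⟨G, hG⟩ := exists_forall_hasDerivAt hg
  have hGc := continuous_of_forall_hasDerivAt hG
  obtain ⟨C, hC⟩ := exists_integral_eq_const_mul_integral (u := fun _ => 0)
    (v := fun x => u x - G x) continuous_const (hu.sub hGc) fun ψ hψ => by
      simp only [zero_mul, zero_add, sub_mul]
      rw [integral_sub (hψ.deriv.integrable_mul hu) (hψ.deriv.integrable_mul hGc), H ψ hψ,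
        hψ.integral_mul_deriv hG hg, sub_self]
  have hconst := eq_const_of_integral_mul_eq (hu.sub hGc) (C := C) (by simpa using hC)
  rw [show u = fun y => C + G y from funext fun y => sub_eq_iff_eq_add.1 (hconst y)]
  exact (hG x).const_add C

/-- The left-hand side of the equation `u'' + g' + h = 0`, tested against `ψ`. -/
def weakForm (u g h ψ : ℝ → ℝ) : ℝ :=
  ∫ x, (u x * deriv (deriv ψ) x - g x * deriv ψ x + h x * ψ x)

theorem IsTestFunction.weakForm_eq {ψ : ℝ → ℝ} (hψ : IsTestFunction ψ) (hu : Continuous u)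
    (hg : Continuous g) (hh : Continuous h) :
    weakForm u g h ψ
      = (∫ x, u x * deriv (deriv ψ) x) - (∫ x, g x * deriv ψ x) + ∫ x, h x * ψ x := by
  have hu' : Integrable fun x => u x * deriv (deriv ψ) x := hψ.deriv.deriv.integrable_mul hu
  have hg' : Integrable fun x => g x * deriv ψ x := hψ.deriv.integrable_mul hg
  rw [← integral_sub hu' hg']
  exact integral_add (hu'.sub hg') (hψ.integrable_mul hh)

theorem IsTestFunction.weakForm_eq_zero {ψ Φ : ℝ → ℝ} (hψ : IsTestFunction ψ) (hg : Continuous g)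
    (hh : Continuous h) (hu : ∀ y, HasDerivAt u (Φ y - g y) y)
    (hΦ : ∀ y, HasDerivAt Φ (-h y) y) : weakForm u g h ψ = 0 := by
  have hΦc := continuous_of_forall_hasDerivAt hΦ
  have hu' := hψ.deriv.integral_mul_deriv hu (hΦc.sub hg)
  have hΦ' := hψ.integral_mul_deriv hΦ hh.neg
  simp only [sub_mul, neg_mul] at hu' hΦ'
  rw [integral_neg] at hΦ'
  rw [integral_sub (hψ.deriv.integrable_mul hΦc) (hψ.deriv.integrable_mul hg)] at hu'
  rw [hψ.weakForm_eq (continuous_of_forall_hasDerivAt hu) hg hh]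
  linarith

theorem exists_flux_of_weakForm_eq_zero (hu : Continuous u) (hg : Continuous g)
    (hh : Continuous h) (H : ∀ ψ, IsTestFunction ψ → weakForm u g h ψ = 0) :
    ∃ Φ : ℝ → ℝ, (∀ y, HasDerivAt u (Φ y - g y) y) ∧ ∀ y, HasDerivAt Φ (-h y) y := by
  obtain ⟨K, hK⟩ := exists_forall_hasDerivAt hh
  have hKc := continuous_of_forall_hasDerivAt hK
  have hv : Continuous fun x => -g x - K x := hg.neg.sub hKc
  obtain ⟨C, hC⟩ := exists_integral_eq_const_mul_integral (u := u) (v := fun x => -g x - K x)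
    hu hv fun ψ hψ => by
      have hψ0 := H ψ hψ
      have hKψ := hψ.integral_mul_deriv hK hh
      rw [hψ.weakForm_eq hu hg hh] at hψ0
      have hsplit : ∀ x, (-g x - K x) * deriv ψ x = -(g x * deriv ψ x + K x * deriv ψ x) :=
        fun x => by ring
      rw [integral_add (hψ.deriv.deriv.integrable_mul hu) (hψ.deriv.integrable_mul hv)]
      simp only [hsplit]
      rw [integral_neg,
        integral_add (hψ.deriv.integrable_mul hg) (hψ.deriv.integrable_mul hKc)]
      linarith
  refine ⟨fun x => -C - K x, fun y => ?_, fun y => (hK y).const_sub _⟩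
  refine hasDerivAt_of_integral_mul_deriv_eq_neg hu (g := fun x => -C - K x - g x) (by fun_prop)
    (fun ψ hψ => ?_) y
  have hψC := hC ψ hψ
  rw [integral_add (hψ.deriv.integrable_mul hu) (hψ.integrable_mul hv)] at hψC
  have hsplit : ∀ x, (-C - K x - g x) * ψ x = (-g x - K x) * ψ x - C * ψ x := fun x => by ring
  simp only [hsplit]
  rw [integral_sub (hψ.integrable_mul hv) (hψ.integrable.const_mul C), integral_const_mul]
  linarith

theorem exists_flux_iff_weakForm_eq_zero (hu : Continuous u) (hg : Continuous g)
    (hh : Continuous h) :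
    (∃ Φ : ℝ → ℝ, (∀ y, HasDerivAt u (Φ y - g y) y) ∧ ∀ y, HasDerivAt Φ (-h y) y) ↔
      ∀ ψ, IsTestFunction ψ → weakForm u g h ψ = 0 :=
  ⟨fun ⟨_, hΦu, hΦ⟩ _ hψ => hψ.weakForm_eq_zero hg hh hΦu hΦ,
    exists_flux_of_weakForm_eq_zero hu hg hh⟩

end Distributions

/-! ### The traveling wave equation in the moving frame -/

/-- The partial derivative of `φ` in its first variable. It is a component of `fderiv`, hence again
a smooth function of both variables. -/
def partialFst (φ : ℝ × ℝ → ℝ) (z : ℝ × ℝ) : ℝ := fderiv ℝ φ z (1, 0)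

/-- The partial derivative of `φ` in its second variable. -/
def partialSnd (φ : ℝ × ℝ → ℝ) (z : ℝ × ℝ) : ℝ := fderiv ℝ φ z (0, 1)

namespace IsTestFunction

variable {φ : ℝ × ℝ → ℝ}

protected theorem partialFst (hφ : IsTestFunction φ) : IsTestFunction (partialFst φ) :=
  hφ.fderiv_apply (1, 0)

protected theorem partialSnd (hφ : IsTestFunction φ) : IsTestFunction (partialSnd φ) :=
  hφ.fderiv_apply (0, 1)

theorem hasDerivAt_fst (hφ : IsTestFunction φ) (y τ : ℝ) :
    HasDerivAt (fun y => φ (y, τ)) (partialFst φ (y, τ)) y :=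
  (hφ.differentiable (y, τ)).hasFDerivAt.comp_hasDerivAt y
    ((hasDerivAt_id y).prodMk (hasDerivAt_const y τ))

theorem hasDerivAt_snd (hφ : IsTestFunction φ) (y τ : ℝ) :
    HasDerivAt (fun τ => φ (y, τ)) (partialSnd φ (y, τ)) τ :=
  (hφ.differentiable (y, τ)).hasFDerivAt.comp_hasDerivAt τ
    ((hasDerivAt_const τ y).prodMk (hasDerivAt_id τ))

theorem deriv_fst (hφ : IsTestFunction φ) (τ : ℝ) :
    deriv (fun y => φ (y, τ)) = fun y => partialFst φ (y, τ) :=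
  funext fun y => (hφ.hasDerivAt_fst y τ).deriv

theorem iteratedDeriv_two_fst (hφ : IsTestFunction φ) (y τ : ℝ) :
    iteratedDeriv 2 (fun y => φ (y, τ)) y = partialFst (partialFst φ) (y, τ) := by
  rw [iteratedDeriv_succ, iteratedDeriv_one, hφ.deriv_fst, hφ.partialFst.deriv_fst]

theorem slice_fst (hφ : IsTestFunction φ) (τ : ℝ) : IsTestFunction fun y => φ (y, τ) :=
  ⟨hφ.contDiff.comp (contDiff_id.prodMk contDiff_const),
    .intro (hφ.hasCompactSupport.isCompact.image continuous_fst) fun y hy => by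
      by_contra hne
      exact hy ⟨(y, τ), subset_tsupport _ hne, rfl⟩⟩

theorem slice_snd (hφ : IsTestFunction φ) (y : ℝ) : IsTestFunction fun τ => φ (y, τ) :=
  ⟨hφ.contDiff.comp (contDiff_const.prodMk contDiff_id),
    .intro (hφ.hasCompactSupport.isCompact.image continuous_snd) fun τ hτ => by
      by_contra hne
      exact hτ ⟨(y, τ), subset_tsupport _ hne, rfl⟩⟩

theorem fst_mul_snd {ψ η : ℝ → ℝ} (hψ : IsTestFunction ψ) (hη : IsTestFunction η) :
    IsTestFunction fun z : ℝ × ℝ => ψ z.1 * η z.2 := by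
  refine ⟨(hψ.contDiff.comp contDiff_fst).mul (hη.contDiff.comp contDiff_snd),
    .intro (hψ.hasCompactSupport.isCompact.prod hη.hasCompactSupport.isCompact) fun z hz => ?_⟩
  rw [Set.mem_prod, not_and_or] at hz
  rcases hz with hz | hz <;> simp only [image_eq_zero_of_notMem_tsupport hz, zero_mul, mul_zero]

end IsTestFunction

/-- The change of variables `(y, τ) ↦ (y - c τ, τ)` from the rest frame to the frame moving with
speed `c`. -/
def shear (c : ℝ) : (ℝ × ℝ) ≃ₜ (ℝ × ℝ) where
  toFun z := (z.1 - c * z.2, z.2)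
  invFun z := (z.1 + c * z.2, z.2)
  left_inv z := by simp
  right_inv z := by simp
  continuous_toFun := by fun_prop
  continuous_invFun := by fun_prop

section MovingFrame

variable {χ : ℝ × ℝ → ℝ} (c : ℝ)

theorem shear_apply (z : ℝ × ℝ) : shear c z = (z.1 - c * z.2, z.2) := rfl

theorem shear_shear_neg (z : ℝ × ℝ) : shear (-c) (shear c z) = z := by
  ext <;> simp [shear]

theorem IsTestFunction.comp_shear (hχ : IsTestFunction χ) :
    IsTestFunction fun z => χ (shear c z) :=
  ⟨hχ.contDiff.comp ((contDiff_fst.sub (contDiff_const.mul contDiff_snd)).prodMk contDiff_snd),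
    hχ.hasCompactSupport.comp_homeomorph (shear c)⟩

theorem integral_comp_shear (A : ℝ × ℝ → ℝ) : ∫ z, A (shear c z) = ∫ z, A z := by
  have hskew : MeasurePreserving (fun z : ℝ × ℝ => (z.1, z.2 - c * z.1))
      (volume.prod volume) (volume.prod volume) :=
    (MeasurePreserving.id volume).skew_product (g := fun τ x => x - c * τ) (by fun_prop)
      (.of_forall fun τ => (measurePreserving_sub_right volume (c * τ)).map_eq)
  have hshear : MeasurePreserving (shear c) volume volume :=
    Measure.measurePreserving_swap.comp (hskew.comp Measure.measurePreserving_swap)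
  exact hshear.integral_comp (shear c).measurableEmbedding A

theorem IsTestFunction.partialFst_comp_shear (hχ : IsTestFunction χ) :
    partialFst (fun z => χ (shear c z)) = fun z => partialFst χ (shear c z) :=
  funext fun z => ((hχ.comp_shear c).hasDerivAt_fst z.1 z.2).unique
    ((hχ.hasDerivAt_fst (z.1 - c * z.2) z.2).comp_sub_const z.1 (c * z.2))

theorem IsTestFunction.partialSnd_comp_shear (hχ : IsTestFunction χ) (z : ℝ × ℝ) :
    partialSnd (fun z => χ (shear c z)) z
      = partialSnd χ (shear c z) - c * partialFst χ (shear c z) := by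
  have hline : HasDerivAt (fun τ => (z.1 - c * τ, τ)) (-c, 1) z.2 := by
    simpa using! (((hasDerivAt_id z.2).const_mul c).const_sub z.1).prodMk (hasDerivAt_id z.2)
  have hchain : HasDerivAt (fun τ => χ (shear c (z.1, τ))) (fderiv ℝ χ (shear c z) (-c, 1)) z.2 :=
    (hχ.differentiable (shear c z)).hasFDerivAt.comp_hasDerivAt
      (f := fun τ => (z.1 - c * τ, τ)) z.2 hline
  rw [((hχ.comp_shear c).hasDerivAt_snd z.1 z.2).unique hchain,
    show ((-c, 1) : ℝ × ℝ) = (0, 1) - c • (1, 0) by simp, map_sub, map_smul]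
  rfl

theorem IsTestFunction.integral_mul_partialSnd (hχ : IsTestFunction χ) {f : ℝ → ℝ}
    (hf : Continuous f) : ∫ z : ℝ × ℝ, f z.1 * partialSnd χ z = 0 := by
  have hslice : ∀ x, ∫ τ, partialSnd χ (x, τ) = 0 := fun x => by
    rw [← (hχ.slice_snd x).integral_deriv_eq_zero]
    exact integral_congr_ae (.of_forall fun τ => (hχ.hasDerivAt_snd x τ).deriv.symm)
  have hint := hχ.partialSnd.integrable_mul (μ := volume) (hf.comp continuous_fst)
  rw [Measure.volume_eq_prod] at hint ⊢
  exact (integral_prod _ hint).trans (by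
    simp only [Function.comp_apply, integral_const_mul, hslice, mul_zero, integral_zero])

variable {f u v g h : ℝ → ℝ}

theorem IsTestFunction.integral_weakForm_slice (hχ : IsTestFunction χ) (hu : Continuous u)
    (hg : Continuous g) (hh : Continuous h) :
    Integrable (fun z : ℝ × ℝ =>
        u z.1 * partialFst (partialFst χ) z - g z.1 * partialFst χ z + h z.1 * χ z) ∧
      ∫ z : ℝ × ℝ, (u z.1 * partialFst (partialFst χ) z - g z.1 * partialFst χ z + h z.1 * χ z)
        = ∫ τ, weakForm u g h fun x => χ (x, τ) := by
  have hint := ((hχ.partialFst.partialFst.integrable_mul (μ := volume)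
    (hu.comp continuous_fst)).sub (hχ.partialFst.integrable_mul (hg.comp continuous_fst))).add
      (hχ.integrable_mul (hh.comp continuous_fst))
  refine ⟨hint, ?_⟩
  simp only [weakForm, hχ.deriv_fst, hχ.partialFst.deriv_fst]
  rw [Measure.volume_eq_prod] at hint ⊢
  exact integral_prod_symm _ hint

theorem IsTestFunction.integral_travelingWave (hχ : IsTestFunction χ) (hf : Continuous f)
    (hu : Continuous u) (hv : Continuous v) (hh : Continuous h) {φ : ℝ × ℝ → ℝ}
    (hφ : φ = fun z => χ (shear c z)) :
    ∫ z : ℝ × ℝ, (f (z.1 - c * z.2) * deriv (fun τ => φ (z.1, τ)) z.2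
        + u (z.1 - c * z.2) * iteratedDeriv 2 (fun y => φ (y, z.2)) z.1
        - v (z.1 - c * z.2) * deriv (fun y => φ (y, z.2)) z.1 + h (z.1 - c * z.2) * φ z)
      = ∫ τ, weakForm u (fun x => c * f x + v x) h fun x => χ (x, τ) := by
  have hφt : IsTestFunction φ := hφ ▸ hχ.comp_shear c
  obtain ⟨hint, hweak⟩ := hχ.integral_weakForm_slice hu
    (g := fun x => c * f x + v x) ((hf.const_mul c).add hv) hh
  have hSnd := hχ.integral_mul_partialSnd hf
  have hsum := integral_add (hχ.partialSnd.integrable_mul (hf.comp continuous_fst)) hint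
  simp only [Function.comp_apply, hSnd, zero_add] at hsum
  rw [← hweak, ← hsum]
  refine .trans (integral_congr_ae (.of_forall fun z => ?_)) (integral_comp_shear c _)
  simp only [(hφt.hasDerivAt_snd _ _).deriv, (hφt.hasDerivAt_fst _ _).deriv,
    hφt.iteratedDeriv_two_fst]
  simp only [hφ, hχ.partialSnd_comp_shear, hχ.partialFst_comp_shear,
    hχ.partialFst.partialFst_comp_shear]
  simp only [shear_apply]
  ring

theorem weakForm_mul_const (u g h ψ : ℝ → ℝ) (r : ℝ) :
    weakForm u g h (fun x => ψ x * r) = weakForm u g h ψ * r := by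
  simp only [weakForm, ← integral_mul_const, deriv_mul_const_field']
  exact integral_congr_ae (.of_forall fun x => by ring)

theorem weakForm_slice_integral_eq_zero_iff :
    (∀ χ : ℝ × ℝ → ℝ, IsTestFunction χ → ∫ τ, weakForm u g h (fun x => χ (x, τ)) = 0) ↔
      ∀ ψ, IsTestFunction ψ → weakForm u g h ψ = 0 := by
  refine ⟨fun H ψ hψ => ?_, fun H χ hχ => ?_⟩
  · obtain ⟨η, hη, hη1⟩ := exists_isTestFunction_integral_eq_one
    simpa only [weakForm_mul_const, integral_const_mul, hη1, mul_one] using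
      H _ (hψ.fst_mul_snd hη)
  · simp only [H _ (hχ.slice_fst _), integral_zero]

theorem isSolution_travelingWave_iff {m p N : ℝ} (hm : 0 < m) (hp : 0 < p) :
    IsSolution m p N (fun y τ => f (y - c * τ)) ↔
      Continuous f ∧ (∀ y, 0 ≤ f y) ∧ ∀ χ : ℝ × ℝ → ℝ, IsTestFunction χ →
        ∫ τ, weakForm (fun x => f x ^ m) (fun x => c * f x + convCoeff m N * f x ^ m)
          (fun x => reactCoeff m N * f x ^ m + f x ^ p) (fun x => χ (x, τ)) = 0 := by
  have htest (hf : Continuous f) {χ φ : ℝ × ℝ → ℝ} (hχ : IsTestFunction χ)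
      (hφ : φ = fun z => χ (shear c z)) := by
    have hfm : Continuous fun x => f x ^ m := hf.rpow_const fun _ => .inr hm.le
    have hfp : Continuous fun x => f x ^ p := hf.rpow_const fun _ => .inr hp.le
    exact hχ.integral_travelingWave c hf hfm (v := fun x => convCoeff m N * f x ^ m)
      (hfm.const_mul _) (h := fun x => reactCoeff m N * f x ^ m + f x ^ p)
      ((hfm.const_mul _).add hfp) hφ
  simp only [add_mul, ← add_assoc] at htest
  constructor
  · rintro ⟨hc, hn, hw⟩
    have hf : Continuous f := by
      simpa only [Function.comp_def, mul_zero, sub_zero] using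
        hc.comp (Continuous.prodMk_left (0 : ℝ))
    refine ⟨hf, fun y => by simpa only [mul_zero, sub_zero] using hn y 0, fun χ hχ => ?_⟩
    rw [← htest hf hχ rfl]
    exact hw _ (hχ.comp_shear c).contDiff (hχ.comp_shear c).hasCompactSupport
  · rintro ⟨hf, hn, hw⟩
    refine ⟨hf.comp (by fun_prop), fun y τ => hn _, fun φ hφ hs => ?_⟩
    have hφt : IsTestFunction φ := ⟨hφ, hs⟩
    rw [htest hf (hφt.comp_shear (-c)) (by simp only [shear_shear_neg])]
    exact hw _ (hφt.comp_shear (-c))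

end MovingFrame

/-- The derivative of `f ^ m` for a profile `f` with flux `Φ`. -/
def profileSlope (m a c : ℝ) (f Φ : ℝ → ℝ) (y : ℝ) : ℝ := Φ y - a * f y ^ m - c * f y

/-- The profile equation `(f^m)'' + a (f^m)' + b f^m + c f' + f^p = 0` in first-order form, with the
flux `Φ = (f^m)' + a f^m + c f`. -/
structure IsProfile (m p a b c : ℝ) (f Φ : ℝ → ℝ) : Prop where
  continuous : Continuous f
  nonneg : ∀ y, 0 ≤ f y
  hasDerivAt_pow : ∀ y, HasDerivAt (fun y => f y ^ m) (profileSlope m a c f Φ y) y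
  hasDerivAt_flux : ∀ y, HasDerivAt Φ (-(b * f y ^ m + f y ^ p)) y

theorem exists_isProfile_iff {m p a b c : ℝ} {f : ℝ → ℝ} (hm : 0 ≤ m) (hp : 0 ≤ p) :
    (∃ Φ, IsProfile m p a b c f Φ) ↔ Continuous f ∧ (∀ y, 0 ≤ f y) ∧
      ∀ ψ, IsTestFunction ψ → weakForm (fun x => f x ^ m) (fun x => c * f x + a * f x ^ m)
        (fun x => b * f x ^ m + f x ^ p) ψ = 0 := by
  have hsub : ∀ s t r : ℝ, s - t - r = s - (r + t) := fun s t r => by ring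
  have hflux : ∀ hf : Continuous f, _ := fun hf =>
    have hfm : Continuous fun x => f x ^ m := hf.rpow_const fun _ => .inr hm
    have hfp : Continuous fun x => f x ^ p := hf.rpow_const fun _ => .inr hp
    exists_flux_iff_weakForm_eq_zero hfm (g := fun x => c * f x + a * f x ^ m)
      ((hf.const_mul c).add (hfm.const_mul a)) (h := fun x => b * f x ^ m + f x ^ p)
      ((hfm.const_mul b).add hfp)
  constructor
  · rintro ⟨Φ, hf, hn, hpow, hΦ⟩
    exact ⟨hf, hn, (hflux hf).1 ⟨Φ, fun y => (hpow y).congr_deriv (hsub _ _ _), hΦ⟩⟩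
  · rintro ⟨hf, hn, hw⟩
    obtain ⟨Φ, hpow, hΦ⟩ := (hflux hf).2 hw
    exact ⟨Φ, hf, hn, fun y => (hpow y).congr_deriv (hsub _ _ _).symm, hΦ⟩

theorem isTravelingWave_iff {m p N c : ℝ} (hm : 0 < m) (hp : 0 < p) {f : ℝ → ℝ} :
    IsTravelingWave m p N c f ↔
      f ≠ 0 ∧ ∃ Φ, IsProfile m p (convCoeff m N) (reactCoeff m N) c f Φ := by
  rw [exists_isProfile_iff hm.le hp.le, ← weakForm_slice_integral_eq_zero_iff,
    ← isSolution_travelingWave_iff c hm hp]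
  exact ⟨fun ⟨hsol, hne⟩ => ⟨hne, hsol⟩, fun ⟨hne, hsol⟩ => ⟨hsol, hne⟩⟩

/-! ### Monotonicity and differential inequalities -/

theorem le_of_hasDerivAt_nonneg {u u' : ℝ → ℝ} {x y : ℝ} (hxy : x ≤ y)
    (hc : ContinuousOn u (Set.Icc x y)) (hd : ∀ t ∈ Set.Ioo x y, HasDerivAt u (u' t) t)
    (h : ∀ t ∈ Set.Ioo x y, 0 ≤ u' t) : u x ≤ u y := by
  rw [← interior_Icc] at hd h
  exact monotoneOn_of_hasDerivWithinAt_nonneg (convex_Icc x y) hc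
    (fun t ht => (hd t ht).hasDerivWithinAt) h (Set.left_mem_Icc.2 hxy)
    (Set.right_mem_Icc.2 hxy) hxy

theorem sub_le_mul_of_hasDerivAt_le {u u' : ℝ → ℝ} {x y C : ℝ} (hxy : x ≤ y)
    (hc : ContinuousOn u (Set.Icc x y)) (hd : ∀ t ∈ Set.Ioo x y, HasDerivAt u (u' t) t)
    (h : ∀ t ∈ Set.Ioo x y, u' t ≤ C) : u y - u x ≤ C * (y - x) := by
  have := le_of_hasDerivAt_nonneg (u := fun t => C * t - u t) (u' := fun t => C - u' t) hxy
    (by fun_prop) (fun t ht => ((hasDerivAt_const_mul C).sub (hd t ht)))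
    (fun t ht => sub_nonneg.2 (h t ht))
  linarith

theorem lt_of_hasDerivAt_neg {u u' : ℝ → ℝ} {x y : ℝ} (hxy : x < y)
    (hc : ContinuousOn u (Set.Icc x y)) (hd : ∀ t ∈ Set.Ioo x y, HasDerivAt u (u' t) t)
    (h : ∀ t ∈ Set.Ioo x y, u' t < 0) : u y < u x := by
  obtain ⟨t, ht, he⟩ := exists_hasDerivAt_eq_slope u u' hxy hc hd
  have hneg : (u y - u x) / (y - x) < 0 := he ▸ h t ht
  rw [div_lt_iff₀ (sub_pos.2 hxy), zero_mul] at hneg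
  exact sub_neg.1 hneg

theorem neg_of_hasDerivAt_neg_of_eq_zero {u u' : ℝ → ℝ} {x y : ℝ} (hxy : x < y)
    (hd : ∀ t ∈ Set.Icc x y, HasDerivAt u (u' t) t) (hx : u x ≤ 0)
    (h : ∀ t ∈ Set.Icc x y, u t = 0 → u' t < 0) : u y < 0 := by
  have hle : ∀ ⦃t⦄, t ∈ Set.Icc x y → u t ≤ 0 :=
    image_le_of_deriv_right_lt_deriv_boundary (B := fun _ => 0) (B' := fun _ => 0)
      (fun t ht => (hd t ht).continuousAt.continuousWithinAt)
      (fun t ht => (hd t (Set.Ico_subset_Icc_self ht)).hasDerivWithinAt) hx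
      (fun _ => hasDerivAt_const _ _) fun t ht => h t (Set.Ico_subset_Icc_self ht)
  have hy : y ∈ Set.Icc x y := Set.right_mem_Icc.2 hxy.le
  refine (hle hy).lt_of_ne fun h0 => ?_
  have hsign := eventually_nhdsWithin_sign_eq_of_deriv_neg
    ((hd y hy).deriv.symm ▸ h y hy h0) h0
  obtain ⟨t, hst, hxt, hty⟩ := ((hsign.filter_mono nhdsWithin_le_nhds).and
    (Ioo_mem_nhdsLT hxy)).exists
  rw [sign_pos (sub_pos.2 hty), sign_eq_one_iff] at hst
  exact hst.not_ge (hle ⟨hxt.le, hty.le⟩)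

theorem le_of_hasDerivAt_nonneg_of_pos {u u' : ℝ → ℝ} {x y : ℝ} (hxy : x ≤ y)
    (hd : ∀ t ∈ Set.Icc x y, HasDerivAt u (u' t) t) (hx : 0 < u x)
    (h : ∀ t ∈ Set.Ico x y, 0 < u t → 0 ≤ u' t) : u x ≤ u y := by
  have hlim : Tendsto (fun ε => u x - ε * (y - x)) (𝓝[>] 0) (𝓝 (u x)) := by
    have : Continuous fun ε => u x - ε * (y - x) := by fun_prop
    exact (this.tendsto' 0 _ (by simp)).mono_left nhdsWithin_le_nhds
  refine le_of_tendsto hlim ?_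
  filter_upwards [hlim.eventually_const_lt hx, self_mem_nhdsWithin] with ε hpos hε
  have := image_le_of_deriv_right_lt_deriv_boundary (f := fun t => - u t) (f' := fun t => - u' t)
    (B := fun t => - u x + ε * (t - x)) (B' := fun _ => ε) (a := x) (b := y)
    (fun t ht => (hd t ht).continuousAt.continuousWithinAt.neg)
    (fun t ht => (hd t (Set.Ico_subset_Icc_self ht)).neg.hasDerivWithinAt) (by simp)
    (fun t => by simpa using (((hasDerivAt_id t).sub_const x).const_mul ε).const_add (-u x))
    (fun t ht he => by
      have hle : ε * (t - x) ≤ ε * (y - x) :=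
        mul_le_mul_of_nonneg_left (by linarith [ht.2]) (le_of_lt hε)
      have := h t ht (by linarith)
      linarith [Set.mem_Ioi.1 hε]) (Set.right_mem_Icc.2 hxy)
  linarith

theorem tendsto_atBot_of_hasDerivAt_le_neg {u u' : ℝ → ℝ} {δ : ℝ} (hδ : 0 < δ)
    (hd : ∀ᶠ t in atTop, HasDerivAt u (u' t) t) (h : ∀ᶠ t in atTop, u' t ≤ -δ) :
    Tendsto u atTop atBot := by
  obtain ⟨Y, hY⟩ := eventually_atTop.1 (hd.and h)
  have hbound : ∀ᶠ t in atTop, u t ≤ u Y + -δ * (t - Y) := by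
    filter_upwards [eventually_ge_atTop Y] with t ht
    have := sub_le_mul_of_hasDerivAt_le ht
      (fun s hs => (hY s hs.1).1.continuousAt.continuousWithinAt)
      (fun s hs => (hY s hs.1.le).1) (fun s hs => (hY s hs.1.le).2)
    linarith
  refine tendsto_atBot_mono' _ hbound (tendsto_atBot_add_const_left _ _ ?_)
  exact (tendsto_atTop_add_const_right _ (-Y) tendsto_id).const_mul_atTop_of_neg (neg_lt_zero.2 hδ)

theorem exists_nonpos_of_hasDerivAt_le_neg_rpow {u u' : ℝ → ℝ} {Y κ p : ℝ} (hκ : 0 < κ)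
    (hp : p < 1) (hd : ∀ t, Y ≤ t → HasDerivAt u (u' t) t)
    (h : ∀ t, Y ≤ t → u' t ≤ -(κ * u t ^ p)) : ∃ t, Y ≤ t ∧ u t ≤ 0 := by
  by_contra! hpos
  have hlim : Tendsto (fun t => u t ^ (1 - p)) atTop atBot := by
    refine tendsto_atBot_of_hasDerivAt_le_neg (δ := κ * (1 - p)) (mul_pos hκ (sub_pos.2 hp))
      (u' := fun t => u' t * (1 - p) * u t ^ (1 - p - 1))
      ((eventually_ge_atTop Y).mono fun t ht => (hd t ht).rpow_const (.inl (hpos t ht).ne'))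
      ((eventually_ge_atTop Y).mono fun t ht => ?_)
    have hcancel : u t ^ p * u t ^ (1 - p - 1) = 1 := by
      rw [← Real.rpow_add (hpos t ht)]; simp
    have hw : 0 ≤ (1 - p) * u t ^ (1 - p - 1) :=
      mul_nonneg (by linarith) (Real.rpow_nonneg (hpos t ht).le _)
    calc u' t * (1 - p) * u t ^ (1 - p - 1)
        ≤ -(κ * u t ^ p) * ((1 - p) * u t ^ (1 - p - 1)) := by
          rw [mul_assoc]; exact mul_le_mul_of_nonneg_right (h t ht) hw
      _ = -(κ * (1 - p)) := by linear_combination -κ * (1 - p) * hcancel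
  obtain ⟨t, hneg, ht⟩ := ((hlim.eventually_lt_atBot 0).and (eventually_ge_atTop Y)).exists
  exact hneg.not_ge (Real.rpow_nonneg (hpos t ht).le _)

theorem exists_forall_neg_mul_rpow_sub_le {m a : ℝ} (hm : 1 < m) (ha : 0 < a) (c : ℝ) :
    ∃ C, ∀ s : ℝ, 0 ≤ s → -a * s ^ m - c * s ≤ C := by
  obtain ⟨M, hM⟩ := eventually_atTop.1
    ((tendsto_rpow_atTop (sub_pos.2 hm)).eventually_ge_atTop (|c| / a))
  refine ⟨|c| * |M|, fun s hs => ?_⟩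
  have hcs : -(|c| * s) ≤ c * s := by
    rw [← neg_mul]; exact mul_le_mul_of_nonneg_right (neg_abs_le c) hs
  have hsm : 0 ≤ s ^ m := Real.rpow_nonneg hs m
  rcases le_total s |M| with h | h
  · have : |c| * s ≤ |c| * |M| := by gcongr
    nlinarith
  · have hsplit : s ^ m = s ^ (m - 1) * s := by
      rw [← Real.rpow_add_one' hs (by linarith), sub_add_cancel]
    have hc : |c| ≤ a * s ^ (m - 1) := (div_le_iff₀' ha).1 (hM s ((le_abs_self M).trans h))
    have : |c| * s ≤ a * s ^ m := by
      rw [hsplit, ← mul_assoc]; gcongr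
    have : 0 ≤ |c| * |M| := by positivity
    linarith

namespace IsProfile

variable {m p a b c : ℝ} {f Φ : ℝ → ℝ}

theorem reaction_pos (hb : 0 < b) {y : ℝ} (hy : 0 < f y) : 0 < b * f y ^ m + f y ^ p := by
  positivity

theorem continuous_flux (h : IsProfile m p a b c f Φ) : Continuous Φ :=
  continuous_iff_continuousAt.2 fun y => (h.hasDerivAt_flux y).continuousAt

theorem continuous_pow (h : IsProfile m p a b c f Φ) : Continuous fun y => f y ^ m :=
  continuous_iff_continuousAt.2 fun y => (h.hasDerivAt_pow y).continuousAt

theorem antitone_flux (h : IsProfile m p a b c f Φ) (hb : 0 ≤ b) : Antitone Φ :=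
  antitone_of_hasDerivAt_nonpos h.hasDerivAt_flux fun y => by
    have := h.nonneg y
    exact neg_nonpos.2 (by positivity : 0 ≤ b * f y ^ m + f y ^ p)

theorem flux_lt (h : IsProfile m p a b c f Φ) (hb : 0 < b) {y z : ℝ} (hyz : y < z)
    (hpos : ∀ t ∈ Set.Ioo y z, 0 < f t) : Φ z < Φ y :=
  lt_of_hasDerivAt_neg hyz h.continuous_flux.continuousOn (fun t _ => h.hasDerivAt_flux t)
    fun t ht => neg_lt_zero.2 (reaction_pos hb (hpos t ht))

theorem flux_eq_zero (h : IsProfile m p a b c f Φ) (hm : m ≠ 0) {y : ℝ} (hy : f y = 0) :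
    Φ y = 0 := by
  have hmin : IsLocalMin (fun y => f y ^ m) y :=
    Filter.Eventually.of_forall fun z => by
      simp only [hy, Real.zero_rpow hm]
      exact Real.rpow_nonneg (h.nonneg z) m
  simpa [profileSlope, hy, Real.zero_rpow hm] using
    hmin.hasDerivAt_eq_zero (h.hasDerivAt_pow y)

theorem eq_zero_of_pow_nonpos (h : IsProfile m p a b c f Φ) {y : ℝ} (hy : f y ^ m ≤ 0) :
    f y = 0 := by
  by_contra hne
  exact hy.not_gt (Real.rpow_pos_of_pos ((h.nonneg y).lt_of_ne' hne) m)

theorem le_of_slope_nonneg (h : IsProfile m p a b c f Φ) (hm : 0 < m) {y z : ℝ} (hyz : y ≤ z)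
    (hs : ∀ t ∈ Set.Ioo y z, 0 ≤ profileSlope m a c f Φ t) : f y ≤ f z :=
  (Real.rpow_le_rpow_iff (h.nonneg y) (h.nonneg z) hm).1 <|
    le_of_hasDerivAt_nonneg (u := fun t => f t ^ m) hyz h.continuous_pow.continuousOn
      (fun t _ => h.hasDerivAt_pow t) hs

theorem le_of_slope_nonpos (h : IsProfile m p a b c f Φ) (hm : 0 < m) {y z : ℝ} (hyz : y ≤ z)
    (hs : ∀ t ∈ Set.Ioo y z, profileSlope m a c f Φ t ≤ 0) : f z ≤ f y :=
  (Real.rpow_le_rpow_iff (h.nonneg z) (h.nonneg y) hm).1 <| neg_le_neg_iff.1 <|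
    le_of_hasDerivAt_nonneg (u := fun t => -f t ^ m) hyz h.continuous_pow.neg.continuousOn
      (fun t _ => (h.hasDerivAt_pow t).neg) fun t ht => neg_nonneg.2 (hs t ht)

theorem slope_le (h : IsProfile m p a b c f Φ) (ha : 0 ≤ a) (y : ℝ) :
    profileSlope m a c f Φ y ≤ Φ y - c * f y := by
  have := mul_nonneg ha (Real.rpow_nonneg (h.nonneg y) m)
  unfold profileSlope
  linarith

theorem eq_zero_right (h : IsProfile m p a b c f Φ) (hm : 0 < m) (ha : 0 ≤ a) (hb : 0 ≤ b)
    (hc : 0 ≤ c) {y z : ℝ} (hy : f y = 0) (hyz : y ≤ z) : f z = 0 := by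
  refine le_antisymm (hy ▸ h.le_of_slope_nonpos hm hyz fun t ht => ?_) (h.nonneg z)
  have hΦ : Φ t ≤ 0 := (h.flux_eq_zero hm.ne' hy) ▸ h.antitone_flux hb ht.1.le
  linarith [h.slope_le ha t, mul_nonneg hc (h.nonneg t)]

theorem eq_zero_left (h : IsProfile m p a b c f Φ) (hm : 0 < m) (hb : 0 ≤ b)
    (hc : c ≤ 0) {y z : ℝ} (hy : f y = 0) (hyz : z ≤ y) : f z = 0 := by
  have hcont := h.continuous_pow
  -- The integrating factor removes the convection term: `(e ^ (a y) f ^ m)' = e ^ (a y) (Φ - c f)`.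
  have hle := le_of_hasDerivAt_nonneg (u := fun y => Real.exp (a * y) * f y ^ m)
    (u' := fun t => Real.exp (a * t) * (Φ t - c * f t)) hyz (by fun_prop)
    (fun t _ => ((hasDerivAt_const_mul a).exp.mul (h.hasDerivAt_pow t)).congr_deriv
      (by unfold profileSlope; ring))
    (fun t ht => by
      have hΦ : 0 ≤ Φ t := (h.flux_eq_zero hm.ne' hy) ▸ h.antitone_flux hb ht.2.le
      have hcf : c * f t ≤ 0 := mul_nonpos_of_nonpos_of_nonneg hc (h.nonneg t)
      exact mul_nonneg (Real.exp_pos _).le (by linarith))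
  rw [hy, Real.zero_rpow hm.ne', mul_zero] at hle
  exact h.eq_zero_of_pow_nonpos (nonpos_of_mul_nonpos_right hle (Real.exp_pos _))

theorem hasDerivAt_rpow (h : IsProfile m p a b c f Φ) (hm : m ≠ 0) (q : ℝ) {y : ℝ}
    (hy : 0 < f y) :
    HasDerivAt (fun y => f y ^ q) (q / m * f y ^ (q - m) * profileSlope m a c f Φ y) y := by
  have hd := (h.hasDerivAt_pow y).rpow_const (p := q / m) (.inl (by positivity))
  have hroot : (fun y => (f y ^ m) ^ (q / m)) = fun y => f y ^ q := funext fun y => by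
    rw [← Real.rpow_mul (h.nonneg y), mul_div_cancel₀ q hm]
  rw [hroot, ← Real.rpow_mul hy.le, show m * (q / m - 1) = q - m by field_simp] at hd
  exact hd.congr_deriv (by ring)

theorem hasDerivAt (h : IsProfile m p a b c f Φ) (hm : m ≠ 0) {y : ℝ} (hy : 0 < f y) :
    HasDerivAt f (profileSlope m a c f Φ y / (m * f y ^ (m - 1))) y := by
  have hd := h.hasDerivAt_rpow hm 1 hy
  simp only [Real.rpow_one] at hd
  refine hd.congr_deriv ?_
  rw [← neg_sub, Real.rpow_neg hy.le]
  field_simp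

theorem hasDerivAt_slope (h : IsProfile m p a b c f Φ) (hm : m ≠ 0) {y : ℝ} (hy : 0 < f y) :
    HasDerivAt (profileSlope m a c f Φ)
      (-(b * f y ^ m + f y ^ p) - a * profileSlope m a c f Φ y
        - c * (profileSlope m a c f Φ y / (m * f y ^ (m - 1)))) y :=
  ((h.hasDerivAt_flux y).sub ((h.hasDerivAt_pow y).const_mul a)).sub
    ((h.hasDerivAt hm hy).const_mul c)

theorem slope_neg_of_lt (h : IsProfile m p a b c f Φ) (hm : m ≠ 0) (hb : 0 < b) {y z : ℝ}
    (hyz : y < z) (hpos : ∀ t ∈ Set.Icc y z, 0 < f t) (hy : profileSlope m a c f Φ y ≤ 0) :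
    profileSlope m a c f Φ z < 0 :=
  neg_of_hasDerivAt_neg_of_eq_zero hyz (fun t ht => h.hasDerivAt_slope hm (hpos t ht)) hy
    fun t ht h0 => by
      have := reaction_pos (m := m) (p := p) hb (hpos t ht)
      simp only [h0, mul_zero, zero_div, sub_zero]
      linarith

theorem slope_nonpos_of_le (h : IsProfile m p a b c f Φ) (hm : m ≠ 0) (hb : 0 < b) {y z : ℝ}
    (hyz : y ≤ z) (hpos : ∀ t ∈ Set.Icc y z, 0 < f t) (hy : profileSlope m a c f Φ y ≤ 0) :
    profileSlope m a c f Φ z ≤ 0 := by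
  rcases hyz.eq_or_lt with rfl | hlt
  · exact hy
  · exact (h.slope_neg_of_lt hm hb hlt hpos hy).le

theorem flux_le (h : IsProfile m p a b c f Φ) (hm : 1 ≤ m) (ha : 0 ≤ a) {y : ℝ}
    (hle : f y ≤ 1) (hs : profileSlope m a c f Φ y ≤ 0) : Φ y ≤ (a + |c|) * f y := by
  have hpow : a * f y ^ m ≤ a * f y := by
    gcongr
    exact Real.rpow_le_self_of_le_one (h.nonneg y) hle hm
  have hc : c * f y ≤ |c| * f y := mul_le_mul_of_nonneg_right (le_abs_self c) (h.nonneg y)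
  unfold profileSlope at hs
  linarith

theorem neg_le_slope (h : IsProfile m p a b c f Φ) (hm : 1 ≤ m) (ha : 0 ≤ a) {y : ℝ}
    (hle : f y ≤ 1) (hΦ : 0 ≤ Φ y) : -((a + |c|) * f y) ≤ profileSlope m a c f Φ y := by
  have hpow : a * f y ^ m ≤ a * f y := by
    gcongr
    exact Real.rpow_le_self_of_le_one (h.nonneg y) hle hm
  have hc : c * f y ≤ |c| * f y := mul_le_mul_of_nonneg_right (le_abs_self c) (h.nonneg y)
  unfold profileSlope
  linarith

theorem not_eventually_slope_le_neg (h : IsProfile m p a b c f Φ) {δ : ℝ} (hδ : 0 < δ) :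
    ¬ ∀ᶠ y in atTop, profileSlope m a c f Φ y ≤ -δ := fun hs => by
  obtain ⟨y, hy⟩ := ((tendsto_atBot_of_hasDerivAt_le_neg hδ (.of_forall h.hasDerivAt_pow)
    hs).eventually_lt_atBot 0).exists
  exact hy.not_ge (Real.rpow_nonneg (h.nonneg y) m)

theorem not_eventually_le (h : IsProfile m p a b c f Φ) (hm : 1 < m) (ha : 0 < a) (hb : 0 < b)
    {ε : ℝ} (hε : 0 < ε) : ¬ ∀ᶠ y in atTop, ε ≤ f y := fun hf => by
  have hflux : Tendsto Φ atTop atBot :=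
    tendsto_atBot_of_hasDerivAt_le_neg (δ := b * ε ^ m) (by positivity)
      (.of_forall h.hasDerivAt_flux) (hf.mono fun t ht => by
        have hpow : b * ε ^ m ≤ b * f t ^ m := by gcongr
        linarith [Real.rpow_nonneg (h.nonneg t) p])
  obtain ⟨C, hC⟩ := exists_forall_neg_mul_rpow_sub_le hm ha c
  refine h.not_eventually_slope_le_neg one_pos ?_
  filter_upwards [hflux.eventually_le_atBot (-C - 1)] with t ht
  have := hC (f t) (h.nonneg t)
  unfold profileSlope
  linarith

theorem exists_slope_nonpos (h : IsProfile m p a b c f Φ) (hm : 1 < m) (ha : 0 < a) (hb : 0 < b)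
    {Y : ℝ} (hY : 0 < f Y) : ∃ y, Y ≤ y ∧ profileSlope m a c f Φ y ≤ 0 := by
  by_contra! hpos
  exact h.not_eventually_le hm ha hb hY <| (eventually_ge_atTop Y).mono fun y hy =>
    h.le_of_slope_nonneg (by linarith) hy fun t ht => (hpos t ht.1.le).le

theorem tendsto_zero (h : IsProfile m p a b c f Φ) (hm : 1 < m) (ha : 0 < a) (hb : 0 < b)
    {Y : ℝ} (hs : ∀ y, Y ≤ y → profileSlope m a c f Φ y ≤ 0) : Tendsto f atTop (𝓝 0) := by
  refine tendsto_order.2 ⟨fun ε hε => .of_forall fun y => hε.trans_le (h.nonneg y),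
    fun ε hε => ?_⟩
  obtain ⟨y, hlt, hy⟩ := ((not_eventually.1 (h.not_eventually_le hm ha hb hε)).and_eventually
    (eventually_ge_atTop Y)).exists
  filter_upwards [eventually_ge_atTop y] with z hz
  exact (h.le_of_slope_nonpos (by linarith) hz fun t ht => hs t (hy.trans ht.1.le)).trans_lt
    (not_le.1 hlt)

theorem flux_nonneg_of_tendsto_zero (h : IsProfile m p a b c f Φ) (ha : 0 ≤ a) (hb : 0 ≤ b)
    (hlim : Tendsto f atTop (𝓝 0)) (y : ℝ) : 0 ≤ Φ y := by
  by_contra! hneg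
  refine h.not_eventually_slope_le_neg (δ := -Φ y / 2) (by linarith) ?_
  have hcf : Tendsto (fun t => -(c * f t)) atTop (𝓝 0) := by simpa using (hlim.const_mul c).neg
  filter_upwards [eventually_ge_atTop y,
    hcf.eventually_lt_const (show 0 < -Φ y / 2 by linarith)] with t ht hct
  linarith [h.antitone_flux hb ht, h.slope_le ha t]

theorem not_forall_pos (h : IsProfile m p a b c f Φ) (hm : 1 < m) (hp0 : 0 < p) (hp1 : p < 1)
    (ha : 0 < a) (hb : 0 < b) (Y : ℝ) : ¬ ∀ y, Y ≤ y → 0 < f y := fun hf => by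
  have hm0 : m ≠ 0 := by linarith
  obtain ⟨y₁, hy₁, hs₁⟩ := h.exists_slope_nonpos hm ha hb (hf Y le_rfl)
  have hs : ∀ y, y₁ ≤ y → profileSlope m a c f Φ y ≤ 0 := fun y hy =>
    h.slope_nonpos_of_le hm0 hb hy (fun t ht => hf t (hy₁.trans ht.1)) hs₁
  have hlim := h.tendsto_zero hm ha hb hs
  obtain ⟨y₂, hy₂⟩ := eventually_atTop.1
    ((hlim.eventually_le_const one_pos).and (eventually_ge_atTop y₁))
  have hΦ : ∀ y, 0 ≤ Φ y := h.flux_nonneg_of_tendsto_zero ha.le hb.le hlim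
  have hC : 0 < a + |c| := by positivity
  obtain ⟨t, ht, hnonpos⟩ := exists_nonpos_of_hasDerivAt_le_neg_rpow (u := Φ) (Y := y₂)
    (κ := ((a + |c|) ^ p)⁻¹) (by positivity) hp1 (fun t _ => h.hasDerivAt_flux t) fun t ht => by
      have hle : Φ t ^ p ≤ (a + |c|) ^ p * f t ^ p := by
        rw [← Real.mul_rpow hC.le (h.nonneg t)]
        exact Real.rpow_le_rpow (hΦ t) (h.flux_le hm.le ha.le (hy₂ t ht).1 (hs t (hy₂ t ht).2))
          hp0.le
      have hreact : 0 ≤ b * f t ^ m := mul_nonneg hb.le (Real.rpow_nonneg (h.nonneg t) m)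
      have := inv_mul_le_of_le_mul₀ (by positivity) (Real.rpow_nonneg (h.nonneg t) p) hle
      linarith
  have hlt := h.flux_lt hb (lt_add_one t) fun s hs =>
    hf s (hy₁.trans ((hy₂ t ht).2.trans hs.1.le))
  linarith [hΦ (t + 1)]

theorem exists_hasInterfaceAt (h : IsProfile m p a b c f Φ) (hm : 1 < m) (hp0 : 0 < p)
    (hp1 : p < 1) (ha : 0 < a) (hb : 0 < b) (hf : f ≠ 0) :
    0 < c ∧ ∃ y₀, HasInterfaceAt f y₀ := by
  have hm0 : 0 < m := by linarith
  obtain ⟨y₁, hy₁⟩ := Function.ne_iff.1 hf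
  have hnot := h.not_forall_pos hm hp0 hp1 ha hb y₁
  push Not at hnot
  obtain ⟨y₂, hy₂, hle⟩ := hnot
  have hy₂0 : f y₂ = 0 := le_antisymm hle (h.nonneg y₂)
  have hc : 0 < c := by
    by_contra! hc
    exact hy₁ (h.eq_zero_left hm0 hb.le hc hy₂0 hy₂)
  have hright : ∀ y z, f y = 0 → y ≤ z → f z = 0 := fun y z =>
    h.eq_zero_right hm0 ha.le hb.le hc.le
  have hbdd : BddBelow {y | f y = 0} := ⟨y₁, fun y hy => by
    by_contra! hlt
    exact hy₁ (hright y y₁ hy hlt.le)⟩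
  have hmem : f (sInf {y | f y = 0}) = 0 :=
    (isClosed_eq h.continuous continuous_const).csInf_mem ⟨y₂, hy₂0⟩ hbdd
  exact ⟨hc, _, fun y hy => (h.nonneg y).lt_of_ne' fun h0 => (csInf_le hbdd h0).not_gt hy,
    fun y hy => hright _ y hmem hy⟩

theorem flux_pos (h : IsProfile m p a b c f Φ) (hm : m ≠ 0) (hb : 0 < b) {y₀ : ℝ}
    (hI : HasInterfaceAt f y₀) {y : ℝ} (hy : y < y₀) : 0 < Φ y :=
  h.flux_eq_zero hm (hI.2 y₀ le_rfl) ▸ h.flux_lt hb hy fun t ht => hI.1 t ht.2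

theorem eventually_le_one (h : IsProfile m p a b c f Φ) {y₀ : ℝ} (h0 : f y₀ = 0) :
    ∀ᶠ y in 𝓝[<] y₀, f y ≤ 1 :=
  ((h0 ▸ h.continuous.tendsto y₀).mono_left nhdsWithin_le_nhds).eventually_le_const one_pos

theorem eventually_slope_nonpos (h : IsProfile m p a b c f Φ) (hm : m ≠ 0) (hb : 0 < b)
    {y₀ : ℝ} (hI : HasInterfaceAt f y₀) : ∀ᶠ y in 𝓝[<] y₀, profileSlope m a c f Φ y ≤ 0 := by
  obtain ⟨y₁, hy₁, hs⟩ := exists_hasDerivAt_eq_slope _ _ (sub_one_lt y₀)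
    h.continuous_pow.continuousOn fun t _ => h.hasDerivAt_pow t
  have hneg : profileSlope m a c f Φ y₁ ≤ 0 := by
    rw [hs, hI.2 y₀ le_rfl, Real.zero_rpow hm, sub_sub_cancel, div_one, zero_sub, neg_nonpos]
    exact Real.rpow_nonneg (h.nonneg _) m
  filter_upwards [Ioo_mem_nhdsLT hy₁.2] with y hy
  exact h.slope_nonpos_of_le hm hb hy.1.le (fun t ht => hI.1 t (ht.2.trans_lt hy.2)) hneg

theorem exists_eventually_mul_rpow_le_flux (h : IsProfile m p a b c f Φ) (hm : 1 < m)
    (hp : 0 < p) (ha : 0 < a) (hb : 0 < b) {y₀ : ℝ} (hI : HasInterfaceAt f y₀) :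
    ∃ κ > 0, ∀ᶠ y in 𝓝[<] y₀, κ * f y ^ (m + p - 1) ≤ Φ y := by
  have hm0 : m ≠ 0 := by linarith
  have hq : 0 < m + p - 1 := by linarith
  have : 0 < a + |c| := by positivity
  have h0 : f y₀ = 0 := hI.2 y₀ le_rfl
  refine ⟨m / ((m + p - 1) * (a + |c|)), by positivity, ?_⟩
  obtain ⟨x, hx, hle⟩ := mem_nhdsLT_iff_exists_Ioo_subset.1 (h.eventually_le_one h0)
  filter_upwards [Ioo_mem_nhdsLT hx] with y hy
  have hcont : Continuous fun y => f y ^ (m + p - 1) :=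
    h.continuous.rpow_const fun _ => .inr hq.le
  have hΦc := h.continuous_flux
  set κ := m / ((m + p - 1) * (a + |c|)) with hκ
  have hmono := le_of_hasDerivAt_nonneg (u := fun y => κ * f y ^ (m + p - 1) - Φ y) hy.2.le
    (by fun_prop) (fun t ht => ((h.hasDerivAt_rpow hm0 (m + p - 1) (hI.1 t ht.2)).const_mul
      κ).sub (h.hasDerivAt_flux t)) fun t ht => by
    have hft := hI.1 t ht.2
    have hslope := h.neg_le_slope hm.le ha.le (hle ⟨hy.1.trans ht.1, ht.2⟩)
      (h.flux_pos hm0 hb hI ht.2).le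
    have hpow : f t ^ (m + p - 1 - m) * f t = f t ^ p := by
      rw [← Real.rpow_add_one hft.ne']; ring_nf
    have hbound : -f t ^ p ≤ κ * ((m + p - 1) / m * f t ^ (m + p - 1 - m)
        * profileSlope m a c f Φ t) := by
      calc -f t ^ p
          = κ * ((m + p - 1) / m * f t ^ (m + p - 1 - m) * -((a + |c|) * f t)) := by
            rw [← hpow, hκ]; field_simp
        _ ≤ _ := by gcongr
    have : 0 ≤ b * f t ^ m := by positivity
    linarith
  simp only [h0, Real.zero_rpow hq.ne', h.flux_eq_zero hm0 h0] at hmono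
  linarith

/- Near the interface the flux is at least of order `f ^ (m + p - 1)`, by integrating the reaction,
and at most of order `f`, since `f` decreases. -/
theorem two_le_add (h : IsProfile m p a b c f Φ) (hm : 1 < m) (hp0 : 0 < p)
    (hp1 : p < 1) (ha : 0 < a) (hb : 0 < b) (hf : f ≠ 0) : 2 ≤ m + p := by
  by_contra! hlt
  obtain ⟨-, y₀, hI⟩ := h.exists_hasInterfaceAt hm hp0 hp1 ha hb hf
  have h0 : f y₀ = 0 := hI.2 y₀ le_rfl
  obtain ⟨κ, hκ, hlower⟩ := h.exists_eventually_mul_rpow_le_flux hm hp0 ha hb hI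
  have hlim : Tendsto (fun y => (a + |c|) * f y ^ (2 - m - p)) (𝓝[<] y₀) (𝓝 0) := by
    have hq : 0 < 2 - m - p := by linarith
    have := (h.continuous.rpow_const (p := 2 - m - p) fun _ => .inr hq.le).const_mul (a + |c|)
    exact (this.tendsto' y₀ 0 (by simp [h0, Real.zero_rpow hq.ne'])).mono_left nhdsWithin_le_nhds
  refine hκ.not_ge (ge_of_tendsto hlim ?_)
  filter_upwards [hlower, h.eventually_le_one h0, h.eventually_slope_nonpos (by linarith) hb hI,
    self_mem_nhdsWithin] with y hflux hle hs hy
  have hfy : 0 < f y := hI.1 y hy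
  have hsplit : f y = f y ^ (m + p - 1) * f y ^ (2 - m - p) := by
    rw [← Real.rpow_add hfy]; ring_nf; simp
  refine le_of_mul_le_mul_right ?_ (Real.rpow_pos_of_pos hfy (m + p - 1))
  calc κ * f y ^ (m + p - 1) ≤ (a + |c|) * f y := hflux.trans (h.flux_le hm.le ha.le hle hs)
    _ = (a + |c|) * f y ^ (2 - m - p) * f y ^ (m + p - 1) := by
      conv_lhs => rw [hsplit]
      ring

end IsProfile

/-! ### The phase plane -/

/-- Admissible exponents and coefficients: `-k` and `-l` stand for the characteristic roots of the
linear principal part `(f ^ m)'' + (k + l) (f ^ m)' + k l f ^ m`, and `k < m l` makes the root `-k`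
dominate the first-order term in `c` as `f → ∞`. -/
structure Admissible (m p k l : ℝ) : Prop where
  one_lt : 1 < m
  p_pos : 0 < p
  p_lt : p < 1
  k_pos : 0 < k
  l_pos : 0 < l
  k_lt : k < m * l

/-- The right-hand side of the phase-plane equation `dP/ds = slopeField m p k l c s P`, satisfied by
`P = -(f ^ m)'` as a function of `s = f` wherever a profile `f` decreases. -/
def slopeField (m p k l c s P : ℝ) : ℝ :=
  c + (k + l) * m * s ^ (m - 1) - m * s ^ (m - 1) * (k * l * s ^ m + s ^ p) / P

/-- A positive solution on `(0, ∞)` of the phase-plane equation `dP/ds = slopeField m p k l c s P`;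
the orbits are the images of the profiles in the phase plane. -/
structure IsOrbit (m p k l c : ℝ) (P : ℝ → ℝ) : Prop where
  pos : ∀ s, 0 < s → 0 < P s
  hasDerivAt : ∀ s, 0 < s → HasDerivAt P (slopeField m p k l c s (P s)) s

/-- The orbit leaves infinity along the characteristic direction of `-k`: `P s = k s ^ m + O(s)`.
For `k = 2 m / (m - 1)` this is the phase-plane form of a good radial profile. -/
def IsGoodAtInfinity (m k : ℝ) (P : ℝ → ℝ) : Prop :=
  (fun s => P s - k * s ^ m) =O[atTop] fun s => s

theorem isGoodAtInfinity_iff {m k : ℝ} {P : ℝ → ℝ} :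
    IsGoodAtInfinity m k P ↔ ∃ α, 0 < α ∧ ∀ᶠ s in atTop, |P s - k * s ^ m| ≤ α * s := by
  have habs : ∀ α : ℝ, (∀ᶠ s in atTop, |P s - k * s ^ m| ≤ α * |s|) ↔
      ∀ᶠ s in atTop, |P s - k * s ^ m| ≤ α * s := fun α =>
    eventually_congr ((eventually_ge_atTop 0).mono fun s hs => by rw [abs_of_nonneg hs])
  constructor
  · intro h
    obtain ⟨α, hα, hbound⟩ := h.exists_pos
    exact ⟨α, hα, (habs α).1 hbound.bound⟩
  · rintro ⟨α, -, hbound⟩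
    exact .of_bound α ((habs α).2 hbound)

theorem rpow_sub_one_mul {s : ℝ} (hs : 0 < s) (m : ℝ) : s ^ (m - 1) * s = s ^ m := by
  rw [← Real.rpow_add_one hs.ne', sub_add_cancel]

theorem rpow_add_sub_one {s : ℝ} (hs : 0 < s) (m p : ℝ) :
    s ^ (m + p - 1) = s ^ (m - 1) * s ^ p := by
  rw [← Real.rpow_add hs, sub_add_eq_add_sub]

theorem eventually_mul_le_mul_rpow {m : ℝ} (hm : 1 < m) (α : ℝ) {ε : ℝ} (hε : 0 < ε) :
    ∀ᶠ s : ℝ in atTop, α * s ≤ ε * s ^ m := by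
  filter_upwards [(tendsto_rpow_atTop (sub_pos.2 hm)).eventually_ge_atTop (α / ε),
    eventually_gt_atTop 0] with s hs hs0
  rw [← rpow_sub_one_mul hs0, ← mul_assoc]
  exact mul_le_mul_of_nonneg_right ((div_le_iff₀' hε).1 hs) hs0.le

theorem IsGoodAtInfinity.eventually_le {m k : ℝ} {P : ℝ → ℝ} (hm : 1 < m)
    (h : IsGoodAtInfinity m k P) {ε : ℝ} (hε : 0 < ε) :
    ∀ᶠ s in atTop, P s ≤ (k + ε) * s ^ m := by
  obtain ⟨α, -, hα⟩ := isGoodAtInfinity_iff.1 h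
  filter_upwards [hα, eventually_mul_le_mul_rpow hm α hε] with s hs hαs
  linarith [le_abs_self (P s - k * s ^ m)]

theorem IsGoodAtInfinity.of_le_of_le {m k : ℝ} {P Q R : ℝ → ℝ} (hP : IsGoodAtInfinity m k P)
    (hQ : IsGoodAtInfinity m k Q) (hPR : ∀ᶠ s in atTop, P s ≤ R s)
    (hRQ : ∀ᶠ s in atTop, R s ≤ Q s) : IsGoodAtInfinity m k R := by
  obtain ⟨α, hα, hαP⟩ := isGoodAtInfinity_iff.1 hP
  obtain ⟨β, hβ, hβQ⟩ := isGoodAtInfinity_iff.1 hQ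
  refine isGoodAtInfinity_iff.2 ⟨α + β, by positivity, ?_⟩
  filter_upwards [hαP, hβQ, hPR, hRQ, eventually_ge_atTop 0] with s hPs hQs h₁ h₂ hs
  have := mul_nonneg hα.le hs
  have := mul_nonneg hβ.le hs
  rw [abs_le] at hPs hQs ⊢
  constructor <;> linarith

section field

variable {m p k l c s : ℝ}

theorem slopeField_mono (H : Admissible m p k l) (hs : 0 < s) {P Q : ℝ} (hP : 0 < P)
    (hPQ : P ≤ Q) : slopeField m p k l c s P ≤ slopeField m p k l c s Q := by
  have := H.one_lt
  have := H.k_pos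
  have := H.l_pos
  unfold slopeField
  gcongr

theorem slopeField_sub {P Q : ℝ} (hP : P ≠ 0) (hQ : Q ≠ 0) :
    slopeField m p k l c s P - slopeField m p k l c s Q
      = m * s ^ (m - 1) * (k * l * s ^ m + s ^ p) * (P - Q) / (P * Q) := by
  unfold slopeField
  field_simp
  ring

theorem continuousOn_slopeField {P : ℝ → ℝ} {t : Set ℝ} (ht : ∀ s ∈ t, 0 < s)
    (hP : ContinuousOn P t) (hpos : ∀ s ∈ t, 0 < P s) :
    ContinuousOn (fun s => slopeField m p k l c s (P s)) t := by
  have hpow : ∀ q : ℝ, ContinuousOn (fun s : ℝ => s ^ q) t := fun q =>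
    continuousOn_id.rpow_const fun s hs => .inl (ht s hs).ne'
  have := hpow (m - 1)
  have := hpow m
  have := hpow p
  unfold slopeField
  exact .sub (by fun_prop) (.div (by fun_prop) hP fun s hs => (hpos s hs).ne')

theorem exists_norm_slopeField_le (m p k l C : ℝ) {d : ℝ → ℝ} {t : Set ℝ}
    (htc : IsCompact t) (ht : ∀ s ∈ t, 0 < s) (hd : ContinuousOn d t) (hdpos : ∀ s ∈ t, 0 < d s) :
    ∃ M, 0 ≤ M ∧ ∀ c, |c| ≤ C → ∀ s ∈ t, ∀ P, d s ≤ P → ‖slopeField m p k l c s P‖ ≤ M := by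
  have hpow : ∀ q : ℝ, ContinuousOn (fun s : ℝ => s ^ q) t := fun q =>
    continuousOn_id.rpow_const fun s hs => .inl (ht s hs).ne'
  have := hpow (m - 1)
  have := hpow m
  have := hpow p
  obtain ⟨A, hA⟩ := htc.exists_bound_of_continuousOn
    (f := fun s => (k + l) * m * s ^ (m - 1)) (by fun_prop)
  obtain ⟨B, hB⟩ := htc.exists_bound_of_continuousOn
    (f := fun s => m * s ^ (m - 1) * (k * l * s ^ m + s ^ p) / d s)
    (.div (by fun_prop) hd fun s hs => (hdpos s hs).ne')
  refine ⟨|C + A + B|, abs_nonneg _, fun c hc s hs P hP => ?_⟩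
  have hquot : ‖m * s ^ (m - 1) * (k * l * s ^ m + s ^ p) / P‖ ≤ B := by
    refine le_trans ?_ (hB s hs)
    have hds := hdpos s hs
    rw [norm_div, norm_div, Real.norm_of_nonneg hds.le, Real.norm_of_nonneg (hds.le.trans hP)]
    gcongr
  calc ‖slopeField m p k l c s P‖
      ≤ ‖c‖ + ‖(k + l) * m * s ^ (m - 1)‖
        + ‖m * s ^ (m - 1) * (k * l * s ^ m + s ^ p) / P‖ :=
        (norm_sub_le _ _).trans (add_le_add_left (norm_add_le _ _) _)
    _ ≤ C + A + B := add_le_add (add_le_add hc (hA s hs)) hquot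
    _ ≤ |C + A + B| := le_abs_self _

theorem Admissible.exists_margin (H : Admissible m p k l) :
    ∃ ε > 0, (k + ε) ^ 2 * (1 + ε) < m * k * l := by
  have hcont : ContinuousAt (fun ε : ℝ => (k + ε) ^ 2 * (1 + ε)) 0 := by fun_prop
  have hlt : ∀ᶠ ε in 𝓝 (0 : ℝ), (k + ε) ^ 2 * (1 + ε) < m * k * l :=
    hcont.eventually_lt continuousAt_const (by
      have := mul_lt_mul_of_pos_left H.k_lt H.k_pos
      norm_num
      linarith)
  obtain ⟨ε, hε, hpos⟩ := ((hlt.filter_mono nhdsWithin_le_nhds).and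
    (self_mem_nhdsWithin : Set.Ioi (0 : ℝ) ∈ 𝓝[>] 0)).exists
  exact ⟨ε, hpos, hε⟩

theorem Admissible.mul_sub_div_le_slopeField_sub (H : Admissible m p k l) {ε P Q : ℝ} (hε : 0 < ε)
    (hmargin : (k + ε) ^ 2 * (1 + ε) ≤ m * k * l) (hs : 0 < s) (hQ : 0 < Q) (hQP : Q ≤ P)
    (hP : P ≤ (k + ε) * s ^ m) :
    (1 + ε) * (P - Q) / s ≤ slopeField m p k l c s P - slopeField m p k l c s Q := by
  obtain ⟨hm, -, -, hk, hl, -⟩ := H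
  have hP0 : 0 < P := hQ.trans_le hQP
  rw [slopeField_sub hP0.ne' hQ.ne', div_le_div_iff₀ hs (mul_pos hP0 hQ)]
  have hprod : (1 + ε) * (P * Q) ≤ m * k * l * (s ^ m * s ^ m) := by
    calc (1 + ε) * (P * Q) ≤ (1 + ε) * (((k + ε) * s ^ m) * ((k + ε) * s ^ m)) := by
          have := hQP.trans hP
          gcongr
      _ = ((k + ε) ^ 2 * (1 + ε)) * (s ^ m * s ^ m) := by ring
      _ ≤ m * k * l * (s ^ m * s ^ m) := by gcongr
  have hreact : m * k * l * (s ^ m * s ^ m) ≤ m * s ^ (m - 1) * (k * l * s ^ m + s ^ p) * s := by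
    have : 0 ≤ m * s ^ m * s ^ p := by positivity
    linear_combination this - (m * (k * l * s ^ m + s ^ p)) * rpow_sub_one_mul hs m
  calc (1 + ε) * (P - Q) * (P * Q) = (1 + ε) * (P * Q) * (P - Q) := by ring
    _ ≤ m * s ^ (m - 1) * (k * l * s ^ m + s ^ p) * s * (P - Q) :=
      mul_le_mul_of_nonneg_right (hprod.trans hreact) (sub_nonneg.2 hQP)
    _ = _ := by ring

end field

theorem le_of_barrier {P P' Q Q' : ℝ → ℝ} {s₀ s₁ : ℝ} (h01 : s₀ ≤ s₁)
    (hP : ∀ t ∈ Set.Icc s₀ s₁, HasDerivAt P (P' t) t)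
    (hQ : ∀ t ∈ Set.Icc s₀ s₁, HasDerivAt Q (Q' t) t) (hle : P s₁ ≤ Q s₁)
    (h : ∀ t ∈ Set.Icc s₀ s₁, Q t < P t → Q' t ≤ P' t) : P s₀ ≤ Q s₀ := by
  by_contra! hlt
  have := le_of_hasDerivAt_nonneg_of_pos (u := fun t => P t - Q t) h01
    (fun t ht => (hP t ht).sub (hQ t ht)) (sub_pos.2 hlt)
    (fun t ht hpos => sub_nonneg.2 (h t (Set.Ico_subset_Icc_self ht) (sub_pos.1 hpos)))
  linarith

theorem mul_rpow_neg_le_of_hasDerivAt {u u' : ℝ → ℝ} {q x y : ℝ} (hx : 0 < x) (hxy : x ≤ y)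
    (hd : ∀ t ∈ Set.Icc x y, HasDerivAt u (u' t) t)
    (h : ∀ t ∈ Set.Icc x y, q * u t / t ≤ u' t) : u x * x ^ (-q) ≤ u y * y ^ (-q) := by
  have hd' : ∀ t ∈ Set.Icc x y,
      HasDerivAt (fun t => u t * t ^ (-q)) (t ^ (-q) * (u' t - q * u t / t)) t := fun t ht => by
    have ht0 : 0 < t := hx.trans_le ht.1
    refine ((hd t ht).mul (Real.hasDerivAt_rpow_const (.inl ht0.ne'))).congr_deriv ?_
    rw [Real.rpow_sub_one ht0.ne']
    ring
  refine le_of_hasDerivAt_nonneg (u := fun t => u t * t ^ (-q)) hxy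
    (fun t ht => (hd' t ht).continuousAt.continuousWithinAt)
    (fun t ht => hd' t (Set.Ioo_subset_Icc_self ht)) fun t ht => ?_
  exact mul_nonneg (Real.rpow_nonneg (hx.trans ht.1).le _)
    (sub_nonneg.2 (h t (Set.Ioo_subset_Icc_self ht)))

theorem nonpos_of_mul_rpow_neg_le_of_isBigO {u : ℝ → ℝ} {ε T : ℝ} (hε : 0 < ε) (hT : 0 < T)
    (hu : u =O[atTop] fun t => t)
    (hgrow : ∀ t, T ≤ t → u T * T ^ (-(1 + ε)) ≤ u t * t ^ (-(1 + ε))) : u T ≤ 0 := by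
  have hbigO : (fun t => u t * t ^ (-(1 + ε))) =O[atTop] fun t : ℝ => t ^ (-ε) := by
    refine (hu.mul (Asymptotics.isBigO_refl _ _)).congr' .rfl ?_
    filter_upwards [eventually_gt_atTop 0] with t ht
    rw [mul_comm, ← Real.rpow_add_one ht.ne']
    ring_nf
  have hle : u T * T ^ (-(1 + ε)) ≤ 0 :=
    ge_of_tendsto (hbigO.trans_tendsto (tendsto_rpow_neg_atTop hε))
      ((eventually_ge_atTop T).mono hgrow)
  exact nonpos_of_mul_nonpos_left hle (Real.rpow_pos_of_pos hT _)

/- By the margin `ε`, the gap between two ordered solutions would grow at least like `s ^ (1 + ε)`,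
whereas goodness at infinity only allows linear growth. -/
theorem le_of_isGoodAtInfinity {m p k l c : ℝ} (H : Admissible m p k l) {P P' Q Q' : ℝ → ℝ}
    (hQ : ∀ s, 0 < s → 0 < Q s)
    (dP : ∀ s, 0 < s → HasDerivAt P (P' s) s) (dQ : ∀ s, 0 < s → HasDerivAt Q (Q' s) s)
    (hP' : ∀ s, 0 < s → slopeField m p k l c s (P s) ≤ P' s)
    (hQ' : ∀ s, 0 < s → Q' s ≤ slopeField m p k l c s (Q s))
    (gP : IsGoodAtInfinity m k P) (gQ : IsGoodAtInfinity m k Q) {s : ℝ} (hs : 0 < s) :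
    P s ≤ Q s := by
  by_contra! hlt
  have hgap : ∀ t, s ≤ t → 0 < P t - Q t := fun t ht => (sub_pos.2 hlt).trans_le <|
    le_of_hasDerivAt_nonneg_of_pos (u := fun t => P t - Q t) ht
      (fun x hx => (dP x (hs.trans_le hx.1)).sub (dQ x (hs.trans_le hx.1))) (sub_pos.2 hlt)
      fun x hx hpos => by
        have hx0 := hs.trans_le hx.1
        have := slopeField_mono H hx0 (c := c) (hQ x hx0) (sub_pos.1 hpos).le
        linarith [hP' x hx0, hQ' x hx0]
  obtain ⟨ε, hε, hmargin⟩ := H.exists_margin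
  obtain ⟨T, hT⟩ := eventually_atTop.1
    ((gP.eventually_le H.one_lt hε).and (eventually_ge_atTop s))
  have hsT : s ≤ T := (hT T le_rfl).2
  have hT0 : 0 < T := hs.trans_le hsT
  have hgrow : ∀ t, T ≤ t → (P T - Q T) * T ^ (-(1 + ε)) ≤ (P t - Q t) * t ^ (-(1 + ε)) :=
    fun t ht => mul_rpow_neg_le_of_hasDerivAt (u := fun x => P x - Q x) hT0 ht
      (fun x hx => (dP x (hT0.trans_le hx.1)).sub (dQ x (hT0.trans_le hx.1))) fun x hx => by
        have hx0 := hT0.trans_le hx.1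
        have := H.mul_sub_div_le_slopeField_sub (c := c) hε hmargin.le hx0 (hQ x hx0)
          (sub_pos.1 (hgap x (hsT.trans hx.1))).le (hT x hx.1).1
        linarith [hP' x hx0, hQ' x hx0]
  have hlinear : (fun t => P t - Q t) =O[atTop] fun t => t :=
    (gP.sub gQ).congr_left fun t => by ring
  exact (hgap T hsT).not_ge <|
    nonpos_of_mul_rpow_neg_le_of_isBigO (u := fun t => P t - Q t) hε hT0 hlinear hgrow

namespace IsOrbit

variable {m p k l c : ℝ} {P Q : ℝ → ℝ}

theorem continuousOn (h : IsOrbit m p k l c P) : ContinuousOn P (Set.Ioi 0) := fun s hs =>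
  (h.hasDerivAt s hs).continuousAt.continuousWithinAt

theorem antitone_speed (H : Admissible m p k l) {c₁ c₂ : ℝ} (hc : c₁ ≤ c₂)
    (h₁ : IsOrbit m p k l c₁ P) (h₂ : IsOrbit m p k l c₂ Q) (g₁ : IsGoodAtInfinity m k P)
    (g₂ : IsGoodAtInfinity m k Q) {s : ℝ} (hs : 0 < s) : Q s ≤ P s :=
  le_of_isGoodAtInfinity (c := c₁) H h₁.pos h₂.hasDerivAt h₁.hasDerivAt
    (fun s _ => by unfold slopeField; gcongr) (fun _ _ => le_rfl) g₂ g₁ hs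

theorem unique (H : Admissible m p k l) (h₁ : IsOrbit m p k l c P) (h₂ : IsOrbit m p k l c Q)
    (g₁ : IsGoodAtInfinity m k P) (g₂ : IsGoodAtInfinity m k Q) {s : ℝ} (hs : 0 < s) :
    P s = Q s :=
  le_antisymm (antitone_speed H le_rfl h₂ h₁ g₂ g₁ hs) (antitone_speed H le_rfl h₁ h₂ g₁ g₂ hs)

end IsOrbit

section LimitODE

variable {ι : Type*} {L : Filter ι} {P F : ι → ℝ → ℝ} {Q G : ℝ → ℝ} {a b M : ℝ}

theorem continuousOn_of_tendsto_of_hasDerivAt [L.NeBot] (hM : 0 ≤ M)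
    (hP : ∀ᶠ n in L, ∀ t ∈ Set.Icc a b, HasDerivAt (P n) (F n t) t ∧ ‖F n t‖ ≤ M)
    (hlim : ∀ t ∈ Set.Icc a b, Tendsto (fun n => P n t) L (𝓝 (Q t))) :
    ContinuousOn Q (Set.Icc a b) := by
  refine (LipschitzOnWith.of_dist_le_mul (K := M.toNNReal) fun x hx y hy => ?_).continuousOn
  refine le_of_tendsto ((hlim x hx).dist (hlim y hy)) (hP.mono fun n hn => ?_)
  simpa only [dist_eq_norm, Real.coe_toNNReal M hM] using
    (convex_Icc a b).norm_image_sub_le_of_norm_hasDerivWithin_le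
      (fun t ht => (hn t ht).1.hasDerivWithinAt) (fun t ht => (hn t ht).2) hy hx

theorem eq_add_integral_of_tendsto [L.NeBot] [L.IsCountablyGenerated]
    (hP : ∀ᶠ n in L, ∀ t ∈ Set.Icc a b, HasDerivAt (P n) (F n t) t ∧ ‖F n t‖ ≤ M)
    (hF : ∀ᶠ n in L, ContinuousOn (F n) (Set.Icc a b))
    (hlim : ∀ t ∈ Set.Icc a b, Tendsto (fun n => P n t) L (𝓝 (Q t)))
    (hlim' : ∀ t ∈ Set.Icc a b, Tendsto (fun n => F n t) L (𝓝 (G t)))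
    {t : ℝ} (ht : t ∈ Set.Icc a b) : Q t = Q a + ∫ x in a..t, G x := by
  have hsub : Set.Icc a t ⊆ Set.Icc a b := Set.Icc_subset_Icc_right ht.2
  have hsub' : ∀ x ∈ Set.uIoc a t, x ∈ Set.Icc a b := fun x hx =>
    hsub (Set.Ioc_subset_Icc_self (Set.uIoc_of_le ht.1 ▸ hx))
  have hdiff : Tendsto (fun n => P n t - P n a) L (𝓝 (Q t - Q a)) :=
    (hlim t ht).sub (hlim a ⟨le_rfl, ht.1.trans ht.2⟩)
  have hint : Tendsto (fun n => ∫ x in a..t, F n x) L (𝓝 (∫ x in a..t, G x)) := by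
    refine intervalIntegral.tendsto_integral_filter_of_dominated_convergence (fun _ => M) ?_ ?_
      intervalIntegrable_const (.of_forall fun x hx => hlim' x (hsub' x hx))
    · filter_upwards [hF] with n hn
      exact (hn.mono hsub').aestronglyMeasurable measurableSet_uIoc
    · filter_upwards [hP] with n hn
      exact .of_forall fun x hx => (hn x (hsub' x hx)).2
  have hFTC : (fun n => P n t - P n a) =ᶠ[L] fun n => ∫ x in a..t, F n x := by
    filter_upwards [hP, hF] with n hn hFn
    rw [← Set.uIcc_of_le ht.1] at hsub
    exact (intervalIntegral.integral_eq_sub_of_hasDerivAt (fun x hx => (hn x (hsub hx)).1)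
      (hFn.mono hsub).intervalIntegrable).symm
  exact eq_add_of_sub_eq' (tendsto_nhds_unique (hdiff.congr' hFTC) hint)

theorem hasDerivAt_of_tendsto_of_norm_le [L.NeBot] [L.IsCountablyGenerated]
    (hP : ∀ᶠ n in L, ∀ t ∈ Set.Icc a b, HasDerivAt (P n) (F n t) t ∧ ‖F n t‖ ≤ M)
    (hF : ∀ᶠ n in L, ContinuousOn (F n) (Set.Icc a b))
    (hlim : ∀ t ∈ Set.Icc a b, Tendsto (fun n => P n t) L (𝓝 (Q t)))
    (hlim' : ∀ t ∈ Set.Icc a b, Tendsto (fun n => F n t) L (𝓝 (G t)))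
    (hG : ContinuousOn G (Set.Icc a b)) {s : ℝ} (hs : s ∈ Set.Ioo a b) :
    HasDerivAt Q (G s) s := by
  have hnhds : Set.Icc a b ∈ 𝓝 s := Icc_mem_nhds hs.1 hs.2
  have hGint : IntervalIntegrable G volume a s := by
    refine ContinuousOn.intervalIntegrable ?_
    rw [Set.uIcc_of_le hs.1.le]
    exact hG.mono (Set.Icc_subset_Icc_right hs.2.le)
  have hmeas : StronglyMeasurableAtFilter G (𝓝 s) :=
    (hG.stronglyMeasurableAtFilter_nhdsWithin measurableSet_Icc s).filter_mono
      (nhdsWithin_eq_nhds.2 hnhds).ge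
  refine ((intervalIntegral.integral_hasDerivAt_right hGint hmeas
    (hG.continuousAt hnhds)).const_add (Q a)).congr_of_eventuallyEq ?_
  filter_upwards [hnhds] with t ht
  exact eq_add_integral_of_tendsto hP hF hlim hlim' ht

end LimitODE

theorem hasDerivAt_of_tendsto_orbits {ι : Type*} {L : Filter ι} [L.NeBot]
    [L.IsCountablyGenerated] {m p k l c : ℝ} {P : ι → ℝ → ℝ} {cn : ι → ℝ} {Q d : ℝ → ℝ}
    (hc : Tendsto cn L (𝓝 c))
    (hd : ContinuousOn d (Set.Ioi 0)) (hdpos : ∀ s, 0 < s → 0 < d s)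
    (hP : ∀ s₀ s₁ : ℝ, 0 < s₀ → ∀ᶠ n in L, ∀ s ∈ Set.Icc s₀ s₁,
      HasDerivAt (P n) (slopeField m p k l (cn n) s (P n s)) s ∧ d s ≤ P n s)
    (hlim : ∀ s, 0 < s → Tendsto (fun n => P n s) L (𝓝 (Q s))) {s : ℝ} (hs : 0 < s) :
    HasDerivAt Q (slopeField m p k l c s (Q s)) s := by
  have hs₀ : 0 < s / 2 := by positivity
  have hpos : ∀ t ∈ Set.Icc (s / 2) (2 * s), 0 < t := fun t ht => hs₀.trans_le ht.1
  have hdpos' : ∀ t ∈ Set.Icc (s / 2) (2 * s), 0 < d t := fun t ht => hdpos t (hpos t ht)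
  have hlim' : ∀ t ∈ Set.Icc (s / 2) (2 * s), Tendsto (fun n => P n t) L (𝓝 (Q t)) :=
    fun t ht => hlim t (hpos t ht)
  have hev := hP (s / 2) (2 * s) hs₀
  obtain ⟨M, hM0, hM⟩ := exists_norm_slopeField_le m p k l (|c| + 1) isCompact_Icc hpos
    (hd.mono hpos) hdpos'
  have hbound : ∀ᶠ n in L, ∀ t ∈ Set.Icc (s / 2) (2 * s),
      HasDerivAt (P n) (slopeField m p k l (cn n) t (P n t)) t ∧
        ‖slopeField m p k l (cn n) t (P n t)‖ ≤ M := by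
    filter_upwards [hev, hc.abs.eventually_le_const (lt_add_one |c|)] with n hn hcn t ht
    exact ⟨(hn t ht).1, hM _ hcn t ht _ (hn t ht).2⟩
  have hQpos : ∀ t ∈ Set.Icc (s / 2) (2 * s), 0 < Q t := fun t ht =>
    (hdpos' t ht).trans_le (ge_of_tendsto (hlim' t ht) (hev.mono fun n hn => (hn t ht).2))
  refine hasDerivAt_of_tendsto_of_norm_le hbound (hev.mono fun n hn => ?_) hlim' (fun t ht => ?_)
    (continuousOn_slopeField hpos (continuousOn_of_tendsto_of_hasDerivAt hM0 hbound hlim') hQpos)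
    ⟨by linarith, by linarith⟩
  · exact continuousOn_slopeField hpos (fun t ht => (hn t ht).1.continuousAt.continuousWithinAt)
      fun t ht => (hdpos' t ht).trans_le (hn t ht).2
  · exact (hc.add_const _).sub (tendsto_const_nhds.div (hlim' t ht) (hQpos t ht).ne')

theorem abs_div_max_sub_div_max_le {d : ℝ} (hd : 0 < d) (b x y : ℝ) :
    |b / max x d - b / max y d| ≤ |b / d ^ 2| * |x - y| := by
  have hx : d ≤ max x d := le_max_right _ _
  have hy : d ≤ max y d := le_max_right _ _
  have hx0 := hd.trans_le hx
  have hy0 := hd.trans_le hy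
  have hsub : b / max x d - b / max y d
      = b * (max y d - max x d) / (max x d * max y d) := by
    field_simp
  have hmax : |max y d - max x d| ≤ |x - y| := by
    rw [abs_sub_comm]; exact abs_max_sub_max_le_abs x y d
  have hsq : d ^ 2 ≤ max x d * max y d := by rw [sq]; gcongr
  rw [hsub, abs_div, abs_mul, abs_of_pos (mul_pos hx0 hy0), abs_div, abs_of_pos (pow_pos hd 2)]
  calc |b| * |max y d - max x d| / (max x d * max y d) ≤ |b| * |x - y| / d ^ 2 := by gcongr
    _ = |b| / d ^ 2 * |x - y| := by ring

theorem norm_div_max_le {d : ℝ} (hd : 0 < d) (b x : ℝ) : ‖b / max x d‖ ≤ ‖b / d‖ := by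
  rw [norm_div, norm_div, Real.norm_of_nonneg hd.le,
    Real.norm_of_nonneg (hd.le.trans (le_max_right _ _))]
  gcongr
  exact le_max_right _ _

theorem exists_hasDerivWithinAt_truncated {A B d : ℝ → ℝ} {s₀ s₁ t₀ : ℝ}
    (ht₀ : t₀ ∈ Set.Icc s₀ s₁) (hA : ContinuousOn A (Set.Icc s₀ s₁))
    (hB : ContinuousOn B (Set.Icc s₀ s₁)) (hd : ContinuousOn d (Set.Icc s₀ s₁))
    (hpos : ∀ s ∈ Set.Icc s₀ s₁, 0 < d s) (x₀ : ℝ) :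
    ∃ P : ℝ → ℝ, P t₀ = x₀ ∧ ∀ s ∈ Set.Icc s₀ s₁,
      HasDerivWithinAt P (A s - B s / max (P s) (d s)) (Set.Icc s₀ s₁) s := by
  obtain ⟨L₁, hL₁⟩ := isCompact_Icc.exists_bound_of_continuousOn hA
  obtain ⟨L₂, hL₂⟩ := isCompact_Icc.exists_bound_of_continuousOn
    (hB.div hd fun s hs => (hpos s hs).ne')
  obtain ⟨K, hK⟩ := isCompact_Icc.exists_bound_of_continuousOn
    (hB.div (hd.pow 2) fun s hs => (pow_pos (hpos s hs) 2).ne')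
  set L : NNReal := ⟨|L₁| + |L₂|, by positivity⟩
  set R : NNReal := L * ⟨s₁ - s₀, by linarith [ht₀.1.trans ht₀.2]⟩ with hR
  have hPL : IsPicardLindelof (fun s x => A s - B s / max x (d s)) (⟨t₀, ht₀⟩ : Set.Icc s₀ s₁)
      x₀ R 0 L ⟨|K|, abs_nonneg K⟩ := by
    refine ⟨fun s hs => LipschitzOnWith.of_dist_le_mul fun x _ y _ => ?_, fun x _ => ?_,
      fun s hs x _ => ?_, ?_⟩
    · rw [Real.dist_eq, Real.dist_eq, sub_sub_sub_cancel_left, abs_sub_comm x y]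
      exact (abs_div_max_sub_div_max_le (hpos s hs) (B s) y x).trans
        (mul_le_mul_of_nonneg_right ((hK s hs).trans (le_abs_self K)) (abs_nonneg _))
    · exact hA.sub (hB.div (.sup continuousOn_const hd) fun s hs =>
        ((hpos s hs).trans_le (le_max_right _ _)).ne')
    · calc ‖A s - B s / max x (d s)‖ ≤ ‖A s‖ + ‖B s / d s‖ :=
            (norm_sub_le _ _).trans (add_le_add_right (norm_div_max_le (hpos s hs) _ _) _)
        _ ≤ |L₁| + |L₂| := add_le_add ((hL₁ s hs).trans (le_abs_self L₁))
            ((hL₂ s hs).trans (le_abs_self L₂))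
    · simp only [hR, NNReal.coe_zero, sub_zero]
      exact mul_le_mul_of_nonneg_left
        (max_le (sub_le_sub_left ht₀.1 s₁) (sub_le_sub_right ht₀.2 s₀)) L.2
  exact hPL.exists_eq_forall_mem_Icc_hasDerivWithinAt₀

/-! ### Existence of good orbits -/

section barriers

/-- The perturbation `k s ^ m + γ s + K` of the leading-order good orbit `k s ^ m`; for suitable
`γ` and `K` it is a sub- or supersolution of the phase-plane equation. -/
def barrier (m k γ K s : ℝ) : ℝ := k * s ^ m + γ * s + K

variable {m p k l c γ K s : ℝ}

theorem hasDerivAt_barrier (hm : 1 ≤ m) (k γ K s : ℝ) :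
    HasDerivAt (barrier m k γ K) (k * (m * s ^ (m - 1)) + γ) s := by
  have hpow := (Real.hasDerivAt_rpow_const (x := s) (.inr hm)).const_mul k
  have hlin := (hasDerivAt_id s).const_mul γ
  rw [mul_one] at hlin
  exact (hpow.add hlin).add_const K

theorem isGoodAtInfinity_barrier (m k γ K : ℝ) : IsGoodAtInfinity m k (barrier m k γ K) := by
  have hlin : (fun s : ℝ => γ * s + K) =O[atTop] fun s => s :=
    (Asymptotics.isBigO_const_mul_self γ _ _).add
      (Asymptotics.isLittleO_const_id_atTop K).isBigO
  exact hlin.congr_left fun s => by unfold barrier; ring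

theorem slopeField_barrier (hQ : barrier m k γ K s ≠ 0) :
    slopeField m p k l c s (barrier m k γ K s) = k * (m * s ^ (m - 1)) + γ
      + (c - γ + m * s ^ (m - 1) * (l * (γ * s + K) - s ^ p) / barrier m k γ K s) := by
  unfold slopeField barrier at *
  field_simp
  ring

theorem slopeField_mul_rpow {z : ℝ} (hz : z ≠ 0) (hs : 0 < s) :
    slopeField m p k l c s (z * s ^ (m + p - 1))
      = c + (k + l) * m * s ^ (m - 1) - m / z * (k * l * s ^ (m - p) + 1) := by
  have hpow : s ^ m = s ^ (m - p) * s ^ p := by rw [← Real.rpow_add hs, sub_add_cancel]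
  unfold slopeField
  rw [rpow_add_sub_one hs, hpow]
  field_simp

theorem slopeField_lowerBarrier_le (H : Admissible m p k l) (hc : 0 ≤ c) (hs : 0 < s)
    (hγ : γ = -(c * k / (m * l - k))) (hQ : 0 < barrier m k γ 0 s) :
    slopeField m p k l c s (barrier m k γ 0 s) ≤ k * (m * s ^ (m - 1)) + γ := by
  obtain ⟨hm, -, -, hk, hl, hkl⟩ := H
  have hkl' : 0 < m * l - k := by linarith
  have hγ0 : 0 ≤ -γ := by rw [hγ, neg_neg]; positivity
  have hγs : 0 ≤ -γ * s := by positivity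
  rw [slopeField_barrier hQ.ne', add_le_iff_nonpos_right]
  have hle : m * s ^ (m - 1) * (l * (-γ * s)) / (k * s ^ m)
      ≤ m * s ^ (m - 1) * (l * (-γ * s) + s ^ p) / barrier m k γ 0 s := by
    have hQle : barrier m k γ 0 s ≤ k * s ^ m := by unfold barrier; linarith
    have : 0 ≤ s ^ p := by positivity
    gcongr
    linarith
  have hleading : m * s ^ (m - 1) * (l * (-γ * s)) / (k * s ^ m) = c - γ := by
    rw [← rpow_sub_one_mul hs m, hγ]
    field_simp
    ring
  have hneg : m * s ^ (m - 1) * (l * (γ * s + 0) - s ^ p) / barrier m k γ 0 s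
      = -(m * s ^ (m - 1) * (l * (-γ * s) + s ^ p) / barrier m k γ 0 s) := by ring
  linarith

theorem le_slopeField_upperBarrier (hm : 0 ≤ m) (hs : 0 ≤ s) (hsK : s ^ p ≤ l * (c * s + K))
    (hQ : 0 < barrier m k c K s) :
    k * (m * s ^ (m - 1)) + c ≤ slopeField m p k l c s (barrier m k c K s) := by
  have : 0 ≤ l * (c * s + K) - s ^ p := sub_nonneg.2 hsK
  rw [slopeField_barrier hQ.ne', sub_self, zero_add]
  exact le_add_of_nonneg_right (by positivity)

theorem mul_rpow_le_barrier {δ q : ℝ} (hδ : δ ≤ k) (hk : 0 ≤ k) (hq : q ≤ m) (hs : 1 ≤ s)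
    (hγ : 0 ≤ γ) (hK : 0 ≤ K) : δ * s ^ q ≤ barrier m k γ K s := by
  have : 0 ≤ s := zero_le_one.trans hs
  calc δ * s ^ q ≤ k * s ^ m := by gcongr
    _ ≤ k * s ^ m + (γ * s + K) := le_add_of_nonneg_right (by positivity)
    _ = barrier m k γ K s := (add_assoc _ _ _).symm

theorem barrier_mono {γ' K' : ℝ} (hs : 0 ≤ s) (hγ : γ ≤ γ') (hK : K ≤ K') :
    barrier m k γ K s ≤ barrier m k γ' K' s := by
  unfold barrier
  gcongr

theorem rpow_sub_one_le_one_add (hp : p ≤ 1) (hm : 1 ≤ m) (hs : 0 ≤ s) :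
    s ^ (m - 1) ≤ 1 + s ^ (m - p) := by
  rcases le_total s 1 with h | h
  · exact (Real.rpow_le_one hs h (by linarith)).trans
      (le_add_of_nonneg_right (Real.rpow_nonneg hs _))
  · linarith [Real.rpow_le_rpow_of_exponent_le h (show m - 1 ≤ m - p by linarith)]

theorem exists_slopeField_mul_rpow_nonpos (H : Admissible m p k l) (c : ℝ) :
    ∃ δ, 0 < δ ∧ δ ≤ k ∧ ∀ s : ℝ, 0 < s → slopeField m p k l c s (δ * s ^ (m + p - 1)) ≤ 0 := by
  obtain ⟨hm, -, hp, hk, hl, -⟩ := H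
  have hm0 : 0 < m := by linarith
  have hev : ∀ᶠ δ in 𝓝[>] (0 : ℝ), δ ≤ k ∧ δ * (c + (k + l) * m) ≤ m ∧ δ * (k + l) ≤ k * l := by
    have hsmall : ∀ a b : ℝ, 0 < b → ∀ᶠ δ in 𝓝[>] (0 : ℝ), δ * a ≤ b := fun a b hb =>
      ((continuous_mul_const a).tendsto' 0 0 (zero_mul a)).mono_left nhdsWithin_le_nhds
        |>.eventually_le_const hb
    filter_upwards [hsmall 1 k hk, hsmall (c + (k + l) * m) m hm0,
      hsmall (k + l) (k * l) (by positivity)] with δ h₁ h₂ h₃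
    exact ⟨mul_one δ ▸ h₁, h₂, h₃⟩
  obtain ⟨δ, ⟨hδk, hδc, hδl⟩, hδ : 0 < δ⟩ := (hev.and self_mem_nhdsWithin).exists
  refine ⟨δ, hδ, hδk, fun s hs => ?_⟩
  rw [slopeField_mul_rpow hδ.ne' hs, sub_nonpos, div_mul_eq_mul_div, le_div_iff₀ hδ]
  calc (c + (k + l) * m * s ^ (m - 1)) * δ
      ≤ (c + (k + l) * m * (1 + s ^ (m - p))) * δ := by
        gcongr
        exact rpow_sub_one_le_one_add hp.le hm.le hs.le
    _ = δ * (c + (k + l) * m) + m * s ^ (m - p) * (δ * (k + l)) := by ring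
    _ ≤ m + m * s ^ (m - p) * (k * l) := by gcongr
    _ = m * (k * l * s ^ (m - p) + 1) := by ring

theorem exists_rpow_le_mul_add (hp0 : 0 < p) (hp1 : p < 1) {q : ℝ} (hq : 0 < q) :
    ∃ K, 0 ≤ K ∧ ∀ s : ℝ, 0 < s → s ^ p ≤ q * s + K := by
  obtain ⟨T, hT⟩ := eventually_atTop.1
    ((eventually_mul_le_mul_rpow (one_lt_one_div hp0 hp1) 1 hq).and (eventually_ge_atTop 0))
  refine ⟨T, (hT T le_rfl).2, fun s hs => ?_⟩
  rcases le_total T (s ^ p) with h | h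
  · have hle := (hT _ h).1
    rw [one_mul, ← Real.rpow_mul hs.le, mul_one_div_cancel hp0.ne', Real.rpow_one] at hle
    exact hle.trans (le_add_of_nonneg_right (hT T le_rfl).2)
  · exact h.trans (le_add_of_nonneg_left (by positivity))

end barriers

section comparison

variable {m p k l c s₀ s₁ : ℝ} {P Q Q' : ℝ → ℝ}

theorem le_of_le_slopeField (H : Admissible m p k l) (h0 : 0 < s₀) (h01 : s₀ ≤ s₁)
    (hP : ∀ t ∈ Set.Icc s₀ s₁, HasDerivAt P (slopeField m p k l c t (P t)) t)
    (hQ : ∀ t ∈ Set.Icc s₀ s₁, 0 < Q t) (dQ : ∀ t ∈ Set.Icc s₀ s₁, HasDerivAt Q (Q' t) t)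
    (hQ' : ∀ t ∈ Set.Icc s₀ s₁, Q' t ≤ slopeField m p k l c t (Q t)) (hle : P s₁ ≤ Q s₁) :
    P s₀ ≤ Q s₀ :=
  le_of_barrier h01 hP dQ hle fun t ht hlt =>
    (hQ' t ht).trans (slopeField_mono H (h0.trans_le ht.1) (hQ t ht) hlt.le)

theorem le_of_slopeField_le (H : Admissible m p k l) (h0 : 0 < s₀) (h01 : s₀ ≤ s₁)
    (hP : ∀ t ∈ Set.Icc s₀ s₁, HasDerivAt P (slopeField m p k l c t (P t)) t)
    (hPpos : ∀ t ∈ Set.Icc s₀ s₁, 0 < P t) (dQ : ∀ t ∈ Set.Icc s₀ s₁, HasDerivAt Q (Q' t) t)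
    (hQ' : ∀ t ∈ Set.Icc s₀ s₁, 0 < Q t → slopeField m p k l c t (Q t) ≤ Q' t)
    (hle : Q s₁ ≤ P s₁) : Q s₀ ≤ P s₀ :=
  le_of_barrier h01 dQ hP hle fun t ht hlt =>
    (slopeField_mono H (h0.trans_le ht.1) (hPpos t ht) hlt.le).trans
      (hQ' t ht ((hPpos t ht).trans hlt))

end comparison

section existence

variable {m p k l c : ℝ}

theorem exists_solution_on_Icc_of_slopeField_le {d d' : ℝ → ℝ} {a T x₀ : ℝ} (ha : 0 < a)
    (haT : a ≤ T) (hdpos : ∀ s, 0 < s → 0 < d s) (hd : ∀ s, 0 < s → HasDerivAt d (d' s) s)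
    (hd' : ∀ s, 0 < s → slopeField m p k l c s (d s) ≤ d' s) (hx₀ : d T ≤ x₀) :
    ∃ P : ℝ → ℝ, P T = x₀ ∧ ∀ s ∈ Set.Icc a T,
      HasDerivAt P (slopeField m p k l c s (P s)) s ∧ d s ≤ P s := by
  have hpos : ∀ s ∈ Set.Icc (a / 2) (2 * T), 0 < s := fun s hs => (half_pos ha).trans_le hs.1
  have hpow : ∀ q : ℝ, ContinuousOn (fun s : ℝ => s ^ q) (Set.Icc (a / 2) (2 * T)) := fun q =>
    continuousOn_id.rpow_const fun s hs => .inl (hpos s hs).ne'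
  have := hpow (m - 1)
  have := hpow m
  have := hpow p
  obtain ⟨P, hPT, hP⟩ := exists_hasDerivWithinAt_truncated (t₀ := T) (d := d)
    (A := fun s => c + (k + l) * m * s ^ (m - 1))
    (B := fun s => m * s ^ (m - 1) * (k * l * s ^ m + s ^ p))
    (s₀ := a / 2) (s₁ := 2 * T) ⟨by linarith, by linarith⟩ (by fun_prop) (by fun_prop)
    (fun s hs => (hd s (hpos s hs)).continuousAt.continuousWithinAt)
    (fun s hs => hdpos s (hpos s hs)) x₀
  have hmax : ∀ s ∈ Set.Icc a T, HasDerivAt P (slopeField m p k l c s (max (P s) (d s))) s :=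
    fun s hs => (hP s ⟨by linarith [hs.1], by linarith [hs.1, hs.2]⟩).hasDerivAt
      (Icc_mem_nhds (by linarith [hs.1]) (by linarith [hs.1, hs.2]))
  have hdP : ∀ s ∈ Set.Icc a T, d s ≤ P s := fun s hs => by
    have hsub : ∀ t ∈ Set.Icc s T, t ∈ Set.Icc a T := fun t ht => ⟨hs.1.trans ht.1, ht.2⟩
    refine le_of_barrier hs.2 (fun t ht => hd t (ha.trans_le (hsub t ht).1))
      (fun t ht => hmax t (hsub t ht)) (hPT ▸ hx₀) fun t ht hlt => ?_
    rw [max_eq_right hlt.le]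
    exact hd' t (ha.trans_le (hsub t ht).1)
  refine ⟨P, hPT, fun s hs => ⟨?_, hdP s hs⟩⟩
  simpa only [max_eq_left (hdP s hs)] using hmax s hs

theorem exists_solution_on_Icc (H : Admissible m p k l) (hc : 0 < c) {K δ T : ℝ} (hK : 0 ≤ K)
    (hKs : ∀ s : ℝ, 0 < s → s ^ p ≤ l * (c * s + K)) (hδ : 0 < δ) (hδk : δ ≤ k)
    (hδs : ∀ s : ℝ, 0 < s → slopeField m p k l c s (δ * s ^ (m + p - 1)) ≤ 0) (hT : 1 ≤ T) :
    ∃ P : ℝ → ℝ, P T = barrier m k c K T ∧ ∀ s ∈ Set.Icc (1 / T) T,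
      HasDerivAt P (slopeField m p k l c s (P s)) s ∧ δ * s ^ (m + p - 1) ≤ P s ∧
      barrier m k (-(c * k / (m * l - k))) 0 s ≤ P s ∧ P s ≤ barrier m k c K s := by
  obtain ⟨hm, hp0, hp1, hk, hl, hkl⟩ := id H
  have hT0 : 0 < T := by linarith
  have hmp : 0 ≤ m + p - 1 := by linarith
  have hinv : 1 / T ≤ T := ((div_le_one₀ hT0).2 hT).trans hT
  obtain ⟨P, hPT, hP⟩ := exists_solution_on_Icc_of_slopeField_le (one_div_pos.2 hT0) hinv
    (d := fun s => δ * s ^ (m + p - 1)) (fun s hs => by positivity)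
    (fun s hs => (Real.hasDerivAt_rpow_const (.inl hs.ne')).const_mul δ)
    (fun s hs => (hδs s hs).trans (by positivity))
    (mul_rpow_le_barrier hδk hk.le (by linarith : m + p - 1 ≤ m) hT hc.le hK)
  have hpos : ∀ s ∈ Set.Icc (1 / T) T, 0 < s := fun s hs => (one_div_pos.2 hT0).trans_le hs.1
  have hsub : ∀ s ∈ Set.Icc (1 / T) T, ∀ t ∈ Set.Icc s T, t ∈ Set.Icc (1 / T) T :=
    fun s hs t ht => ⟨hs.1.trans ht.1, ht.2⟩
  refine ⟨P, hPT, fun s hs => ⟨(hP s hs).1, (hP s hs).2, ?_, ?_⟩⟩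
  · refine le_of_slopeField_le H (hpos s hs) hs.2 (fun t ht => (hP t (hsub s hs t ht)).1)
      (fun t ht => ?_) (fun t _ => hasDerivAt_barrier hm.le _ _ _ t)
      (fun t ht => slopeField_lowerBarrier_le H hc.le (hpos t (hsub s hs t ht)) rfl) ?_
    · have := hpos t (hsub s hs t ht)
      exact lt_of_lt_of_le (by positivity) (hP t (hsub s hs t ht)).2
    · have hγ : 0 ≤ c * k / (m * l - k) := div_nonneg (by positivity) (by linarith)
      exact hPT ▸ barrier_mono hT0.le (by linarith) hK
  · have hQ : ∀ t, 0 < t → 0 < barrier m k c K t := fun t ht => by unfold barrier; positivity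
    have ht0 : ∀ t ∈ Set.Icc s T, 0 < t := fun t ht => hpos t (hsub s hs t ht)
    exact le_of_le_slopeField H (hpos s hs) hs.2 (fun t ht => (hP t (hsub s hs t ht)).1)
      (fun t ht => hQ t (ht0 t ht)) (fun t _ => hasDerivAt_barrier hm.le _ _ _ t)
      (fun t ht => le_slopeField_upperBarrier (by linarith) (ht0 t ht).le (hKs t (ht0 t ht))
        (hQ t (ht0 t ht))) hPT.le

theorem eventually_Icc_subset_Icc_one_div {s₀ : ℝ} (h0 : 0 < s₀) (s₁ : ℝ) :
    ∀ᶠ T : ℝ in atTop, Set.Icc s₀ s₁ ⊆ Set.Icc (1 / T) T := by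
  filter_upwards [eventually_ge_atTop (1 / s₀), eventually_ge_atTop s₁] with T hT₀ hT₁
  refine Set.Icc_subset_Icc ?_ hT₁
  exact (one_div_le ((one_div_pos.2 h0).trans_le hT₀) h0).2 hT₀

theorem exists_tendsto_of_antitoneOn_Ici {f : ℝ → ℝ} {T₀ b : ℝ} (hf : AntitoneOn f (Set.Ici T₀))
    (hb : ∀ T, T₀ ≤ T → b ≤ f T) : ∃ L, Tendsto f atTop (𝓝 L) := by
  have hanti : Antitone fun T => f (max T T₀) := fun T T' hT =>
    hf (Set.mem_Ici.2 (le_max_right _ _)) (Set.mem_Ici.2 (le_max_right _ _))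
      (max_le_max_right T₀ hT)
  have hbdd : BddBelow (Set.range fun T => f (max T T₀)) :=
    ⟨b, Set.forall_mem_range.2 fun T => hb _ (le_max_right _ _)⟩
  refine ⟨_, (tendsto_atTop_ciInf hanti hbdd).congr' ?_⟩
  filter_upwards [eventually_ge_atTop T₀] with T hT
  rw [max_eq_left hT]

theorem exists_antitone_solutions (H : Admissible m p k l) (hc : 0 < c) :
    ∃ (P : ℝ → ℝ → ℝ) (δ K : ℝ), 0 < δ ∧
      (∀ T, 1 ≤ T → ∀ s ∈ Set.Icc (1 / T) T,
        HasDerivAt (P T) (slopeField m p k l c s (P T s)) s ∧ δ * s ^ (m + p - 1) ≤ P T s ∧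
        barrier m k (-(c * k / (m * l - k))) 0 s ≤ P T s ∧ P T s ≤ barrier m k c K s) ∧
      ∀ T T' s, 1 ≤ T → T ≤ T' → s ∈ Set.Icc (1 / T) T → P T' s ≤ P T s := by
  have hl := H.l_pos
  obtain ⟨K, hK, hKs⟩ : ∃ K, 0 ≤ K ∧ ∀ s : ℝ, 0 < s → s ^ p ≤ l * (c * s + K) := by
    obtain ⟨K, hK, hKs⟩ := exists_rpow_le_mul_add H.p_pos H.p_lt (mul_pos hl hc)
    refine ⟨K / l, by positivity, fun s hs => (hKs s hs).trans_eq ?_⟩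
    field_simp
  obtain ⟨δ, hδ, hδk, hδs⟩ := exists_slopeField_mul_rpow_nonpos H c
  choose! P hPT hP using fun (T : ℝ) (hT : 1 ≤ T) =>
    exists_solution_on_Icc H hc hK hKs hδ hδk hδs hT
  refine ⟨P, δ, K, hδ, hP, fun T T' s hT hTT' hs => ?_⟩
  have hT0 : 0 < T := by linarith
  have hs0 : 0 < s := (one_div_pos.2 hT0).trans_le hs.1
  have hsub : ∀ t ∈ Set.Icc s T, t ∈ Set.Icc (1 / T) T := fun t ht => ⟨hs.1.trans ht.1, ht.2⟩
  have hsub' : ∀ t ∈ Set.Icc s T, t ∈ Set.Icc (1 / T') T' := fun t ht =>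
    Set.Icc_subset_Icc (one_div_le_one_div_of_le hT0 hTT') hTT' (hsub t ht)
  refine le_of_le_slopeField H hs0 hs.2 (fun t ht => (hP T' (hT.trans hTT') t (hsub' t ht)).1)
    (fun t ht => ?_) (fun t ht => (hP T hT t (hsub t ht)).1) (fun t _ => le_rfl) ?_
  · have := hs0.trans_le ht.1
    exact lt_of_lt_of_le (by positivity) (hP T hT t (hsub t ht)).2.1
  · rw [hPT T hT]
    exact (hP T' (hT.trans hTT') T (hsub' T ⟨hs.2, le_rfl⟩)).2.2.2

/- The orbit is the decreasing limit, as `T → ∞`, of the solutions on `[1 / T, T]` that start from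
the upper barrier at `T`. -/
theorem exists_isOrbit_isGoodAtInfinity (H : Admissible m p k l) (hc : 0 < c) :
    ∃ P : ℝ → ℝ, IsOrbit m p k l c P ∧ IsGoodAtInfinity m k P ∧
      ∃ δ, 0 < δ ∧ ∀ s, 0 < s → δ * s ^ (m + p - 1) ≤ P s := by
  obtain ⟨P, δ, K, hδ, hP, hanti⟩ := exists_antitone_solutions H hc
  have hIcc : ∀ s₀ s₁ : ℝ, 0 < s₀ →
      ∀ᶠ T : ℝ in atTop, 1 ≤ T ∧ Set.Icc s₀ s₁ ⊆ Set.Icc (1 / T) T :=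
    fun s₀ s₁ h0 => (eventually_ge_atTop 1).and (eventually_Icc_subset_Icc_one_div h0 s₁)
  have hmem : ∀ s, 0 < s → ∀ᶠ T : ℝ in atTop, 1 ≤ T ∧ s ∈ Set.Icc (1 / T) T := fun s hs =>
    (hIcc s s hs).mono fun T hT => ⟨hT.1, hT.2 ⟨le_rfl, le_rfl⟩⟩
  have hconv : ∀ s, 0 < s → ∃ L, Tendsto (fun T => P T s) atTop (𝓝 L) := fun s hs => by
    obtain ⟨T₀, hT₀⟩ := eventually_atTop.1 (hmem s hs)
    exact exists_tendsto_of_antitoneOn_Ici (T₀ := T₀)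
      (fun T hT T' _ hTT' => hanti T T' s (hT₀ T hT).1 hTT' (hT₀ T hT).2)
      fun T hT => (hP T (hT₀ T hT).1 s (hT₀ T hT).2).2.1
  choose! Q hQ using hconv
  have hlow : ∀ s, 0 < s → δ * s ^ (m + p - 1) ≤ Q s := fun s hs =>
    ge_of_tendsto (hQ s hs) ((hmem s hs).mono fun T hT => (hP T hT.1 s hT.2).2.1)
  refine ⟨Q, ⟨fun s hs => lt_of_lt_of_le (by positivity) (hlow s hs), fun s hs => ?_⟩, ?_,
    δ, hδ, hlow⟩
  · exact hasDerivAt_of_tendsto_orbits (P := P) (d := fun s => δ * s ^ (m + p - 1))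
      tendsto_const_nhds
      (continuousOn_const.mul (continuousOn_id.rpow_const fun s hs => .inl (ne_of_gt hs)))
      (fun s hs => by positivity) (fun s₀ s₁ h0 => (hIcc s₀ s₁ h0).mono fun T hT s hs =>
        ⟨(hP T hT.1 s (hT.2 hs)).1, (hP T hT.1 s (hT.2 hs)).2.1⟩) hQ hs
  · exact (isGoodAtInfinity_barrier m k _ _).of_le_of_le (isGoodAtInfinity_barrier m k _ _)
      ((eventually_gt_atTop 0).mono fun s hs => ge_of_tendsto (hQ s hs)
        ((hmem s hs).mono fun T hT => (hP T hT.1 s hT.2).2.2.1))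
      ((eventually_gt_atTop 0).mono fun s hs => le_of_tendsto (hQ s hs)
        ((hmem s hs).mono fun T hT => (hP T hT.1 s hT.2).2.2.2))

end existence

/-! ### Orbits near the origin -/

theorem tendsto_rpow_nhdsGT_zero {q : ℝ} (hq : 0 < q) :
    Tendsto (fun s : ℝ => s ^ q) (𝓝[>] 0) (𝓝 0) := by
  have h := (Real.continuousAt_rpow_const 0 q (.inr hq.le)).tendsto
  rw [Real.zero_rpow hq.ne'] at h
  exact h.mono_left nhdsWithin_le_nhds

theorem eventually_nhdsGT_zero_iff {r : ℝ → Prop} :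
    (∀ᶠ s in 𝓝[>] (0 : ℝ), r s) ↔ ∃ s₀, 0 < s₀ ∧ ∀ s, 0 < s → s ≤ s₀ → r s := by
  refine mem_nhdsGT_iff_exists_Ioc_subset.trans (exists_congr fun s₀ => and_congr_right fun _ => ?_)
  exact ⟨fun h s h0 h1 => h ⟨h0, h1⟩, fun h s hs => h s hs.1 hs.2⟩

theorem mul_le_of_le_hasDerivAt {u u' : ℝ → ℝ} {q s₀ : ℝ}
    (hd : ∀ s, 0 < s → HasDerivAt u (u' s) s) (h : ∀ s, 0 < s → s ≤ s₀ → q ≤ u' s)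
    (hu : Tendsto u (𝓝[>] 0) (𝓝 0)) {s : ℝ} (hs : 0 < s) (hs₀ : s ≤ s₀) : q * s ≤ u s := by
  have hlim : Tendsto (fun t => u t + q * (s - t)) (𝓝[>] 0) (𝓝 (0 + q * (s - 0))) :=
    hu.add (((tendsto_id'.2 nhdsWithin_le_nhds).const_sub s).const_mul q)
  rw [zero_add, sub_zero] at hlim
  refine le_of_tendsto hlim (eventually_nhdsGT_zero_iff.2 ⟨s, hs, fun t ht hts => ?_⟩)
  have hd' : ∀ x, 0 < x → HasDerivAt (fun x => u x - q * x) (u' x - q) x := fun x hx => 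
    (hd x hx).sub (((hasDerivAt_id' x).const_mul q).congr_deriv (mul_one q))
  have := le_of_hasDerivAt_nonneg hts
    (fun x hx => (hd' x (ht.trans_le hx.1)).continuousAt.continuousWithinAt)
    (fun x hx => hd' x (ht.trans hx.1))
    (fun x hx => sub_nonneg.2 (h x (ht.trans hx.1) (hx.2.le.trans hs₀)))
  linarith

section nearZero

variable {m p k l c : ℝ}

theorem slopeField_eq_add (c s P : ℝ) :
    slopeField m p k l c s P = c + slopeField m p k l 0 s P := by
  unfold slopeField
  ring

theorem tendsto_slopeField_mul (hm : 1 < m) (hmp : 2 < m + p) {η : ℝ} (hη : 0 < η) :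
    Tendsto (fun s => slopeField m p k l 0 s (η * s)) (𝓝[>] 0) (𝓝 0) := by
  have hlim := ((tendsto_rpow_nhdsGT_zero (show 0 < m - 1 by linarith)).const_mul
    ((k + l) * m)).sub ((((tendsto_rpow_nhdsGT_zero (show 0 < 2 * m - 2 by linarith)).const_mul
      (k * l)).add (tendsto_rpow_nhdsGT_zero (show 0 < m + p - 2 by linarith))).const_mul (m / η))
  simp only [mul_zero, add_zero, sub_zero] at hlim
  refine hlim.congr' (eventually_nhdsGT_zero_iff.2 ⟨1, one_pos, fun s hs _ => ?_⟩)
  have hpow : s ^ (2 * m - 2) * s = s ^ (m - 1) * s ^ m := by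
    rw [← Real.rpow_add_one hs.ne', ← Real.rpow_add hs]
    ring_nf
  have hpow' : s ^ (m + p - 2) * s = s ^ (m - 1) * s ^ p := by
    rw [← Real.rpow_add_one hs.ne', ← Real.rpow_add hs]
    ring_nf
  simp only [slopeField]
  rw [zero_add, mul_assoc m, mul_add (s ^ (m - 1)), mul_left_comm (s ^ (m - 1)), ← hpow, ← hpow']
  field_simp

theorem tendsto_slopeField_mul_rpow (hm : 1 < m) (hp : p < 1) {z : ℝ} (hz : z ≠ 0) :
    Tendsto (fun s => slopeField m p k l c s (z * s ^ (m + p - 1))) (𝓝[>] 0)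
      (𝓝 (c - m / z)) := by
  have hlim := (((tendsto_rpow_nhdsGT_zero (show 0 < m - 1 by linarith)).const_mul
    ((k + l) * m)).const_add c).sub ((((tendsto_rpow_nhdsGT_zero
      (show 0 < m - p by linarith)).const_mul (k * l)).add_const 1).const_mul (m / z))
  simp only [mul_zero, add_zero, zero_add, mul_one] at hlim
  exact hlim.congr' (eventually_nhdsGT_zero_iff.2
    ⟨1, one_pos, fun s hs _ => (slopeField_mul_rpow hz hs).symm⟩)

theorem tendsto_zero_of_le_rpow_add {P : ℝ → ℝ} {C D : ℝ} (hm : 0 < m)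
    (hpos : ∀ s, 0 < s → 0 < P s) (hle : ∀ᶠ s in 𝓝[>] 0, P s ≤ C * s ^ m + D * s) :
    Tendsto P (𝓝[>] 0) (𝓝 0) := by
  have hlim : Tendsto (fun s : ℝ => C * s ^ m + D * s) (𝓝[>] 0) (𝓝 (C * 0 + D * 0)) :=
    ((tendsto_rpow_nhdsGT_zero hm).const_mul _).add
      ((tendsto_id'.2 nhdsWithin_le_nhds).const_mul D)
  simp only [mul_zero, add_zero] at hlim
  exact squeeze_zero' (eventually_mem_nhdsWithin.mono fun s hs => (hpos s hs).le) hle hlim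

theorem eventually_div_lt_of_le_rpow_add {P : ℝ → ℝ} {C D q : ℝ} (hm : 1 < m)
    (hle : ∀ s, 0 < s → P s ≤ C * s ^ m + D * s) (hq : D < q) :
    ∀ᶠ s in 𝓝[>] 0, P s / s < q := by
  have hlim := ((tendsto_rpow_nhdsGT_zero (sub_pos.2 hm)).const_mul C).add_const D
  rw [mul_zero, zero_add] at hlim
  filter_upwards [hlim.eventually_lt_const hq, self_mem_nhdsWithin] with s hsq (hs : 0 < s)
  refine lt_of_le_of_lt ((div_le_iff₀ hs).2 ?_) hsq
  rw [add_mul, mul_assoc, rpow_sub_one_mul hs]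
  exact hle s hs

namespace IsOrbit

variable {P Q Q' : ℝ → ℝ}

theorem hasDerivAt_flux (h : IsOrbit m p k l c P) {s : ℝ} (hs : 0 < s) :
    HasDerivAt (fun s => (k + l) * s ^ m + c * s - P s)
      (m * s ^ (m - 1) * (k * l * s ^ m + s ^ p) / P s) s := by
  refine ((((Real.hasDerivAt_rpow_const (.inl hs.ne')).const_mul (k + l)).add
    ((hasDerivAt_id s).const_mul c)).sub (h.hasDerivAt s hs)).congr_deriv ?_
  unfold slopeField
  ring

theorem tendsto_flux (hm : 0 < m) (h0 : Tendsto P (𝓝[>] 0) (𝓝 0)) :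
    Tendsto (fun s => (k + l) * s ^ m + c * s - P s) (𝓝[>] 0) (𝓝 0) := by
  simpa only [id, mul_zero, add_zero, sub_zero] using
    (((tendsto_rpow_nhdsGT_zero hm).const_mul (k + l)).add
      ((tendsto_nhdsWithin_of_tendsto_nhds tendsto_id).const_mul c)).sub h0

theorem tendsto_zero_iff (H : Admissible m p k l) (h : IsOrbit m p k l c P) :
    Tendsto P (𝓝[>] 0) (𝓝 0) ↔ ∀ s, 0 < s → P s ≤ (k + l) * s ^ m + c * s := by
  obtain ⟨hm, -, -, hk, hl, -⟩ := H
  refine ⟨fun h0 s hs => ?_, fun hle => tendsto_zero_of_le_rpow_add (by linarith) h.pos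
    (eventually_mem_nhdsWithin.mono hle)⟩
  have := mul_le_of_le_hasDerivAt (q := 0) (fun s hs => h.hasDerivAt_flux hs)
    (fun t ht _ => by have := h.pos t ht; positivity) (tendsto_flux (by linarith) h0) hs le_rfl
  linarith

theorem le_of_le_right (H : Admissible m p k l) (h : IsOrbit m p k l c P) {s s₁ : ℝ}
    (hQ : ∀ s, 0 < s → 0 < Q s) (dQ : ∀ s, 0 < s → HasDerivAt Q (Q' s) s)
    (hQ' : ∀ s, 0 < s → s ≤ s₁ → Q' s ≤ slopeField m p k l c s (Q s)) (hle : P s₁ ≤ Q s₁)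
    (hs : 0 < s) (hs₁ : s ≤ s₁) : P s ≤ Q s :=
  le_of_le_slopeField H hs hs₁ (fun t ht => h.hasDerivAt t (hs.trans_le ht.1))
    (fun t ht => hQ t (hs.trans_le ht.1)) (fun t ht => dQ t (hs.trans_le ht.1))
    (fun t ht => hQ' t (hs.trans_le ht.1) ht.2) hle

theorem le_of_right_le (H : Admissible m p k l) (h : IsOrbit m p k l c P) {s s₁ : ℝ}
    (dQ : ∀ s, 0 < s → HasDerivAt Q (Q' s) s)
    (hQ' : ∀ s, 0 < s → s ≤ s₁ → slopeField m p k l c s (Q s) ≤ Q' s) (hle : Q s₁ ≤ P s₁)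
    (hs : 0 < s) (hs₁ : s ≤ s₁) : Q s ≤ P s :=
  le_of_slopeField_le H hs hs₁ (fun t ht => h.hasDerivAt t (hs.trans_le ht.1))
    (fun t ht => h.pos t (hs.trans_le ht.1)) (fun t ht => dQ t (hs.trans_le ht.1))
    (fun t ht _ => hQ' t (hs.trans_le ht.1) ht.2) hle

theorem tendsto_div_of_linear_le (H : Admissible m p k l) (hmp : 2 < m + p)
    (h : IsOrbit m p k l c P) (h0 : Tendsto P (𝓝[>] 0) (𝓝 0)) {η : ℝ} (hη : 0 < η)
    (hle : ∀ᶠ s in 𝓝[>] 0, η * s ≤ P s) :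
    Tendsto (fun s => P s / s) (𝓝[>] 0) (𝓝 c) := by
  refine tendsto_order.2 ⟨fun q hq => ?_, fun q hq =>
    eventually_div_lt_of_le_rpow_add H.one_lt ((h.tendsto_zero_iff H).1 h0) hq⟩
  obtain ⟨s₀, hs₀, hs⟩ := eventually_nhdsGT_zero_iff.1 (hle.and
    ((tendsto_slopeField_mul (k := k) (l := l) H.one_lt hmp hη).eventually_const_lt
      (show (q - c) / 2 < 0 by linarith)))
  refine eventually_nhdsGT_zero_iff.2 ⟨s₀, hs₀, fun s hs0 hss₀ => (lt_div_iff₀ hs0).2 ?_⟩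
  have hlow : (q + c) / 2 * s ≤ P s := by
    refine mul_le_of_le_hasDerivAt h.hasDerivAt (fun t ht hts => ?_) h0 hs0 hss₀
    have := slopeField_mono (c := c) H ht (mul_pos hη ht) (hs t ht hts).1
    rw [slopeField_eq_add] at this
    linarith [(hs t ht hts).2]
  have : q * s < (q + c) / 2 * s := mul_lt_mul_of_pos_right (by linarith) hs0
  linarith

theorem eventually_le_mul_rpow (H : Admissible m p k l) (hmp : 2 < m + p)
    (h : IsOrbit m p k l c P) (h0 : Tendsto P (𝓝[>] 0) (𝓝 0))
    (hlt : ∀ η, 0 < η → ∃ᶠ s in 𝓝[>] 0, P s < η * s) {z : ℝ} (hz : 0 < z) (hcz : m / z < c) :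
    ∀ᶠ s in 𝓝[>] 0, P s ≤ z * s ^ (m + p - 1) := by
  obtain ⟨ε, hε, hεc⟩ : ∃ ε, 0 < ε ∧ ε < c - m / z := exists_between (sub_pos.2 hcz)
  have hsmall := ((tendsto_rpow_nhdsGT_zero (show 0 < m + p - 1 - 1 by linarith)).const_mul
    (m + p - 1)).const_mul z
  rw [mul_zero, mul_zero] at hsmall
  obtain ⟨s₀, hs₀, hs⟩ := eventually_nhdsGT_zero_iff.1
    (((tendsto_slopeField_mul_rpow (k := k) (l := l) H.one_lt H.p_lt hz.ne').eventually_const_lt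
      hεc).and (hsmall.eventually_lt_const hε))
  obtain ⟨s₁, hs₁, hs₁₀, hP⟩ : ∃ s, 0 < s ∧ s ≤ s₀ ∧ P s ≤ z * s ^ (m + p - 1) := by
    by_contra! hcon
    refine hlt ε hε (eventually_nhdsGT_zero_iff.2 ⟨s₀, hs₀, fun t ht hts => not_lt.2 ?_⟩)
    exact mul_le_of_le_hasDerivAt h.hasDerivAt (fun x hx hxs => (hs x hx hxs).1.le.trans
      (slopeField_mono H hx (by positivity) (hcon x hx hxs).le)) h0 ht hts
  refine eventually_nhdsGT_zero_iff.2 ⟨s₁, hs₁, fun s hs0 hss₁ =>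
    h.le_of_le_right H (fun s hs => by positivity)
      (fun t ht => (Real.hasDerivAt_rpow_const (.inl ht.ne')).const_mul z)
      (fun t ht hts => ?_) hP hs0 hss₁⟩
  have := hs t ht (hts.trans hs₁₀)
  exact (this.2.trans this.1).le

theorem eventually_mul_rpow_le (H : Admissible m p k l) (h : IsOrbit m p k l c P)
    (h0 : Tendsto P (𝓝[>] 0) (𝓝 0)) {z : ℝ} (hz : 0 < z) (hcz : c < m / z) :
    ∀ᶠ s in 𝓝[>] 0, z * s ^ (m + p - 1) ≤ P s := by
  have hm := H.one_lt
  have hp := H.p_pos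
  obtain ⟨s₀, hs₀, hs⟩ := eventually_nhdsGT_zero_iff.1
    ((tendsto_slopeField_mul_rpow (k := k) (l := l) hm H.p_lt hz.ne').eventually_lt_const
      (sub_neg.2 hcz))
  obtain ⟨s₁, hs₁, hs₁₀, hP⟩ : ∃ s, 0 < s ∧ s ≤ s₀ ∧ z * s ^ (m + p - 1) ≤ P s := by
    by_contra! hcon
    have hnonpos := mul_le_of_le_hasDerivAt (u := fun s => -P s) (q := 0)
      (fun s hs => (h.hasDerivAt s hs).neg)
      (fun x hx hxs => neg_nonneg.2 ((slopeField_mono H hx (h.pos x hx) (hcon x hx hxs).le).trans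
        (hs x hx hxs).le)) (by simpa only [neg_zero] using h0.neg) hs₀ le_rfl
    linarith [h.pos s₀ hs₀]
  refine eventually_nhdsGT_zero_iff.2 ⟨s₁, hs₁, fun s hs0 hss₁ =>
    h.le_of_right_le H (fun t ht => (Real.hasDerivAt_rpow_const (.inl ht.ne')).const_mul z)
      (fun t ht hts => ?_) hP hs0 hss₁⟩
  have : 0 ≤ m + p - 1 := by linarith
  exact (hs t ht (hts.trans hs₁₀)).le.trans (by positivity)

theorem tendsto_div_rpow_of_frequently_lt (H : Admissible m p k l) (hmp : 2 < m + p) (hc : 0 < c)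
    (h : IsOrbit m p k l c P) (h0 : Tendsto P (𝓝[>] 0) (𝓝 0))
    (hlt : ∀ η, 0 < η → ∃ᶠ s in 𝓝[>] 0, P s < η * s) :
    Tendsto (fun s => P s / s ^ (m + p - 1)) (𝓝[>] 0) (𝓝 (m / c)) := by
  have hm : 0 < m := by linarith [H.one_lt]
  have hmc : 0 < m / c := by positivity
  refine tendsto_order.2 ⟨fun q hq => ?_, fun q hq => ?_⟩
  · obtain ⟨z, hqz, hzc⟩ := exists_between (max_lt hq hmc)
    have hz : 0 < z := (le_max_right q 0).trans_lt hqz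
    filter_upwards [h.eventually_mul_rpow_le H h0 hz (by rwa [lt_div_comm₀ hc hz]),
      self_mem_nhdsWithin] with s hs (hs0 : 0 < s)
    exact ((le_max_left q 0).trans_lt hqz).trans_le ((le_div_iff₀ (by positivity)).2 hs)
  · obtain ⟨z, hcz, hzq⟩ := exists_between hq
    have hz : 0 < z := hmc.trans hcz
    filter_upwards [h.eventually_le_mul_rpow H hmp h0 hlt hz (by rwa [div_lt_comm₀ hz hc]),
      self_mem_nhdsWithin] with s hs (hs0 : 0 < s)
    exact ((div_le_iff₀ (by positivity)).2 hs).trans_lt hzq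

end IsOrbit

end nearZero

/-! ### The critical speed -/

theorem rpow_le_add_rpow {m q s : ℝ} (hs : 0 < s) (h1 : 1 ≤ q) (hqm : q ≤ m) :
    s ^ q ≤ s + s ^ m := by
  rcases le_total s 1 with hs1 | hs1
  · have := Real.rpow_le_rpow_of_exponent_ge hs hs1 h1
    rw [Real.rpow_one] at this
    linarith [Real.rpow_nonneg hs.le m]
  · linarith [Real.rpow_le_rpow_of_exponent_le hs1 hqm]

section criticalSpeed

variable {m p k l c : ℝ}

theorem IsOrbit.mul_rpow_add_le_flux (H : Admissible m p k l) {P : ℝ → ℝ} (h : IsOrbit m p k l c P)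
    (h0 : Tendsto P (𝓝[>] 0) (𝓝 0)) {s M : ℝ} (hs : 0 < s)
    (hPM : ∀ t, 0 < t → t ≤ s → P t ≤ M) :
    m / (m + p) / M * s ^ (m + p) ≤ (k + l) * s ^ m + c * s - P s := by
  obtain ⟨hm1, hp0, -, hk, hl, -⟩ := H
  have hm : 0 < m := by linarith
  have hpow : ∀ t, 0 < t → HasDerivAt (fun t => m / (m + p) / M * t ^ (m + p))
      (m / M * (t ^ (m - 1) * t ^ p)) t := fun t ht => by
    refine ((Real.hasDerivAt_rpow_const (.inl ht.ne')).const_mul _).congr_deriv ?_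
    rw [rpow_add_sub_one ht]
    field_simp
  have hlim : Tendsto (fun t => (k + l) * t ^ m + c * t - P t - m / (m + p) / M * t ^ (m + p))
      (𝓝[>] 0) (𝓝 0) := by
    simpa only [mul_zero, sub_zero] using (IsOrbit.tendsto_flux hm h0).sub
      ((tendsto_rpow_nhdsGT_zero (show 0 < m + p by linarith)).const_mul (m / (m + p) / M))
  have hflux := mul_le_of_le_hasDerivAt (q := 0) (s₀ := s)
    (fun t ht => (h.hasDerivAt_flux ht).sub (hpow t ht))
    (fun t ht hts => sub_nonneg.2 <| calc
      m / M * (t ^ (m - 1) * t ^ p) ≤ m / P t * (t ^ (m - 1) * (k * l * t ^ m + t ^ p)) := by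
          have := h.pos t ht
          gcongr
          · exact hPM t ht hts
          · exact le_add_of_nonneg_left (by positivity)
      _ = m * t ^ (m - 1) * (k * l * t ^ m + t ^ p) / P t := by ring)
    hlim hs le_rfl
  simpa only [zero_mul, Pi.sub_apply, sub_nonneg] using hflux

-- The point `s` is the one where `c * s = s ^ m`.
theorem IsOrbit.one_le_mul_rpow (H : Admissible m p k l) {P : ℝ → ℝ} {s : ℝ} (hs : 0 < s)
    (h : IsOrbit m p k l (s ^ (m - 1)) P) (h0 : Tendsto P (𝓝[>] 0) (𝓝 0)) :
    1 ≤ (k + l + 1) ^ 2 * (m + p) / m * s ^ (m - p) := by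
  have hle := (h.tendsto_zero_iff H).1 h0
  obtain ⟨hm1, hp0, -, hk, hl, -⟩ := id H
  have hm : 0 < m := by linarith
  have hcs : s ^ (m - 1) * s = s ^ m := rpow_sub_one_mul hs m
  set M := (k + l + 1) * s ^ m
  have hPM : ∀ t, 0 < t → t ≤ s → P t ≤ M := fun t ht hts => by
    calc P t ≤ (k + l) * t ^ m + s ^ (m - 1) * t := hle t ht
      _ ≤ (k + l) * s ^ m + s ^ (m - 1) * s := by gcongr
      _ = M := by rw [hcs]; ring
  have hB : m / (m + p) / M * s ^ (m + p) ≤ M := by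
    have := h.mul_rpow_add_le_flux H h0 hs hPM
    rw [hcs] at this
    linarith [h.pos s hs]
  have hsplit : s ^ (m + p) * s ^ (m - p) = s ^ m * s ^ m := by
    rw [← Real.rpow_add hs, ← Real.rpow_add hs]
    ring_nf
  rw [div_mul_eq_mul_div, div_le_iff₀ (by positivity), div_mul_eq_mul_div,
    div_le_iff₀ (by positivity)] at hB
  rw [div_mul_eq_mul_div, le_div_iff₀ hm, one_mul]
  refine le_of_mul_le_mul_right ?_ (show 0 < s ^ (m + p) by positivity)
  linear_combination hB - (k + l + 1) ^ 2 * (m + p) * hsplit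

theorem exists_speed_lower_bound (H : Admissible m p k l) :
    ∃ c₀, 0 < c₀ ∧ ∀ (c : ℝ) (P : ℝ → ℝ), 0 < c → IsOrbit m p k l c P →
      Tendsto P (𝓝[>] 0) (𝓝 0) → c₀ ≤ c := by
  have hm : 0 < m - 1 := sub_pos.2 H.one_lt
  have hlim := (tendsto_rpow_nhdsGT_zero (show 0 < m - p by linarith [H.p_lt])).const_mul
    ((k + l + 1) ^ 2 * (m + p) / m)
  rw [mul_zero] at hlim
  obtain ⟨s₀, hs₀, hsmall⟩ := eventually_nhdsGT_zero_iff.1 (hlim.eventually_lt_const one_pos)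
  refine ⟨s₀ ^ (m - 1), by positivity, fun c P hc h h0 => not_lt.1 fun hlt => ?_⟩
  have hs : 0 < c ^ (m - 1)⁻¹ := by positivity
  have hcs : (c ^ (m - 1)⁻¹) ^ (m - 1) = c := Real.rpow_inv_rpow hc.le hm.ne'
  refine (hsmall _ hs ?_).not_ge (IsOrbit.one_le_mul_rpow H hs (by rwa [hcs]) h0)
  rw [← Real.rpow_le_rpow_iff hs.le hs₀.le hm, hcs]
  exact hlt.le

theorem IsOrbit.tendsto_zero_of_le_speed (H : Admissible m p k l) (hmp : 2 ≤ m + p)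
    (hc : 1 + m + m / k ≤ c) {P : ℝ → ℝ} (h : IsOrbit m p k l c P)
    (hg : IsGoodAtInfinity m k P) : Tendsto P (𝓝[>] 0) (𝓝 0) := by
  obtain ⟨hm, -, hp, hk, hl, -⟩ := id H
  have hbar : ∀ s, 0 < s → 0 < barrier m k 1 0 s := fun s hs => by
    unfold barrier
    positivity
  have hsub : ∀ s, 0 < s → k * (m * s ^ (m - 1)) + 1
      ≤ slopeField m p k l c s (barrier m k 1 0 s) := fun s hs => by
    rw [slopeField_barrier (hbar s hs).ne', le_add_iff_nonneg_right, ← sub_le_iff_le_add',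
      le_div_iff₀ (hbar s hs)]
    have hpow : s ^ (m - 1) * s ^ p ≤ s + s ^ m := by
      rw [← rpow_add_sub_one hs]
      exact rpow_le_add_rpow hs (by linarith) (by linarith)
    calc (0 - (c - 1)) * barrier m k 1 0 s ≤ -(m + m / k) * barrier m k 1 0 s :=
          mul_le_mul_of_nonneg_right (by linarith) (hbar s hs).le
      _ = -(m * (s + s ^ m)) - (m * k * s ^ m + m / k * s) := by
          unfold barrier
          field_simp
          ring
      _ ≤ -(m * (s ^ (m - 1) * s ^ p)) + m * s ^ (m - 1) * (l * s) := by
          have : 0 ≤ m * k * s ^ m + m / k * s := by positivity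
          have : 0 ≤ m * s ^ (m - 1) * (l * s) := by positivity
          have := mul_le_mul_of_nonneg_left hpow (show 0 ≤ m by linarith)
          linarith
      _ = m * s ^ (m - 1) * (l * (1 * s + 0) - s ^ p) := by ring
  refine tendsto_zero_of_le_rpow_add (m := m) (C := k) (D := 1) (by linarith) h.pos
    (eventually_mem_nhdsWithin.mono fun s hs => ?_)
  simpa only [barrier, add_zero] using le_of_isGoodAtInfinity H hbar h.hasDerivAt
    (fun s _ => hasDerivAt_barrier hm.le k 1 0 s) (fun _ _ => le_rfl) hsub hg
    (isGoodAtInfinity_barrier m k 1 0) hs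

/-- The good orbit of speed `c`, which is unique on `(0, ∞)` and exists for `0 < c`. -/
def goodOrbit (m p k l c : ℝ) : ℝ → ℝ :=
  Classical.epsilon fun P => IsOrbit m p k l c P ∧ IsGoodAtInfinity m k P

theorem isOrbit_goodOrbit (H : Admissible m p k l) (hc : 0 < c) :
    IsOrbit m p k l c (goodOrbit m p k l c) :=
  have ⟨P, hP, gP, _⟩ := exists_isOrbit_isGoodAtInfinity H hc
  (Classical.epsilon_spec (p := fun P => IsOrbit m p k l c P ∧ IsGoodAtInfinity m k P)
    ⟨P, hP, gP⟩).1

theorem isGoodAtInfinity_goodOrbit (H : Admissible m p k l) (hc : 0 < c) :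
    IsGoodAtInfinity m k (goodOrbit m p k l c) :=
  have ⟨P, hP, gP, _⟩ := exists_isOrbit_isGoodAtInfinity H hc
  (Classical.epsilon_spec (p := fun P => IsOrbit m p k l c P ∧ IsGoodAtInfinity m k P)
    ⟨P, hP, gP⟩).2

theorem IsOrbit.eq_goodOrbit (H : Admissible m p k l) (hc : 0 < c) {P : ℝ → ℝ}
    (h : IsOrbit m p k l c P) (hg : IsGoodAtInfinity m k P) {s : ℝ} (hs : 0 < s) :
    P s = goodOrbit m p k l c s :=
  h.unique H (isOrbit_goodOrbit H hc) hg (isGoodAtInfinity_goodOrbit H hc) hs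

theorem exists_forall_mul_rpow_le_goodOrbit (H : Admissible m p k l) (hc : 0 < c) :
    ∃ δ, 0 < δ ∧ ∀ s, 0 < s → δ * s ^ (m + p - 1) ≤ goodOrbit m p k l c s := by
  obtain ⟨P, hP, gP, δ, hδ, hle⟩ := exists_isOrbit_isGoodAtInfinity H hc
  exact ⟨δ, hδ, fun s hs => hP.eq_goodOrbit H hc gP hs ▸ hle s hs⟩

theorem antitoneOn_goodOrbit (H : Admissible m p k l) {s : ℝ} (hs : 0 < s) :
    AntitoneOn (fun c => goodOrbit m p k l c s) (Set.Ioi 0) := fun _ h₁ _ h₂ hle =>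
  IsOrbit.antitone_speed H hle (isOrbit_goodOrbit H h₁) (isOrbit_goodOrbit H h₂)
    (isGoodAtInfinity_goodOrbit H h₁) (isGoodAtInfinity_goodOrbit H h₂) hs

theorem tendsto_goodOrbit_of_tendsto (H : Admissible m p k l) (hc : 0 < c) {L : Filter ℝ}
    [L.NeBot] [L.IsCountablyGenerated] (hL : L ≤ 𝓝 c)
    (hconv : ∀ s, 0 < s → ∃ R, Tendsto (fun c => goodOrbit m p k l c s) L (𝓝 R)) {s : ℝ}
    (hs : 0 < s) :
    Tendsto (fun c => goodOrbit m p k l c s) L (𝓝 (goodOrbit m p k l c s)) := by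
  choose! R hR using hconv
  have hlo : 0 < c / 2 := half_pos hc
  have hhi : 0 < c + 1 := by linarith
  have hc' : ∀ᶠ c' in L, c / 2 < c' ∧ c' < c + 1 :=
    hL (Ioo_mem_nhds (half_lt_self hc) (lt_add_one c))
  have hge : ∀ᶠ c' in L, ∀ s, 0 < s → goodOrbit m p k l (c + 1) s ≤ goodOrbit m p k l c' s :=
    hc'.mono fun c' hc' s hs =>
      antitoneOn_goodOrbit H hs (hlo.trans hc'.1) hhi hc'.2.le
  have hle : ∀ᶠ c' in L, ∀ s, 0 < s → goodOrbit m p k l c' s ≤ goodOrbit m p k l (c / 2) s :=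
    hc'.mono fun c' hc' s hs => antitoneOn_goodOrbit H hs hlo (hlo.trans hc'.1) hc'.1.le
  have hRge : ∀ s, 0 < s → goodOrbit m p k l (c + 1) s ≤ R s := fun s hs =>
    ge_of_tendsto (hR s hs) (hge.mono fun _ h => h s hs)
  have hRle : ∀ s, 0 < s → R s ≤ goodOrbit m p k l (c / 2) s := fun s hs =>
    le_of_tendsto (hR s hs) (hle.mono fun _ h => h s hs)
  have ohi := isOrbit_goodOrbit H hhi
  have oR : IsOrbit m p k l c R :=
    ⟨fun s hs => (ohi.pos s hs).trans_le (hRge s hs), fun s hs =>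
      hasDerivAt_of_tendsto_orbits (tendsto_id'.2 hL)
        ohi.continuousOn ohi.pos
        (fun s₀ s₁ h0 => by
          filter_upwards [hc', hge] with c' hc' hge s hs
          have hs0 := h0.trans_le hs.1
          exact ⟨(isOrbit_goodOrbit H (hlo.trans hc'.1)).hasDerivAt s hs0, hge s hs0⟩) hR hs⟩
  have gR : IsGoodAtInfinity m k R := (isGoodAtInfinity_goodOrbit H hhi).of_le_of_le
    (isGoodAtInfinity_goodOrbit H hlo) ((eventually_gt_atTop 0).mono hRge)
    ((eventually_gt_atTop 0).mono hRle)
  exact oR.eq_goodOrbit H hc gR hs ▸ hR s hs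

theorem continuousAt_goodOrbit (H : Admissible m p k l) (hc : 0 < c) {s : ℝ} (hs : 0 < s) :
    ContinuousAt (fun c => goodOrbit m p k l c s) c := by
  have hle : c / 2 < c := half_lt_self hc
  have hlo : 0 < c / 2 := half_pos hc
  refine continuousAt_iff_continuous_left'_right'.2
    ⟨tendsto_goodOrbit_of_tendsto H hc nhdsWithin_le_nhds (fun t ht => ?left) hs,
      tendsto_goodOrbit_of_tendsto H hc nhdsWithin_le_nhds (fun t ht => ?right) hs⟩
  case left =>
    refine ⟨_, AntitoneOn.tendsto_nhdsWithin_Ioo_left (Set.nonempty_Ioo.2 hle)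
      ((antitoneOn_goodOrbit H ht).mono fun x hx => hlo.trans hx.1)
      ⟨goodOrbit m p k l c t, ?_⟩⟩
    rintro _ ⟨x, hx, rfl⟩
    exact antitoneOn_goodOrbit H ht (hlo.trans hx.1) hc hx.2.le
  case right =>
    refine ⟨_, AntitoneOn.tendsto_nhdsWithin_Ioo_right (Set.nonempty_Ioo.2 (lt_add_one c))
      ((antitoneOn_goodOrbit H ht).mono fun x hx => hc.trans hx.1)
      ⟨goodOrbit m p k l c t, ?_⟩⟩
    rintro _ ⟨x, hx, rfl⟩
    exact antitoneOn_goodOrbit H ht hc (hc.trans hx.1) hx.1.le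

/-- The least speed whose good orbit starts at the origin, the `c^*` of the theorem. -/
def criticalSpeed (m p k l : ℝ) : ℝ :=
  sInf {c | 0 < c ∧ Tendsto (goodOrbit m p k l c) (𝓝[>] 0) (𝓝 0)}

theorem criticalSpeed_le (hc : 0 < c) (h0 : Tendsto (goodOrbit m p k l c) (𝓝[>] 0) (𝓝 0)) :
    criticalSpeed m p k l ≤ c :=
  csInf_le ⟨0, fun _ h => h.1.le⟩ ⟨hc, h0⟩

theorem nonempty_setOf_tendsto_goodOrbit (H : Admissible m p k l) (hmp : 2 ≤ m + p) :
    {c | 0 < c ∧ Tendsto (goodOrbit m p k l c) (𝓝[>] 0) (𝓝 0)}.Nonempty := by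
  have hc : 0 < 1 + m + m / k := by
    have := H.one_lt
    have := H.k_pos
    positivity
  exact ⟨_, hc, (isOrbit_goodOrbit H hc).tendsto_zero_of_le_speed H hmp le_rfl
    (isGoodAtInfinity_goodOrbit H hc)⟩

theorem criticalSpeed_pos (H : Admissible m p k l) (hmp : 2 ≤ m + p) :
    0 < criticalSpeed m p k l := by
  obtain ⟨c₀, hc₀, hle⟩ := exists_speed_lower_bound H
  exact hc₀.trans_le (le_csInf (nonempty_setOf_tendsto_goodOrbit H hmp) fun c h =>
    hle c _ h.1 (isOrbit_goodOrbit H h.1) h.2)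

theorem tendsto_goodOrbit_zero_of_lt (H : Admissible m p k l) (hmp : 2 ≤ m + p)
    (hlt : criticalSpeed m p k l < c) : Tendsto (goodOrbit m p k l c) (𝓝[>] 0) (𝓝 0) := by
  obtain ⟨c', ⟨hc', h0⟩, hcc⟩ := exists_lt_of_csInf_lt (nonempty_setOf_tendsto_goodOrbit H hmp) hlt
  have hc := hc'.trans hcc
  refine ((isOrbit_goodOrbit H hc).tendsto_zero_iff H).2 fun s hs => ?_
  calc goodOrbit m p k l c s ≤ goodOrbit m p k l c' s := antitoneOn_goodOrbit H hs hc' hc hcc.le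
    _ ≤ (k + l) * s ^ m + c' * s := ((isOrbit_goodOrbit H hc').tendsto_zero_iff H).1 h0 s hs
    _ ≤ (k + l) * s ^ m + c * s := by gcongr

theorem tendsto_goodOrbit_zero_iff (H : Admissible m p k l) (hmp : 2 ≤ m + p) (hc : 0 < c) :
    Tendsto (goodOrbit m p k l c) (𝓝[>] 0) (𝓝 0) ↔ criticalSpeed m p k l ≤ c := by
  refine ⟨criticalSpeed_le hc, fun hle => hle.lt_or_eq.elim
    (tendsto_goodOrbit_zero_of_lt H hmp) fun heq => ?_⟩
  refine ((isOrbit_goodOrbit H hc).tendsto_zero_iff H).2 fun s hs => ?_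
  refine le_of_tendsto_of_tendsto (b := 𝓝[>] c)
    ((continuousAt_goodOrbit H hc hs).tendsto.mono_left nhdsWithin_le_nhds)
    (Continuous.tendsto (f := fun c => (k + l) * s ^ m + c * s) (by fun_prop) c |>.mono_left
      nhdsWithin_le_nhds) (eventually_mem_nhdsWithin.mono fun c' hc' => ?_)
  exact ((isOrbit_goodOrbit H (hc.trans hc')).tendsto_zero_iff H).1
    (tendsto_goodOrbit_zero_of_lt H hmp (heq ▸ hc')) s hs

-- If the critical orbit were below every line, then by continuity in the speed a slightly slower
-- good orbit would be trapped below such a line and reach the origin as well.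
theorem exists_eventually_mul_le_goodOrbit_criticalSpeed (H : Admissible m p k l)
    (hmp : 2 < m + p) :
    ∃ η, 0 < η ∧ ∀ᶠ s in 𝓝[>] 0, η * s ≤ goodOrbit m p k l (criticalSpeed m p k l) s := by
  set cs := criticalSpeed m p k l
  have hcs0 : 0 < cs := criticalSpeed_pos H hmp.le
  have hη : 0 < cs / 3 := by positivity
  obtain ⟨s₀, hs₀, hline⟩ := eventually_nhdsGT_zero_iff.1
    ((tendsto_slopeField_mul (k := k) (l := l) H.one_lt hmp hη).eventually_const_lt
      (show cs / 3 - cs / 2 < 0 by linarith))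
  refine ⟨cs / 3, hη, eventually_nhdsGT_zero_iff.2 ⟨s₀, hs₀, fun s hs hss₀ => ?_⟩⟩
  by_contra! hlt
  obtain ⟨c, hbelow, hc, hccs⟩ : ∃ c, goodOrbit m p k l c s < cs / 3 * s ∧ cs / 2 < c ∧ c < cs :=
    ((((continuousAt_goodOrbit H hcs0 hs).tendsto.mono_left
      (nhdsWithin_le_nhds (s := Set.Iio cs))).eventually_lt_const hlt).and
      (Ioo_mem_nhdsLT (half_lt_self hcs0))).exists
  have hc0 : 0 < c := (half_pos hcs0).trans hc
  refine hccs.not_ge (criticalSpeed_le hc0 (tendsto_zero_of_le_rpow_add (m := m) (C := 0)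
    (D := cs / 3) (by linarith [H.one_lt]) (isOrbit_goodOrbit H hc0).pos
    (eventually_nhdsGT_zero_iff.2 ⟨s, hs, fun t ht hts => ?_⟩)))
  rw [zero_mul, zero_add]
  refine (isOrbit_goodOrbit H hc0).le_of_le_right H (fun t ht => mul_pos hη ht)
    (fun t _ => ((hasDerivAt_id' t).const_mul _).congr_deriv (mul_one _)) (fun x hx hxs => ?_)
    hbelow.le ht hts
  rw [slopeField_eq_add]
  linarith [hline x hx (hxs.trans hss₀)]

theorem tendsto_goodOrbit_criticalSpeed_div (H : Admissible m p k l) (hmp : 2 < m + p) :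
    Tendsto (fun s => goodOrbit m p k l (criticalSpeed m p k l) s / s) (𝓝[>] 0)
      (𝓝 (criticalSpeed m p k l)) := by
  have hcs := criticalSpeed_pos H hmp.le
  obtain ⟨η, hη, hle⟩ := exists_eventually_mul_le_goodOrbit_criticalSpeed H hmp
  exact (isOrbit_goodOrbit H hcs).tendsto_div_of_linear_le H hmp
    ((tendsto_goodOrbit_zero_iff H hmp.le hcs).2 le_rfl) hη hle

theorem tendsto_goodOrbit_div_rpow (H : Admissible m p k l) (hmp : 2 < m + p)
    (hc : criticalSpeed m p k l < c) :
    Tendsto (fun s => goodOrbit m p k l c s / s ^ (m + p - 1)) (𝓝[>] 0) (𝓝 (m / c)) := by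
  have hcs := criticalSpeed_pos H hmp.le
  have hc0 := hcs.trans hc
  have h := isOrbit_goodOrbit H hc0
  have h0 := tendsto_goodOrbit_zero_of_lt H hmp.le hc
  refine h.tendsto_div_rpow_of_frequently_lt H hmp hc0 h0 fun η hη => ?_
  by_contra hcon
  have hle : ∀ᶠ s in 𝓝[>] 0, η * s ≤ goodOrbit m p k l c s :=
    (not_frequently.1 hcon).mono fun s => not_lt.1
  -- A linear lower bound would give `P s ~ c * s`, above the critical orbit `~ c^* * s`.
  have hlim := h.tendsto_div_of_linear_le H hmp h0 hη hle
  refine hc.not_ge (le_of_tendsto_of_tendsto hlim (tendsto_goodOrbit_criticalSpeed_div H hmp)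
    (eventually_mem_nhdsWithin.mono fun s hs => ?_))
  exact div_le_div_of_nonneg_right (antitoneOn_goodOrbit H hs hcs hc0 hc.le) (le_of_lt hs)

end criticalSpeed

/-! ### Good profiles run along good orbits -/

/-- The larger decay rate `2m/(m-1)`: `-rootK m` is the characteristic root selected by regularity
at the origin. -/
def rootK (m : ℝ) : ℝ := 2 * m / (m - 1)

/-- The other characteristic root is `-rootL m N`. -/
def rootL (m N : ℝ) : ℝ := N + 2 / (m - 1)

theorem rootK_eq (m : ℝ) : rootK m = m * (2 / (m - 1)) := by
  unfold rootK
  ring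

theorem convCoeff_eq {m : ℝ} (hm : 1 < m) (N : ℝ) : convCoeff m N = rootK m + rootL m N := by
  have : m - 1 ≠ 0 := by linarith
  unfold convCoeff rootK rootL
  field_simp
  ring

theorem reactCoeff_eq {m : ℝ} (hm : 1 < m) (N : ℝ) : reactCoeff m N = rootK m * rootL m N := by
  have : m - 1 ≠ 0 := by linarith
  unfold reactCoeff rootK rootL
  field_simp

theorem admissible_roots {m p N : ℝ} (hm : 1 < m) (hp0 : 0 < p) (hp1 : p < 1) (hN : 0 < N) :
    Admissible m p (rootK m) (rootL m N) := by
  have h1 : 0 < m - 1 := by linarith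
  refine ⟨hm, hp0, hp1, by unfold rootK; positivity, by unfold rootL; positivity, ?_⟩
  have : m * rootL m N - rootK m = m * N := by
    unfold rootK rootL
    field_simp
    ring
  have : 0 < m * N := by positivity
  linarith

theorem radialProfile_exp (m : ℝ) (f : ℝ → ℝ) (y : ℝ) :
    radialProfile m f (Real.exp y) = Real.exp (2 / (m - 1) * y) * f y := by
  rw [radialProfile, Real.log_exp, ← Real.exp_mul, mul_comm y]

theorem hasDerivAt_radialProfile {m f' y : ℝ} {f : ℝ → ℝ} (h : HasDerivAt f f' y) :
    HasDerivAt (radialProfile m f)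
      (Real.exp ((2 / (m - 1) - 1) * y) * (2 / (m - 1) * f y + f')) (Real.exp y) := by
  have h1 : HasDerivAt (fun ξ : ℝ => ξ ^ (2 / (m - 1)))
      (2 / (m - 1) * Real.exp y ^ (2 / (m - 1) - 1)) (Real.exp y) :=
    Real.hasDerivAt_rpow_const (Or.inl (Real.exp_pos y).ne')
  have h2 : HasDerivAt (fun ξ => f (Real.log ξ)) (f' * (Real.exp y)⁻¹) (Real.exp y) :=
    HasDerivAt.comp (Real.exp y) (by rwa [Real.log_exp])
      (Real.hasDerivAt_log (Real.exp_pos y).ne')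
  refine (h1.mul h2).congr_deriv ?_
  rw [Real.log_exp, ← Real.exp_mul, ← Real.exp_mul, mul_comm y, mul_comm y,
    show 2 / (m - 1) * y = (2 / (m - 1) - 1) * y + y by ring, Real.exp_add]
  field_simp

theorem radial_flux_eq {m N y f' : ℝ} (hm : 1 < m) {f : ℝ → ℝ} (hf : 0 < f y)
    (h : HasDerivAt f f' y) :
    m * (Real.exp (2 / (m - 1) * y) * f y) ^ (m - 1) *
      (Real.exp y ^ (N - 1) * deriv (radialProfile m f) (Real.exp y))
      = Real.exp (rootL m N * y) * (rootK m * f y ^ m + m * f y ^ (m - 1) * f') := by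
  have hm1 : m - 1 ≠ 0 := by linarith
  rw [(hasDerivAt_radialProfile h).deriv, Real.mul_rpow (Real.exp_pos _).le hf.le,
    ← Real.exp_mul, ← Real.exp_mul, ← rpow_sub_one_mul hf m]
  have hexp : Real.exp (rootL m N * y) = Real.exp (2 / (m - 1) * y * (m - 1))
      * Real.exp (y * (N - 1)) * Real.exp ((2 / (m - 1) - 1) * y) := by
    rw [← Real.exp_add, ← Real.exp_add]
    congr 1
    unfold rootL
    field_simp
    ring
  rw [hexp, rootK_eq]
  ring

theorem nonneg_of_hasDerivAt_nonneg_of_tendsto_atBot {u u' : ℝ → ℝ} {Y : ℝ}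
    (hd : ∀ y, y ≤ Y → HasDerivAt u (u' y) y) (h : ∀ y, y ≤ Y → 0 ≤ u' y)
    (h0 : Tendsto u atBot (𝓝 0)) {y : ℝ} (hy : y ≤ Y) : 0 ≤ u y := by
  refine le_of_tendsto h0 ?_
  filter_upwards [eventually_le_atBot y] with x hx
  exact le_of_hasDerivAt_nonneg hx
    (fun t ht => (hd t (ht.2.trans hy)).continuousAt.continuousWithinAt)
    (fun t ht => hd t (ht.2.le.trans hy)) (fun t ht => h t (ht.2.le.trans hy))

theorem tendsto_exp_mul_atBot {r : ℝ} (hr : 0 < r) :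
    Tendsto (fun y : ℝ => Real.exp (r * y)) atBot (𝓝 0) :=
  Real.tendsto_exp_atBot.comp ((tendsto_const_mul_atBot_of_pos hr).2 tendsto_id)

theorem isBigO_exp_of_hasDerivAt {u u' : ℝ → ℝ} {N : ℝ} (hN : 0 < N)
    (hd : ∀ y, HasDerivAt u (u' y) y) (h : u' =O[atBot] fun y => Real.exp (N * y))
    (h0 : Tendsto u atBot (𝓝 0)) : u =O[atBot] fun y => Real.exp (N * y) := by
  obtain ⟨C, -, hC⟩ := h.exists_pos
  obtain ⟨Y, hY⟩ := eventually_atBot.1 hC.bound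
  simp only [Real.norm_eq_abs, Real.abs_exp, abs_le] at hY
  have hexp : ∀ y, HasDerivAt (fun y => C / N * Real.exp (N * y)) (C * Real.exp (N * y)) y :=
    fun y => by
      refine (((hasDerivAt_id' y).const_mul N).exp.const_mul (C / N)).congr_deriv ?_
      field_simp
  have hexp0 : Tendsto (fun y : ℝ => C / N * Real.exp (N * y)) atBot (𝓝 0) := by
    simpa only [mul_zero] using (tendsto_exp_mul_atBot hN).const_mul (C / N)
  refine .of_bound (C / N) ((eventually_le_atBot Y).mono fun y hy => ?_)
  have hupper := nonneg_of_hasDerivAt_nonneg_of_tendsto_atBot (Y := Y)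
    (fun y _ => (hexp y).sub (hd y)) (fun y hy => sub_nonneg.2 (hY y hy).2)
    ((sub_zero (0 : ℝ)) ▸ hexp0.sub h0) hy
  have hlower := nonneg_of_hasDerivAt_nonneg_of_tendsto_atBot (Y := Y)
    (fun y _ => (hexp y).add (hd y)) (fun y hy => by linarith [(hY y hy).1])
    ((add_zero (0 : ℝ)) ▸ hexp0.add h0) hy
  rw [Real.norm_eq_abs, Real.norm_eq_abs, Real.abs_exp, abs_le]
  simp only [Pi.sub_apply, Pi.add_apply] at hupper hlower
  exact ⟨by linarith, by linarith⟩

section ExpDecay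

variable {q A : ℝ} {f : ℝ → ℝ}

theorem isTheta_exp_of_tendsto (hA : A ≠ 0)
    (hlim : Tendsto (fun y => Real.exp (q * y) * f y) atBot (𝓝 A)) :
    f =Θ[atBot] fun y => Real.exp (-q * y) := by
  refine (Asymptotics.isTheta_of_div_tendsto_nhds_ne_zero (hlim.congr fun y => ?_) hA).symm
  rw [neg_mul, Real.exp_neg, div_inv_eq_mul, mul_comm]

theorem tendsto_atTop_of_tendsto_exp_mul (hq : 0 < q) (hA : 0 < A)
    (hlim : Tendsto (fun y => Real.exp (q * y) * f y) atBot (𝓝 A)) : Tendsto f atBot atTop := by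
  have hexp : Tendsto (fun y => Real.exp (-q * y)) atBot atTop :=
    Real.tendsto_exp_atTop.comp
      ((tendsto_const_mul_atTop_of_neg (neg_neg_of_pos hq)).2 tendsto_id)
  refine (hlim.pos_mul_atTop hA hexp).congr fun y => ?_
  rw [mul_right_comm, ← Real.exp_add, neg_mul, add_neg_cancel, Real.exp_zero, one_mul]

end ExpDecay

theorem surjOn_of_hasInterfaceAt {f : ℝ → ℝ} {y₀ : ℝ} (hf : Continuous f)
    (hI : HasInterfaceAt f y₀) (htop : Tendsto f atBot atTop) :
    Set.SurjOn f (Set.Iio y₀) (Set.Ioi 0) := fun s hs => by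
  have hf0 : f y₀ = 0 := hI.2 y₀ le_rfl
  obtain ⟨y, hys, hy⟩ := ((htop.eventually_gt_atTop s).and (eventually_lt_atBot y₀)).exists
  obtain ⟨z, hz, hzs⟩ := intermediate_value_Icc' hy.le hf.continuousOn
    (show s ∈ Set.Icc (f y₀) (f y) from ⟨hf0.trans_le (le_of_lt hs), hys.le⟩)
  refine ⟨z, lt_of_le_of_ne hz.2 ?_, hzs⟩
  rintro rfl
  exact (ne_of_gt hs) (hzs.symm.trans hf0)

theorem exists_inverse_of_strictAntiOn {f : ℝ → ℝ} {y₀ : ℝ} (hI : HasInterfaceAt f y₀)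
    (hanti : StrictAntiOn f (Set.Iio y₀)) (hsurj : Set.SurjOn f (Set.Iio y₀) (Set.Ioi 0)) :
    ∃ Z : ℝ → ℝ, (∀ s, 0 < s → Z s < y₀ ∧ f (Z s) = s ∧ ContinuousAt Z s) ∧
      (∀ y, y < y₀ → Z (f y) = y) ∧ Tendsto Z atTop atBot := by
  choose! Z hZ hfZ using show ∀ s, 0 < s → ∃ y, y < y₀ ∧ f y = s from fun _ hs => hsurj hs
  have hZanti : StrictAntiOn Z (Set.Ioi 0) := fun s hs t ht hst =>
    (hanti.lt_iff_gt (hZ s hs) (hZ t ht)).1 (by rwa [hfZ s hs, hfZ t ht])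
  have hZf : ∀ y, y < y₀ → Z (f y) = y := fun y hy =>
    hanti.injOn (hZ _ (hI.1 y hy)) hy (hfZ _ (hI.1 y hy))
  refine ⟨Z, fun s hs => ⟨hZ s hs, hfZ s hs, ?_⟩, hZf, tendsto_atBot.2 fun y => ?_⟩
  · refine StrictMonoOn.continuousAt_of_image_mem_nhds (β := ℝᵒᵈ) hZanti.dual_right
      (Ioi_mem_nhds hs) (mem_of_superset
        (show Set.Iio y₀ ∈ 𝓝 (Z s) from Iio_mem_nhds (hZ s hs)) fun y hy => ?_)
    exact ⟨f y, hI.1 y hy, hZf y hy⟩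
  · have hlt : min y (y₀ - 1) < y₀ := (min_le_right _ _).trans_lt (by linarith)
    filter_upwards [eventually_ge_atTop (f (min y (y₀ - 1)))] with s hs
    have hs0 : 0 < s := (hI.1 _ hlt).trans_le hs
    exact ((hanti.le_iff_ge hlt (hZ s hs0)).1 (by rwa [hfZ s hs0])).trans (min_le_left _ _)

/-- The front `f`, with interface at `y₀`, runs along the phase-plane curve `P`, that is,
`(f ^ m)' = -P f`; this is stated after dividing by `m f ^ (m - 1)`. -/
structure FollowsOrbit (m : ℝ) (P f : ℝ → ℝ) (y₀ : ℝ) : Prop where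
  continuous : Continuous f
  hasInterfaceAt : HasInterfaceAt f y₀
  hasDerivAt : ∀ y, y < y₀ → HasDerivAt f (-P (f y) / (m * f y ^ (m - 1))) y

namespace IsProfile

section PhasePlane

variable {m p k l c y₀ : ℝ} {f Φ : ℝ → ℝ}

theorem slope_neg (h : IsProfile m p (k + l) (k * l) c f Φ) (H : Admissible m p k l)
    (hI : HasInterfaceAt f y₀) (htop : Tendsto f atBot atTop) {y : ℝ} (hy : y < y₀) :
    profileSlope m (k + l) c f Φ y < 0 := by
  have hm : 0 < m := zero_lt_one.trans H.one_lt
  by_contra hcon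
  have hpos : ∀ z, z < y → 0 ≤ profileSlope m (k + l) c f Φ z := fun z hz => by
    by_contra hneg
    exact hcon (h.slope_neg_of_lt hm.ne' (mul_pos H.k_pos H.l_pos) hz
      (fun t ht => hI.1 t (ht.2.trans_lt hy)) (not_le.1 hneg).le)
  obtain ⟨z, hz, hzy⟩ := ((htop.eventually_gt_atTop (f y)).and (eventually_lt_atBot y)).exists
  exact hz.not_ge (h.le_of_slope_nonneg hm hzy.le fun t ht => hpos t ht.2)

theorem strictAntiOn (h : IsProfile m p (k + l) (k * l) c f Φ) (H : Admissible m p k l)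
    (hI : HasInterfaceAt f y₀) (htop : Tendsto f atBot atTop) : StrictAntiOn f (Set.Iio y₀) :=
  fun _ _ _ hz hyz => (Real.rpow_lt_rpow_iff (h.nonneg _) (h.nonneg _)
    (zero_lt_one.trans H.one_lt)).1 (lt_of_hasDerivAt_neg hyz h.continuous_pow.continuousOn
      (fun t _ => h.hasDerivAt_pow t) fun _ ht => h.slope_neg H hI htop (ht.2.trans hz))

theorem isOrbit_neg_slope_comp (h : IsProfile m p (k + l) (k * l) c f Φ) (hm : 0 < m) {Z : ℝ → ℝ}
    (hZ : ∀ s, 0 < s → f (Z s) = s ∧ ContinuousAt Z s)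
    (hS : ∀ s, 0 < s → profileSlope m (k + l) c f Φ (Z s) < 0) :
    IsOrbit m p k l c fun s => -profileSlope m (k + l) c f Φ (Z s) where
  pos s hs := neg_pos.2 (hS s hs)
  hasDerivAt s hs := by
    have hfs : 0 < f (Z s) := (hZ s hs).1.symm ▸ hs
    have hne := (hS s hs).ne
    have : 0 < s ^ (m - 1) := by positivity
    have hinv := HasDerivAt.of_local_left_inverse (hZ s hs).2 (h.hasDerivAt hm.ne' hfs)
      (div_ne_zero hne (by positivity))
      (eventually_of_mem (Ioi_mem_nhds hs) fun t ht => (hZ t ht).1)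
    refine ((h.hasDerivAt_slope hm.ne' hfs).comp s hinv).neg.congr_deriv ?_
    rw [slopeField, (hZ s hs).1]
    field_simp
    ring

theorem hasDerivAt_exp_mul_flux_sub (h : IsProfile m p (k + l) (k * l) c f Φ) (y : ℝ) :
    HasDerivAt (fun y => Real.exp (l * y) * (Φ y - l * f y ^ m))
      (Real.exp (l * y) * (l * c * f y - f y ^ p)) y := by
  refine (((hasDerivAt_id' y).const_mul l).exp.mul
    ((h.hasDerivAt_flux y).sub ((h.hasDerivAt_pow y).const_mul l))).congr_deriv ?_
  simp only [Pi.sub_apply, profileSlope]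
  ring

theorem isBigO_slope_add {N q A : ℝ} (h : IsProfile m p (k + (N + q)) (k * (N + q)) c f Φ)
    (hp : p ≤ 1) (hN : 0 < N) (hq : 0 < q) (hA : 0 < A)
    (hlim : Tendsto (fun y => Real.exp (q * y) * f y) atBot (𝓝 A))
    (hflux : Tendsto (fun y => Real.exp ((N + q) * y) * (Φ y - (N + q) * f y ^ m)) atBot (𝓝 0)) :
    (fun y => profileSlope m (k + (N + q)) c f Φ y + k * f y ^ m) =O[atBot] f := by
  have htheta := isTheta_exp_of_tendsto hA.ne' hlim
  have hpow : (fun y => f y ^ p) =O[atBot] f := by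
    refine .of_bound 1 ?_
    filter_upwards [(tendsto_atTop_of_tendsto_exp_mul hq hA hlim).eventually_ge_atTop 1] with y hy
    have hy0 : 0 ≤ f y := h.nonneg y
    rw [one_mul, Real.norm_of_nonneg (by positivity), Real.norm_of_nonneg hy0]
    exact Real.rpow_le_self_of_one_le hy hp
  have hexp : ∀ y : ℝ, Real.exp ((N + q) * y) * Real.exp (-q * y) = Real.exp (N * y) := fun y => by
    rw [← Real.exp_add]
    congr 1
    ring
  have hderiv : (fun y => Real.exp ((N + q) * y) * ((N + q) * c * f y - f y ^ p))
      =O[atBot] fun y => Real.exp (N * y) := by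
    simp only [← hexp]
    exact (Asymptotics.isBigO_refl _ _).mul
      ((((Asymptotics.isBigO_refl f _).const_mul_left _).sub hpow).trans htheta.1)
  have hE := isBigO_exp_of_hasDerivAt hN h.hasDerivAt_exp_mul_flux_sub hderiv hflux
  have hΦ : (fun y => Φ y - (N + q) * f y ^ m) =O[atBot] f := by
    refine Asymptotics.IsBigO.trans ?_ htheta.2
    refine ((Asymptotics.isBigO_refl (fun y => Real.exp (-(N + q) * y)) atBot).mul hE).congr
      (fun y => ?_) fun y => ?_
    · rw [← mul_assoc, ← Real.exp_add, neg_mul, neg_add_cancel, Real.exp_zero, one_mul]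
    · rw [← Real.exp_add]
      congr 1
      ring
  refine (hΦ.sub ((Asymptotics.isBigO_refl f _).const_mul_left c)).congr_left fun y => ?_
  rw [profileSlope]
  ring

end PhasePlane

section Regular

variable {m p N c y₀ : ℝ} {f Φ : ℝ → ℝ}

theorem tendsto_exp_mul_flux_sub {A : ℝ}
    (h : IsProfile m p (rootK m + rootL m N) (rootK m * rootL m N) c f Φ) (hm : 1 < m)
    (hN : 0 < N) (hI : HasInterfaceAt f y₀) (hA : A ≠ 0)
    (hlim : Tendsto (fun y => Real.exp (2 / (m - 1) * y) * f y) atBot (𝓝 A))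
    (hflux : Tendsto (fun ξ => ξ ^ (N - 1) * deriv (radialProfile m f) ξ) (𝓝[>] 0) (𝓝 0)) :
    Tendsto (fun y => Real.exp (rootL m N * y) * (Φ y - rootL m N * f y ^ m)) atBot (𝓝 0) := by
  have hm0 : m ≠ 0 := by linarith
  have hslope : Tendsto (fun y => Real.exp (rootL m N * y) * (rootK m * f y ^ m
      + profileSlope m (rootK m + rootL m N) c f Φ y)) atBot (𝓝 (m * A ^ (m - 1) * 0)) := by
    refine (((hlim.rpow_const (p := m - 1) (.inl hA)).const_mul m).mul
      (Real.tendsto_comp_exp_atBot.2 hflux)).congr' ?_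
    filter_upwards [eventually_lt_atBot y₀] with y hy
    have hfy := hI.1 y hy
    rw [radial_flux_eq hm hfy (h.hasDerivAt hm0 hfy), mul_div_cancel₀ _ (by positivity)]
  have hlow : Tendsto (fun y => Real.exp (N * y) * (Real.exp (2 / (m - 1) * y) * f y)) atBot
      (𝓝 (0 * A)) := (tendsto_exp_mul_atBot hN).mul hlim
  have hsum := hslope.add (hlow.const_mul c)
  simp only [zero_mul, mul_zero, add_zero] at hsum
  refine hsum.congr fun y => ?_
  rw [← mul_assoc (Real.exp (N * y)), ← Real.exp_add, ← add_mul, ← rootL, profileSlope]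
  ring

theorem exists_isOrbit (h : IsProfile m p (rootK m + rootL m N) (rootK m * rootL m N) c f Φ)
    (H : Admissible m p (rootK m) (rootL m N)) (hN : 0 < N) (hI : HasInterfaceAt f y₀)
    (hR : RegularAtOrigin m N f) :
    ∃ P : ℝ → ℝ, IsOrbit m p (rootK m) (rootL m N) c P ∧ IsGoodAtInfinity m (rootK m) P ∧
      Tendsto P (𝓝[>] 0) (𝓝 0) ∧
      ∀ y, y < y₀ → P (f y) = -profileSlope m (rootK m + rootL m N) c f Φ y := by
  obtain ⟨⟨A, hA, hFA⟩, -, hflux⟩ := hR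
  have hm0 : 0 < m := zero_lt_one.trans H.one_lt
  have hq : 0 < 2 / (m - 1) := div_pos two_pos (sub_pos.2 H.one_lt)
  have hlim : Tendsto (fun y => Real.exp (2 / (m - 1) * y) * f y) atBot (𝓝 A) := by
    simpa only [radialProfile_exp] using Real.tendsto_comp_exp_atBot.2 hFA
  have htop := tendsto_atTop_of_tendsto_exp_mul hq hA hlim
  obtain ⟨Z, hZ, hZf, hZbot⟩ := exists_inverse_of_strictAntiOn hI (h.strictAntiOn H hI htop)
    (surjOn_of_hasInterfaceAt h.continuous hI htop)
  have hP := h.isOrbit_neg_slope_comp hm0 (fun s hs => (hZ s hs).2)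
    fun s hs => h.slope_neg H hI htop (hZ s hs).1
  refine ⟨_, hP, ?good, ?zero, fun y hy => by rw [hZf y hy]⟩
  case good =>
    have hbound := ((h.isBigO_slope_add H.p_lt.le hN hq hA hlim
      (h.tendsto_exp_mul_flux_sub H.one_lt hN hI hA.ne' hlim hflux)).comp_tendsto hZbot).neg_left
    refine hbound.congr' ?_ ?_ <;> filter_upwards [eventually_gt_atTop 0] with s hs
    · simp only [Function.comp_apply, (hZ s hs).2.1, rootL]
      ring
    · exact (hZ s hs).2.1
  case zero =>
    refine tendsto_zero_of_le_rpow_add (m := m) (C := rootK m + rootL m N) (D := c) hm0 hP.pos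
      (eventually_mem_nhdsWithin.mono fun s hs => ?_)
    have hΦ := h.flux_pos hm0.ne' (mul_pos H.k_pos H.l_pos) hI (hZ s hs).1
    rw [profileSlope, (hZ s hs).2.1]
    linarith

theorem tendsto_goodOrbit (h : IsProfile m p (rootK m + rootL m N) (rootK m * rootL m N) c f Φ)
    (H : Admissible m p (rootK m) (rootL m N)) (hN : 0 < N) (hc : 0 < c)
    (hI : HasInterfaceAt f y₀) (hR : RegularAtOrigin m N f) :
    Tendsto (goodOrbit m p (rootK m) (rootL m N) c) (𝓝[>] 0) (𝓝 0) := by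
  obtain ⟨P, hP, hgood, h0, -⟩ := h.exists_isOrbit H hN hI hR
  exact h0.congr' (eventually_mem_nhdsWithin.mono fun s hs => hP.eq_goodOrbit H hc hgood hs)

theorem followsOrbit_goodOrbit
    (h : IsProfile m p (rootK m + rootL m N) (rootK m * rootL m N) c f Φ)
    (H : Admissible m p (rootK m) (rootL m N)) (hN : 0 < N) (hc : 0 < c)
    (hI : HasInterfaceAt f y₀) (hR : RegularAtOrigin m N f) :
    FollowsOrbit m (goodOrbit m p (rootK m) (rootL m N) c) f y₀ where
  continuous := h.continuous
  hasInterfaceAt := hI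
  hasDerivAt y hy := by
    obtain ⟨P, hP, hgood, -, hPf⟩ := h.exists_isOrbit H hN hI hR
    rw [← hP.eq_goodOrbit H hc hgood (hI.1 y hy), hPf y hy, neg_neg]
    exact h.hasDerivAt (zero_lt_one.trans H.one_lt).ne' (hI.1 y hy)

end Regular

end IsProfile

/-! ### Waves following an orbit -/

section TravelTime

variable {m p δ : ℝ} {P : ℝ → ℝ}

/-- The reciprocal of the speed `P t / (m t ^ (m - 1))` at which a wave following the orbit `P`
passes the value `t`, extended by `1` to `t ≤ 0` so that its primitive is a bijection of `ℝ`. -/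
def slowness (m : ℝ) (P : ℝ → ℝ) (t : ℝ) : ℝ := if t ≤ 0 then 1 else m * t ^ (m - 1) / P t

theorem slowness_of_nonpos {t : ℝ} (ht : t ≤ 0) : slowness m P t = 1 := if_pos ht

theorem slowness_of_pos {t : ℝ} (ht : 0 < t) : slowness m P t = m * t ^ (m - 1) / P t :=
  if_neg ht.not_ge

theorem slowness_pos (hm : 0 < m) (hpos : ∀ s, 0 < s → 0 < P s) (t : ℝ) : 0 < slowness m P t := by
  rcases le_or_gt t 0 with ht | ht
  · rw [slowness_of_nonpos ht]
    exact one_pos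
  · rw [slowness_of_pos ht]
    have := hpos t ht
    positivity

theorem continuousAt_slowness (hpos : ∀ s, 0 < s → 0 < P s) (hP : ContinuousOn P (Set.Ioi 0))
    {t : ℝ} (ht : t ≠ 0) : ContinuousAt (slowness m P) t := by
  rcases ht.lt_or_gt with ht | ht
  · refine (continuousAt_const (y := (1 : ℝ))).congr ?_
    filter_upwards [Iio_mem_nhds ht] with x hx using (slowness_of_nonpos (le_of_lt hx)).symm
  · have hquot : ContinuousAt (fun t => m * t ^ (m - 1) / P t) t :=
      (continuousAt_const.mul (Real.continuousAt_rpow_const _ _ (Or.inl ht.ne'))).div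
        (hP.continuousAt (Ioi_mem_nhds ht)) (hpos t ht).ne'
    refine hquot.congr ?_
    filter_upwards [Ioi_mem_nhds ht] with x hx using (slowness_of_pos hx).symm

theorem measurable_slowness (hpos : ∀ s, 0 < s → 0 < P s) (hP : ContinuousOn P (Set.Ioi 0)) :
    Measurable (slowness m P) :=
  measurable_of_continuousOn_compl_singleton 0 fun _ ht =>
    (continuousAt_slowness hpos hP ht).continuousWithinAt

theorem slowness_le (hm : 0 < m) (hδ : 0 < δ) (hδP : ∀ s, 0 < s → δ * s ^ (m + p - 1) ≤ P s)
    (t : ℝ) : slowness m P t ≤ 1 + m / δ * |t ^ (-p)| := by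
  rcases le_or_gt t 0 with ht | ht
  · rw [slowness_of_nonpos ht]
    exact le_add_of_nonneg_right (by positivity)
  · rw [slowness_of_pos ht, abs_of_pos (by positivity)]
    have hsplit : t ^ (m - 1) = t ^ (m + p - 1) * t ^ (-p) := by
      rw [← Real.rpow_add ht]
      congr 1
      ring
    calc m * t ^ (m - 1) / P t
        ≤ m * t ^ (m - 1) / (δ * t ^ (m + p - 1)) := by
          have := hδP t ht
          gcongr
      _ = m / δ * t ^ (-p) := by
          rw [hsplit]
          field_simp
      _ ≤ 1 + m / δ * t ^ (-p) := le_add_of_nonneg_left zero_le_one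

theorem intervalIntegrable_slowness (hm : 0 < m) (hp : p < 1) (hpos : ∀ s, 0 < s → 0 < P s)
    (hP : ContinuousOn P (Set.Ioi 0)) (hδ : 0 < δ)
    (hδP : ∀ s, 0 < s → δ * s ^ (m + p - 1) ≤ P s) (a b : ℝ) :
    IntervalIntegrable (slowness m P) volume a b := by
  have hbound : IntervalIntegrable (fun t : ℝ => 1 + m / δ * |t ^ (-p)|) volume a b :=
    intervalIntegrable_const.add
      ((intervalIntegral.intervalIntegrable_rpow' (by linarith)).abs.const_mul _)
  refine hbound.mono_fun' (measurable_slowness hpos hP).aestronglyMeasurable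
    (Eventually.of_forall fun t => ?_)
  simpa only [Real.norm_of_nonneg (slowness_pos hm hpos t).le] using slowness_le hm hδ hδP t

theorem tendsto_atTop_of_mul_inv_le_hasDerivAt {u u' : ℝ → ℝ} {C : ℝ} (hC : 0 < C)
    (hd : ∀ s, 0 < s → HasDerivAt u (u' s) s) (hu : ∀ᶠ s in atTop, C * s⁻¹ ≤ u' s) :
    Tendsto u atTop atTop := by
  obtain ⟨S, hS⟩ := eventually_atTop.1 (hu.and (eventually_gt_atTop 0))
  have hdiff : ∀ t, S ≤ t → HasDerivAt (fun s => u s - C * Real.log s) (u' t - C * t⁻¹) t :=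
    fun t ht => (hd t (hS t ht).2).sub ((Real.hasDerivAt_log (hS t ht).2.ne').const_mul C)
  refine tendsto_atTop_mono' _ ?_ (tendsto_atTop_add_const_left _ (u S - C * Real.log S)
    (Real.tendsto_log_atTop.const_mul_atTop hC))
  filter_upwards [eventually_ge_atTop S] with s hs
  have := le_of_hasDerivAt_nonneg hs
    (fun t ht => (hdiff t ht.1).continuousAt.continuousWithinAt)
    (fun t ht => hdiff t ht.1.le) fun t ht => sub_nonneg.2 (hS t ht.1.le).1
  linarith

/-- `Y s` is the distance to the interface of the point where a wave following the orbit `P` takes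
the value `s`, and `W` is the inverse function. Negative arguments carry no information: they are
there to make `Y` and `W` bijections of `ℝ`. -/
structure IsTravelTime (m : ℝ) (P Y W : ℝ → ℝ) : Prop where
  continuous : Continuous Y
  continuous_inv : Continuous W
  strictMono : StrictMono Y
  zero : Y 0 = 0
  inv_apply : ∀ s, W (Y s) = s
  apply_inv : ∀ y, Y (W y) = y
  hasDerivAt : ∀ s, 0 < s → HasDerivAt Y (m * s ^ (m - 1) / P s) s

theorem IsGoodAtInfinity.exists_eventually_mul_inv_le {k : ℝ} (hg : IsGoodAtInfinity m k P)
    (hm : 1 < m) (hk : 0 ≤ k) (hpos : ∀ s, 0 < s → 0 < P s) :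
    ∃ C > 0, ∀ᶠ s in atTop, C * s⁻¹ ≤ m * s ^ (m - 1) / P s := by
  refine ⟨m / (k + 1), by positivity, ?_⟩
  filter_upwards [hg.eventually_le hm one_pos, eventually_gt_atTop 0] with s hPs hs
  rw [le_div_iff₀ (hpos s hs)]
  calc m / (k + 1) * s⁻¹ * P s ≤ m / (k + 1) * s⁻¹ * ((k + 1) * s ^ m) := by gcongr
    _ = m * s ^ (m - 1) := by
      rw [← rpow_sub_one_mul hs m]
      field_simp

theorem exists_isTravelTime {k l c : ℝ} (H : Admissible m p k l) (h : IsOrbit m p k l c P)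
    (hg : IsGoodAtInfinity m k P) (hδ : 0 < δ) (hδP : ∀ s, 0 < s → δ * s ^ (m + p - 1) ≤ P s) :
    ∃ Y W, IsTravelTime m P Y W := by
  have hm := zero_lt_one.trans H.one_lt
  have hint := intervalIntegrable_slowness hm H.p_lt h.pos h.continuousOn hδ hδP
  set Y : ℝ → ℝ := fun s => ∫ t in (0 : ℝ)..s, slowness m P t
  have hcont : Continuous Y := intervalIntegral.continuous_primitive hint 0
  have hmono : StrictMono Y := fun a b hab => by
    rw [← sub_pos, intervalIntegral.integral_interval_sub_left (hint 0 b) (hint 0 a)]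
    exact intervalIntegral.intervalIntegral_pos_of_pos (hint a b) (slowness_pos hm h.pos) hab
  have hderiv : ∀ s, 0 < s → HasDerivAt Y (m * s ^ (m - 1) / P s) s := fun s hs => by
    rw [← slowness_of_pos hs]
    exact intervalIntegral.integral_hasDerivAt_right (hint 0 s)
      (measurable_slowness h.pos h.continuousOn).stronglyMeasurable.stronglyMeasurableAtFilter
      (continuousAt_slowness h.pos h.continuousOn hs.ne')
  have hbot : Tendsto Y atBot atBot := by
    refine tendsto_id.congr' ?_
    filter_upwards [eventually_le_atBot (0 : ℝ)] with s hs
    have hone : Y s = ∫ _ in (0 : ℝ)..s, (1 : ℝ) :=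
      intervalIntegral.integral_congr fun t ht =>
        slowness_of_nonpos (Set.uIcc_of_ge hs ▸ ht).2
    rw [hone, intervalIntegral.integral_const, sub_zero, smul_eq_mul, mul_one, id]
  have htop : Tendsto Y atTop atTop := by
    obtain ⟨C, hC, hCP⟩ := hg.exists_eventually_mul_inv_le H.one_lt H.k_pos.le h.pos
    exact tendsto_atTop_of_mul_inv_le_hasDerivAt hC hderiv hCP
  let e := hmono.orderIsoOfSurjective Y (hcont.surjective htop hbot)
  exact ⟨Y, e.symm, hcont, e.symm.continuous, hmono, intervalIntegral.integral_same,
    e.symm_apply_apply, e.apply_symm_apply, hderiv⟩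

end TravelTime

namespace IsTravelTime

variable {m : ℝ} {P Y W : ℝ → ℝ}

theorem inv_nonpos (hT : IsTravelTime m P Y W) {y : ℝ} (hy : y ≤ 0) : W y ≤ 0 :=
  hT.strictMono.le_iff_le.1 (by rwa [hT.apply_inv, hT.zero])

theorem inv_pos (hT : IsTravelTime m P Y W) {y : ℝ} (hy : 0 < y) : 0 < W y :=
  hT.strictMono.lt_iff_lt.1 (by rwa [hT.apply_inv, hT.zero])

theorem apply_add_eq (hT : IsTravelTime m P Y W) (hm : 0 < m) (hpos : ∀ s, 0 < s → 0 < P s)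
    {f : ℝ → ℝ} {y₀ : ℝ} (hf : FollowsOrbit m P f y₀) {y : ℝ} (hy : y ≤ y₀) :
    Y (f y) + y = y₀ := by
  have hder : ∀ z, z < y₀ → HasDerivAt (fun z => Y (f z) + z) 0 z := fun z hz => by
    have hfz := hf.hasInterfaceAt.1 z hz
    have hPz := hpos _ hfz
    refine ((HasDerivAt.comp z (hT.hasDerivAt _ hfz) (hf.hasDerivAt z hz)).add
      (hasDerivAt_id z)).congr_deriv ?_
    have : 0 < f z ^ (m - 1) := by positivity
    field_simp
    ring
  have hcont : Continuous fun z => Y (f z) + z :=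
    (hT.continuous.comp hf.continuous).add continuous_id
  have hconst := constant_of_has_deriv_right_zero (a := y) (b := y₀) hcont.continuousOn
    (fun z hz => (hder z hz.2).hasDerivWithinAt) y₀ (Set.right_mem_Icc.2 hy)
  simpa only [hf.hasInterfaceAt.2 y₀ le_rfl, hT.zero, zero_add] using hconst.symm

theorem eq_max_inv (hT : IsTravelTime m P Y W) (hm : 0 < m) (hpos : ∀ s, 0 < s → 0 < P s)
    {f : ℝ → ℝ} {y₀ : ℝ} (hf : FollowsOrbit m P f y₀) (y : ℝ) : f y = max 0 (W (y₀ - y)) := by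
  rcases lt_or_ge y y₀ with hy | hy
  · rw [← hT.apply_add_eq hm hpos hf hy.le, add_sub_cancel_right, hT.inv_apply,
      max_eq_right (hf.hasInterfaceAt.1 y hy).le]
  · rw [hf.hasInterfaceAt.2 y hy, max_eq_left (hT.inv_nonpos (by linarith))]

theorem max_inv_neg (hT : IsTravelTime m P Y W) {y : ℝ} (hy : y < 0) :
    max 0 (W (-y)) = W (-y) := max_eq_right (hT.inv_pos (neg_pos.2 hy)).le

theorem followsOrbit (hT : IsTravelTime m P Y W) (hm : 0 < m) (hpos : ∀ s, 0 < s → 0 < P s) :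
    FollowsOrbit m P (fun y => max 0 (W (-y))) 0 where
  continuous := continuous_const.max (hT.continuous_inv.comp continuous_neg)
  hasInterfaceAt := ⟨fun _ hy => lt_max_of_lt_right (hT.inv_pos (neg_pos.2 hy)),
    fun _ hy => max_eq_left (hT.inv_nonpos (neg_nonpos.2 hy))⟩
  hasDerivAt y hy := by
    have hW := hT.inv_pos (neg_pos.2 hy)
    have hPW := hpos _ hW
    have hinv : HasDerivAt W (m * W (-y) ^ (m - 1) / P (W (-y)))⁻¹ (-y) :=
      (hT.hasDerivAt _ hW).of_local_left_inverse hT.continuous_inv.continuousAt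
        (by positivity) (Eventually.of_forall hT.apply_inv)
    rw [hT.max_inv_neg hy]
    refine ((hinv.comp y (hasDerivAt_neg y)).congr_deriv ?_).congr_of_eventuallyEq ?_
    · rw [inv_div, mul_neg_one, neg_div]
    · filter_upwards [Iio_mem_nhds hy] with x hx using hT.max_inv_neg hx

end IsTravelTime

theorem hasDerivAt_of_hasDerivAt_left {u g : ℝ → ℝ} {y₀ : ℝ} (hu : ContinuousAt u y₀)
    (hg : ContinuousAt g y₀) (hleft : ∀ y, y < y₀ → HasDerivAt u (g y) y)
    (hu0 : ∀ y, y₀ ≤ y → u y = 0) (hg0 : ∀ y, y₀ ≤ y → g y = 0) (y : ℝ) :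
    HasDerivAt u (g y) y := by
  refine hasDerivAt_of_hasDerivAt_of_ne' (fun z hz => ?_) hu hg y
  rcases hz.lt_or_gt with hz | hz
  · exact hleft z hz
  · rw [hg0 z hz.le]
    refine (hasDerivAt_const z (0 : ℝ)).congr_of_eventuallyEq ?_
    filter_upwards [Ioi_mem_nhds hz] with x hx using hu0 x (le_of_lt hx)

theorem continuousAt_indicator_Ioi {P : ℝ → ℝ} (h0 : Tendsto P (𝓝[>] 0) (𝓝 0)) :
    ContinuousAt ((Set.Ioi 0).indicator P) 0 := by
  rw [ContinuousAt, Set.indicator_of_notMem Set.self_notMem_Ioi]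
  nth_rewrite 1 [← nhdsLE_sup_nhdsGT]
  rw [tendsto_sup]
  refine ⟨tendsto_const_nhds.congr' ?_, h0.congr' ?_⟩
  · filter_upwards [self_mem_nhdsWithin] with x hx
    exact (Set.indicator_of_notMem (Set.notMem_Ioi.2 hx) P).symm
  · filter_upwards [self_mem_nhdsWithin] with x hx
    exact (Set.indicator_of_mem hx P).symm

namespace FollowsOrbit

variable {m p k l c y₀ : ℝ} {P f : ℝ → ℝ}

theorem nonneg (hf : FollowsOrbit m P f y₀) (y : ℝ) : 0 ≤ f y := by
  rcases lt_or_ge y y₀ with hy | hy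
  · exact (hf.hasInterfaceAt.1 y hy).le
  · exact (hf.hasInterfaceAt.2 y hy).ge

theorem tendsto_nhdsLT (hf : FollowsOrbit m P f y₀) : Tendsto f (𝓝[<] y₀) (𝓝[>] 0) := by
  refine tendsto_nhdsWithin_iff.2
    ⟨?_, eventually_mem_nhdsWithin.mono fun y hy => hf.hasInterfaceAt.1 y hy⟩
  have h := hf.continuous.tendsto y₀
  rw [hf.hasInterfaceAt.2 y₀ le_rfl] at h
  exact h.mono_left nhdsWithin_le_nhds

theorem continuousAt_indicator_comp (hf : FollowsOrbit m P f y₀)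
    (h0 : Tendsto P (𝓝[>] 0) (𝓝 0)) :
    ContinuousAt (fun y => (Set.Ioi 0).indicator P (f y)) y₀ :=
  ContinuousAt.comp' (by
    rw [hf.hasInterfaceAt.2 y₀ le_rfl]
    exact continuousAt_indicator_Ioi h0) hf.continuous.continuousAt

theorem indicator_of_lt (hf : FollowsOrbit m P f y₀) {y : ℝ} (hy : y < y₀) :
    (Set.Ioi 0).indicator P (f y) = P (f y) :=
  Set.indicator_of_mem (hf.hasInterfaceAt.1 y hy) P

theorem indicator_of_le (hf : FollowsOrbit m P f y₀) {y : ℝ} (hy : y₀ ≤ y) :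
    (Set.Ioi 0).indicator P (f y) = 0 := by
  rw [hf.hasInterfaceAt.2 y hy]
  exact Set.indicator_of_notMem Set.self_notMem_Ioi P

theorem hasDerivAt_pow (hf : FollowsOrbit m P f y₀) (hm : 0 < m)
    (h0 : Tendsto P (𝓝[>] 0) (𝓝 0)) (y : ℝ) :
    HasDerivAt (fun y => f y ^ m) (-(Set.Ioi 0).indicator P (f y)) y := by
  refine hasDerivAt_of_hasDerivAt_left (u := fun y => f y ^ m)
    (g := fun y => -(Set.Ioi 0).indicator P (f y)) (y₀ := y₀)
    (hf.continuous.rpow_const fun _ => .inr hm.le).continuousAt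
    (hf.continuousAt_indicator_comp h0).neg (fun y hy => ?_)
    (fun y hy => by rw [hf.hasInterfaceAt.2 y hy, Real.zero_rpow hm.ne'])
    (fun y hy => by rw [hf.indicator_of_le hy, neg_zero]) y
  have hfy := hf.hasInterfaceAt.1 y hy
  have : 0 < f y ^ (m - 1) := by positivity
  refine ((hf.hasDerivAt y hy).rpow_const (.inl hfy.ne')).congr_deriv ?_
  rw [hf.indicator_of_lt hy]
  field_simp

theorem hasDerivAt_flux (hf : FollowsOrbit m P f y₀) (hm : 0 < m) (hp : 0 < p)
    (h : IsOrbit m p k l c P) (h0 : Tendsto P (𝓝[>] 0) (𝓝 0)) (y : ℝ) :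
    HasDerivAt (fun y => (k + l) * f y ^ m + c * f y - (Set.Ioi 0).indicator P (f y))
      (-(k * l * f y ^ m + f y ^ p)) y := by
  have hpow : ∀ {q : ℝ}, 0 < q → ContinuousAt (fun y => f y ^ q) y₀ := fun hq =>
    (hf.continuous.rpow_const fun _ => .inr hq.le).continuousAt
  refine hasDerivAt_of_hasDerivAt_left
    (u := fun y => (k + l) * f y ^ m + c * f y - (Set.Ioi 0).indicator P (f y))
    (g := fun y => -(k * l * f y ^ m + f y ^ p)) (y₀ := y₀)
    ((((hpow hm).const_mul _).add (hf.continuous.continuousAt.const_mul _)).sub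
      (hf.continuousAt_indicator_comp h0))
    (((hpow hm).const_mul _).add (hpow hp)).neg (fun y hy => ?_)
    (fun y hy => by
      rw [hf.indicator_of_le hy, hf.hasInterfaceAt.2 y hy, Real.zero_rpow hm.ne']
      ring)
    (fun y hy => by
      rw [hf.hasInterfaceAt.2 y hy, Real.zero_rpow hm.ne', Real.zero_rpow hp.ne']
      ring) y
  have hfy := hf.hasInterfaceAt.1 y hy
  have hPy := h.pos _ hfy
  have : 0 < f y ^ (m - 1) := by positivity
  refine (((h.hasDerivAt_flux hfy).comp y (hf.hasDerivAt y hy)).congr_deriv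
    ?_).congr_of_eventuallyEq ?_
  · field_simp
  · filter_upwards [Iio_mem_nhds hy] with x hx
    rw [hf.indicator_of_lt hx, Function.comp_apply]

theorem exists_isProfile (hf : FollowsOrbit m P f y₀) (hm : 0 < m) (hp : 0 < p)
    (h : IsOrbit m p k l c P) (h0 : Tendsto P (𝓝[>] 0) (𝓝 0)) :
    ∃ Φ, IsProfile m p (k + l) (k * l) c f Φ :=
  ⟨_, hf.continuous, hf.nonneg,
    fun y => (hf.hasDerivAt_pow hm h0 y).congr_deriv (by unfold profileSlope; ring),
    hf.hasDerivAt_flux hm hp h h0⟩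

theorem hasDerivAt_rpow (hf : FollowsOrbit m P f y₀) (q : ℝ) {y : ℝ} (hy : y < y₀) :
    HasDerivAt (fun y => f y ^ q) (-(q / m * (P (f y) * f y ^ (q - m)))) y := by
  have hfy := hf.hasInterfaceAt.1 y hy
  refine ((hf.hasDerivAt y hy).rpow_const (.inl hfy.ne')).congr_deriv ?_
  have hsplit : f y ^ (q - 1) = f y ^ (q - m) * f y ^ (m - 1) := by
    rw [← Real.rpow_add hfy, sub_add_sub_cancel]
  have : 0 < f y ^ (m - 1) := by positivity
  rw [hsplit]
  field_simp

theorem tendsto_rpow_div_sub (hf : FollowsOrbit m P f y₀) {q B : ℝ} (hq : 0 < q)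
    (hP : Tendsto (fun s => P s * s ^ (q - m)) (𝓝[>] 0) (𝓝 B)) :
    Tendsto (fun y => f y ^ q / (y₀ - y)) (𝓝[<] y₀) (𝓝 (q / m * B)) := by
  have hlin : ∀ y, HasDerivAt (fun y => y₀ - y) (-1) y := fun y =>
    (hasDerivAt_id' y).const_sub y₀
  have hlin0 : Tendsto (fun y => y₀ - y) (𝓝[<] y₀) (𝓝 0) :=
    (sub_self y₀ ▸ (hlin y₀).continuousAt.tendsto).mono_left nhdsWithin_le_nhds
  refine HasDerivAt.lhopital_zero_nhdsLT (eventually_mem_nhdsWithin.mono fun y hy =>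
    hf.hasDerivAt_rpow q hy) (.of_forall hlin) (.of_forall fun _ => by norm_num)
    ((tendsto_rpow_nhdsGT_zero hq).comp hf.tendsto_nhdsLT) hlin0 ?_
  simpa only [neg_div_neg_eq, div_one, Function.comp_def]
    using (hP.comp hf.tendsto_nhdsLT).const_mul (q / m)

theorem interfaceBehavior (hf : FollowsOrbit m P f y₀) (hm : 0 < m) {q B : ℝ} (hq : 0 < q)
    (hB : 0 < B) (hP : Tendsto (fun s => P s * s ^ (q - m)) (𝓝[>] 0) (𝓝 B)) :
    InterfaceBehavior f y₀ (1 / q) := by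
  have hC : 0 < q / m * B := by positivity
  refine ⟨(q / m * B) ^ (1 / q), by positivity,
    ((hf.tendsto_rpow_div_sub hq hP).rpow_const (p := 1 / q) (.inl hC.ne')).congr' ?_⟩
  filter_upwards [eventually_mem_nhdsWithin] with y hy
  rw [Real.div_rpow (Real.rpow_nonneg (hf.nonneg y) q) (sub_nonneg.2 (le_of_lt hy)),
    ← Real.rpow_mul (hf.nonneg y), mul_one_div_cancel hq.ne', Real.rpow_one]

end FollowsOrbit

/-! ### Regularity at the origin of waves following an orbit -/

section Regularity

variable {m k : ℝ} {P : ℝ → ℝ}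

theorem IsGoodAtInfinity.rpow_isBigO (hg : IsGoodAtInfinity m k P) (hm : 1 < m) (hk : 0 < k) :
    (fun s => s ^ m) =O[atTop] P := by
  obtain ⟨α, -, hα⟩ := isGoodAtInfinity_iff.1 hg
  refine .of_bound (2 / k) ?_
  filter_upwards [hα, eventually_mul_le_mul_rpow hm α (half_pos hk), eventually_gt_atTop 0]
    with s hPs hlin hs
  have hlower : k / 2 * s ^ m ≤ P s := by linarith [neg_abs_le (P s - k * s ^ m)]
  rw [Real.norm_of_nonneg (by positivity), div_mul_eq_mul_div, le_div_iff₀' hk]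
  linarith [Real.le_norm_self (P s)]

theorem IsGoodAtInfinity.isBigO_inv_sub (hg : IsGoodAtInfinity m k P) (hm : 1 < m) (hk : 0 < k)
    (hpos : ∀ s, 0 < s → 0 < P s) :
    (fun s => s⁻¹ - k / m * (m * s ^ (m - 1) / P s)) =O[atTop] fun s => s ^ (-m) := by
  have hinv : (fun s => (s * P s)⁻¹) =O[atTop] fun s => (s * s ^ m)⁻¹ :=
    ((Asymptotics.isBigO_refl _ _).mul (hg.rpow_isBigO hm hk)).inv_rev
      ((eventually_gt_atTop 0).mono fun s hs h => absurd h (by positivity))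
  refine (hg.mul hinv).congr' ?_ ?_
  · filter_upwards [eventually_gt_atTop 0] with s hs
    have := hpos s hs
    rw [← rpow_sub_one_mul hs m]
    field_simp
  · filter_upwards [eventually_gt_atTop 0] with s hs
    rw [Real.rpow_neg hs.le]
    field_simp

theorem IsTravelTime.exists_tendsto_log_sub {Y W : ℝ → ℝ} (hT : IsTravelTime m P Y W)
    (hg : IsGoodAtInfinity m k P) (hm : 1 < m) (hk : 0 < k) (hpos : ∀ s, 0 < s → 0 < P s)
    (hP : ContinuousOn P (Set.Ioi 0)) :
    ∃ L, Tendsto (fun s => Real.log s - k / m * Y s) atTop (𝓝 L) := by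
  have hIci : ∀ s ∈ Set.Ici (1 : ℝ), 0 < s := fun s hs => one_pos.trans_le hs
  have hcont : ContinuousOn (fun s => s⁻¹ - k / m * (m * s ^ (m - 1) / P s)) (Set.Ici 1) :=
    (continuousOn_inv₀.mono fun s hs => (hIci s hs).ne').sub
      ((((continuousOn_id.rpow_const fun s hs => .inl (hIci s hs).ne').const_mul m).div
        (hP.mono hIci) fun s hs => (hpos s (hIci s hs)).ne').const_mul _)
  have hint := (hcont.locallyIntegrableOn measurableSet_Ici).integrableOn_of_isBigO_atTop
    (hg.isBigO_inv_sub hm hk hpos) (integrableAtFilter_rpow_atTop_iff.2 (neg_lt_neg hm))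
  refine ⟨_, tendsto_limUnder_of_hasDerivAt_of_integrableOn_Ioi (fun s hs => ?_)
    (hint.mono_set Set.Ioi_subset_Ici_self)⟩
  have hs0 : 0 < s := one_pos.trans (Set.mem_Ioi.1 hs)
  exact (Real.hasDerivAt_log hs0.ne').sub ((hT.hasDerivAt s hs0).const_mul _)

namespace FollowsOrbit

variable {f : ℝ → ℝ} {y₀ : ℝ}

theorem exists_tendsto_exp_mul {Y W : ℝ → ℝ} (hf : FollowsOrbit m P f y₀)
    (hT : IsTravelTime m P Y W) (hg : IsGoodAtInfinity m k P) (hm : 1 < m) (hk : 0 < k)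
    (hpos : ∀ s, 0 < s → 0 < P s) (hP : ContinuousOn P (Set.Ioi 0)) :
    ∃ A > 0, Tendsto (fun y => Real.exp (k / m * y) * f y) atBot (𝓝 A) := by
  have htime : ∀ y, y < y₀ → Y (f y) = y₀ - y := fun y hy =>
    eq_sub_of_add_eq (hT.apply_add_eq (zero_lt_one.trans hm) hpos hf hy.le)
  have htop : Tendsto f atBot atTop := by
    refine tendsto_atTop.2 fun b => ?_
    filter_upwards [eventually_lt_atBot y₀, eventually_le_atBot (y₀ - Y b)] with y hy hb
    refine hT.strictMono.le_iff_le.1 ?_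
    rw [htime y hy]
    linarith
  obtain ⟨L, hL⟩ := hT.exists_tendsto_log_sub hg hm hk hpos hP
  refine ⟨Real.exp (L + k / m * y₀), Real.exp_pos _, ((Real.continuous_exp.tendsto _).comp
    ((hL.comp htop).add_const (k / m * y₀))).congr' ?_⟩
  filter_upwards [eventually_lt_atBot y₀] with y hy
  have hexponent : Real.log (f y) - k / m * Y (f y) + k / m * y₀
      = k / m * y + Real.log (f y) := by
    rw [htime y hy]
    ring
  rw [Function.comp_apply, Function.comp_apply, hexponent, Real.exp_add,
    Real.exp_log (hf.hasInterfaceAt.1 y hy)]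

theorem isBigO_mul_add {A q : ℝ} (hf : FollowsOrbit m P f y₀) (hg : IsGoodAtInfinity m (m * q) P)
    (hm : m ≠ 0) (hq : 0 < q) (hA : 0 < A)
    (hlim : Tendsto (fun y => Real.exp (q * y) * f y) atBot (𝓝 A)) :
    (fun y => q * f y + -P (f y) / (m * f y ^ (m - 1)))
      =O[atBot] fun y => Real.exp (-q * y) ^ (2 - m) := by
  have hquot : (fun s => (P s - m * q * s ^ m) * (s ^ (m - 1))⁻¹) =O[atTop]
      fun s => s ^ (2 - m) := by
    refine (hg.mul (Asymptotics.isBigO_refl (fun s => (s ^ (m - 1))⁻¹) atTop)).congr' .rfl ?_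
    filter_upwards [eventually_gt_atTop 0] with s hs
    rw [show 2 - m = 1 - (m - 1) by ring, Real.rpow_sub hs 1 (m - 1), Real.rpow_one, div_eq_mul_inv]
  have htheta : (fun y => f y ^ (2 - m)) =Θ[atBot] fun y => Real.exp (-q * y) ^ (2 - m) := by
    refine (isTheta_exp_of_tendsto hA.ne' hlim).rpow ?_ (.of_forall fun y => (Real.exp_pos _).le)
    exact .of_forall hf.nonneg
  have hcomp := (hquot.comp_tendsto (tendsto_atTop_of_tendsto_exp_mul hq hA hlim)).trans
    htheta.isBigO
  refine (hcomp.const_mul_left (-m⁻¹)).congr' ?_ .rfl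
  filter_upwards [eventually_lt_atBot y₀] with y hy
  have hfy := hf.hasInterfaceAt.1 y hy
  rw [Function.comp_apply, ← rpow_sub_one_mul hfy m]
  field_simp
  ring

theorem isBigO_exp_mul_deriv_radialProfile {A : ℝ} (hf : FollowsOrbit m P f y₀)
    (hg : IsGoodAtInfinity m (rootK m) P) (hm : 1 < m) (hA : 0 < A)
    (hlim : Tendsto (fun y => Real.exp (2 / (m - 1) * y) * f y) atBot (𝓝 A)) (r : ℝ) :
    (fun y => Real.exp ((r - 1) * y) * deriv (radialProfile m f) (Real.exp y))
      =O[atBot] fun y => Real.exp (r * y) := by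
  have hq : 0 < 2 / (m - 1) := div_pos two_pos (sub_pos.2 hm)
  have hmain := hf.isBigO_mul_add (rootK_eq m ▸ hg) (by linarith) hq hA hlim
  refine ((Asymptotics.isBigO_refl (fun y => Real.exp ((r - 1) * y)
    * Real.exp ((2 / (m - 1) - 1) * y)) atBot).mul hmain).congr' ?_ (.of_forall fun y => ?_)
  · filter_upwards [eventually_lt_atBot y₀] with y hy
    rw [(hasDerivAt_radialProfile (hf.hasDerivAt y hy)).deriv, mul_assoc]
  · have hqm : 2 / (m - 1) * (m - 1) = 2 := div_mul_cancel₀ _ (sub_ne_zero.2 hm.ne')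
    dsimp only
    rw [← Real.exp_mul, ← Real.exp_add, ← Real.exp_add]
    congr 1
    linear_combination y * hqm

theorem regularAtOrigin {N A : ℝ} (hf : FollowsOrbit m P f y₀)
    (hg : IsGoodAtInfinity m (rootK m) P) (hm : 1 < m) (hN : 0 < N) (hA : 0 < A)
    (hlim : Tendsto (fun y => Real.exp (2 / (m - 1) * y) * f y) atBot (𝓝 A)) :
    RegularAtOrigin m N f := by
  have hderiv : ∀ r : ℝ, 0 < r → Tendsto (fun y => Real.exp ((r - 1) * y)
      * deriv (radialProfile m f) (Real.exp y)) atBot (𝓝 0) := fun r hr =>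
    (hf.isBigO_exp_mul_deriv_radialProfile hg hm hA hlim r).trans_tendsto (tendsto_exp_mul_atBot hr)
  refine ⟨⟨A, hA, ?_⟩, ?_, ?_⟩ <;> rw [← Real.tendsto_comp_exp_atBot]
  · simpa only [radialProfile_exp] using hlim
  · simpa only [sub_self, zero_mul, Real.exp_zero, one_mul] using hderiv 1 one_pos
  · simpa only [← Real.exp_mul, mul_comm] using hderiv N hN

end FollowsOrbit

end Regularity

/-! ### Traveling waves -/

section Waves

variable {m p N c : ℝ} {f g : ℝ → ℝ}

theorem IsTravelingWave.exists_isProfile (h : IsTravelingWave m p N c f) (hm : 1 < m)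
    (hp : 0 < p) : ∃ Φ, IsProfile m p (rootK m + rootL m N) (rootK m * rootL m N) c f Φ := by
  rw [← convCoeff_eq hm, ← reactCoeff_eq hm]
  exact ((isTravelingWave_iff (zero_lt_one.trans hm) hp).1 h).2

theorem IsTravelingWave.exists_hasInterfaceAt (h : IsTravelingWave m p N c f) (hm : 1 < m)
    (hp0 : 0 < p) (hp1 : p < 1) (hN : 0 < N) : 0 < c ∧ ∃ y₀, HasInterfaceAt f y₀ := by
  have H := admissible_roots hm hp0 hp1 hN
  obtain ⟨Φ, hΦ⟩ := h.exists_isProfile hm hp0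
  exact hΦ.exists_hasInterfaceAt hm hp0 hp1 (add_pos H.k_pos H.l_pos) (mul_pos H.k_pos H.l_pos)
    h.ne_zero

theorem IsTravelingWave.two_le_add (h : IsTravelingWave m p N c f) (hm : 1 < m) (hp0 : 0 < p)
    (hp1 : p < 1) (hN : 0 < N) : 2 ≤ m + p := by
  have H := admissible_roots hm hp0 hp1 hN
  obtain ⟨Φ, hΦ⟩ := h.exists_isProfile hm hp0
  exact hΦ.two_le_add hm hp0 hp1 (add_pos H.k_pos H.l_pos) (mul_pos H.k_pos H.l_pos) h.ne_zero

theorem FollowsOrbit.isTravelingWave {y₀ : ℝ} {P : ℝ → ℝ} (hf : FollowsOrbit m P f y₀)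
    (h : IsOrbit m p (rootK m) (rootL m N) c P) (h0 : Tendsto P (𝓝[>] 0) (𝓝 0)) (hm : 1 < m)
    (hp : 0 < p) : IsTravelingWave m p N c f := by
  have hm0 := zero_lt_one.trans hm
  refine (isTravelingWave_iff hm0 hp).2 ⟨fun hzero => ?_, ?_⟩
  · exact (hf.hasInterfaceAt.1 (y₀ - 1) (sub_one_lt y₀)).ne' (congrFun hzero _)
  · rw [convCoeff_eq hm, reactCoeff_eq hm]
    exact hf.exists_isProfile hm0 hp h h0

theorem FollowsOrbit.isGoodTravelingWave {y₀ : ℝ} {P Y W : ℝ → ℝ} (hf : FollowsOrbit m P f y₀)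
    (hT : IsTravelTime m P Y W) (h : IsOrbit m p (rootK m) (rootL m N) c P)
    (hg : IsGoodAtInfinity m (rootK m) P) (h0 : Tendsto P (𝓝[>] 0) (𝓝 0))
    (H : Admissible m p (rootK m) (rootL m N)) (hN : 0 < N) : IsGoodTravelingWave m p N c f := by
  obtain ⟨A, hA, hlim⟩ :=
    hf.exists_tendsto_exp_mul hT hg H.one_lt H.k_pos h.pos h.continuousOn
  rw [rootK_eq, mul_div_cancel_left₀ _ (zero_lt_one.trans H.one_lt).ne'] at hlim
  exact ⟨hf.isTravelingWave h h0 H.one_lt H.p_pos, hf.regularAtOrigin hg H.one_lt hN hA hlim⟩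

theorem exists_isTravelTime_goodOrbit {k l : ℝ} (H : Admissible m p k l) (hc : 0 < c) :
    ∃ Y W, IsTravelTime m (goodOrbit m p k l c) Y W := by
  obtain ⟨δ, hδ, hδP⟩ := exists_forall_mul_rpow_le_goodOrbit H hc
  exact exists_isTravelTime H (isOrbit_goodOrbit H hc) (isGoodAtInfinity_goodOrbit H hc) hδ hδP

namespace IsGoodTravelingWave

theorem exists_followsOrbit (h : IsGoodTravelingWave m p N c f) (hm : 1 < m) (hp0 : 0 < p)
    (hp1 : p < 1) (hN : 0 < N) :
    0 < c ∧ Tendsto (goodOrbit m p (rootK m) (rootL m N) c) (𝓝[>] 0) (𝓝 0) ∧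
      ∃ y₀, FollowsOrbit m (goodOrbit m p (rootK m) (rootL m N) c) f y₀ := by
  have H := admissible_roots hm hp0 hp1 hN
  obtain ⟨hc, y₀, hI⟩ := h.1.exists_hasInterfaceAt hm hp0 hp1 hN
  obtain ⟨Φ, hΦ⟩ := h.1.exists_isProfile hm hp0
  exact ⟨hc, hΦ.tendsto_goodOrbit H hN hc hI h.2, y₀, hΦ.followsOrbit_goodOrbit H hN hc hI h.2⟩

theorem eq_translate (hf : IsGoodTravelingWave m p N c f) (hg : IsGoodTravelingWave m p N c g)
    (hm : 1 < m) (hp0 : 0 < p) (hp1 : p < 1) (hN : 0 < N) : ∃ h : ℝ, ∀ y : ℝ, g y = f (y + h) := by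
  have H := admissible_roots hm hp0 hp1 hN
  obtain ⟨hc, -, y₁, hf₁⟩ := hf.exists_followsOrbit hm hp0 hp1 hN
  obtain ⟨-, -, y₂, hg₂⟩ := hg.exists_followsOrbit hm hp0 hp1 hN
  obtain ⟨Y, W, hT⟩ := exists_isTravelTime_goodOrbit H hc
  have hm0 := zero_lt_one.trans hm
  have hpos := (isOrbit_goodOrbit H hc).pos
  refine ⟨y₁ - y₂, fun y => ?_⟩
  rw [hT.eq_max_inv hm0 hpos hg₂ y, hT.eq_max_inv hm0 hpos hf₁ (y + (y₁ - y₂)),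
    show y₁ - (y + (y₁ - y₂)) = y₂ - y by ring]

theorem hasTypeI
    (h : IsGoodTravelingWave m p N (criticalSpeed m p (rootK m) (rootL m N)) f)
    (hm : 1 < m) (hp0 : 0 < p) (hp1 : p < 1) (hN : 0 < N) (hmp : 2 < m + p) : HasTypeI m f := by
  have H := admissible_roots hm hp0 hp1 hN
  obtain ⟨hc, -, y₀, hf⟩ := h.exists_followsOrbit hm hp0 hp1 hN
  refine ⟨y₀, hf.hasInterfaceAt, hf.interfaceBehavior (zero_lt_one.trans hm) (sub_pos.2 hm) hc ?_⟩
  simpa only [sub_sub_cancel_left, Real.rpow_neg_one, div_eq_mul_inv]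
    using tendsto_goodOrbit_criticalSpeed_div H hmp

theorem hasTypeII (h : IsGoodTravelingWave m p N c f)
    (hlt : criticalSpeed m p (rootK m) (rootL m N) < c) (hm : 1 < m) (hp0 : 0 < p) (hp1 : p < 1)
    (hN : 0 < N) (hmp : 2 < m + p) : HasTypeII p f := by
  have H := admissible_roots hm hp0 hp1 hN
  have hm0 := zero_lt_one.trans hm
  obtain ⟨hc, -, y₀, hf⟩ := h.exists_followsOrbit hm hp0 hp1 hN
  refine ⟨y₀, hf.hasInterfaceAt, hf.interfaceBehavior hm0 (sub_pos.2 hp1) (div_pos hm0 hc)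
    ((tendsto_goodOrbit_div_rpow H hmp hlt).congr' ?_)⟩
  filter_upwards [self_mem_nhdsWithin] with s (hs : 0 < s)
  rw [show 1 - p - m = -(m + p - 1) by ring, Real.rpow_neg hs.le, div_eq_mul_inv]

end IsGoodTravelingWave

theorem exists_isGoodTravelingWave_iff (hm : 1 < m) (hp0 : 0 < p) (hp1 : p < 1) (hN : 0 < N)
    (hmp : 2 ≤ m + p) :
    (∃ f, IsGoodTravelingWave m p N c f) ↔ criticalSpeed m p (rootK m) (rootL m N) ≤ c := by
  have H := admissible_roots hm hp0 hp1 hN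
  constructor
  · rintro ⟨f, hf⟩
    obtain ⟨hc, h0, -⟩ := hf.exists_followsOrbit hm hp0 hp1 hN
    exact (tendsto_goodOrbit_zero_iff H hmp hc).1 h0
  · intro hle
    have hc := (criticalSpeed_pos H hmp).trans_le hle
    have horbit := isOrbit_goodOrbit H hc
    obtain ⟨Y, W, hT⟩ := exists_isTravelTime_goodOrbit H hc
    exact ⟨_, (hT.followsOrbit (zero_lt_one.trans hm) horbit.pos).isGoodTravelingWave hT horbit
      (isGoodAtInfinity_goodOrbit H hc) ((tendsto_goodOrbit_zero_iff H hmp hc).2 hle) H hN⟩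

end Waves

end

theorem theorem6p1 (m p N : ℝ) (hm : 1 < m) (hp0 : 0 < p) (hp1 : p < 1) (hN : 0 < N) :
    (2 ≤ m + p →
      ∃! cs : ℝ, 0 < cs ∧
        (∀ c : ℝ, (∃ f : ℝ → ℝ, IsGoodTravelingWave m p N c f) ↔ cs ≤ c) ∧
        (∀ (c : ℝ) (f g : ℝ → ℝ), IsGoodTravelingWave m p N c f →
          IsGoodTravelingWave m p N c g → ∃ h : ℝ, ∀ y : ℝ, g y = f (y + h)) ∧
        (∀ (c : ℝ) (f : ℝ → ℝ), IsGoodTravelingWave m p N c f →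
          ∃ y₀ : ℝ, HasInterfaceAt f y₀) ∧
        (2 < m + p →
          (∀ f : ℝ → ℝ, IsGoodTravelingWave m p N cs f → HasTypeI m f) ∧
          (∀ (c : ℝ) (f : ℝ → ℝ), cs < c → IsGoodTravelingWave m p N c f →
            HasTypeII p f))) ∧
    (m + p < 2 → ¬ ∃ (c : ℝ) (f : ℝ → ℝ), IsTravelingWave m p N c f) := by
  refine ⟨fun hmp => ?_, fun hlt ⟨c, f, hf⟩ => hlt.not_ge (hf.two_le_add hm hp0 hp1 hN)⟩
  have hiff : ∀ c : ℝ, (∃ f : ℝ → ℝ, IsGoodTravelingWave m p N c f) ↔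
      criticalSpeed m p (rootK m) (rootL m N) ≤ c := fun c =>
    exists_isGoodTravelingWave_iff hm hp0 hp1 hN hmp
  refine ⟨_, ⟨criticalSpeed_pos (admissible_roots hm hp0 hp1 hN) hmp, hiff,
    fun c f g hf hg => hf.eq_translate hg hm hp0 hp1 hN,
    fun c f hf => (hf.1.exists_hasInterfaceAt hm hp0 hp1 hN).2,
    fun hlt => ⟨fun f hf => hf.hasTypeI hm hp0 hp1 hN hlt,
      fun c f hc hf => hf.hasTypeII hc hm hp0 hp1 hN hlt⟩⟩, ?_⟩
  rintro cs ⟨-, hcs, -⟩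
  exact le_antisymm ((hcs _).1 ((hiff _).2 le_rfl)) ((hiff _).1 ((hcs _).2 le_rfl))
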